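/- Let $d\ge 1$, let $\lambda$ be a Lévy measure on $\mathbb R$ (so $\lambda(\{0\})=0$) such that $$\int_{\mathbb R}|z|^{1+\varepsilon}\,\lambda(dz)<\infty\ \text{ for some }\varepsilon>0\qquad\text{and}\qquad \int_{[-1,1]}|z\log|z||\,\lambda(dz)<\infty ,$$ let $m\in\mathbb R$ and $m_0=m-\int_{\mathbb R}z\,\lambda(dz)$. Let $\mu$ be a Poisson random measure on $(0,\infty)\times\mathbb R^d\times\mathbb R$ with intensity $dt\,dx\,\lambda(dz)$, and let $\Lambda(dt,dx)=m_0\,dt\,dx+\int_{\mathbb R}z\,\mu(dt,dx,dz)$ be the associated Lévy space-time white noise with mean $m$. Let $g(t,x)=(4\pi t)^{-d/2}e^{-|x|^2/(4t)}\mathbf 1_{t>0}$ be the heat kernel on $\mathbb R^d$, let $$Y(t,x)=\int_0^t\!\int_{\mathbb R^d}g(t-s,x-y)\,\Lambda(ds,dy)=m_0\int_0^t\!\int_{\mathbb R^d}g(t-s,x-y)\,dy\,ds+\int g(t-s,x-y)\,z\,\mathbf 1_{s<t}\,\mu(ds,dy,dz)$$ be the mild solution of the stochastic heat equation $\partial_tY=\Delta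 Y+\dot\Lambda$ on $(0,\infty)\times\mathbb R^d$ with $Y(0,\cdot)=0$, and put $Y_0(t)=Y(t,0)$. Let $f\colon(0,\infty)\to(0,\infty)$ be nondecreasing. Then, almost surely, the integrals defining $Y_0(t)$ converge absolutely for all $t>0$ simultaneously, and the following hold. 1. If $\int_1^\infty \frac{dt}{f(t)}=\infty$ and $\lambda((0,\infty))>0$ (resp. $\lambda((-\infty,0))>0$), then $\limsup_{t\to\infty}\frac{Y_0(t)}{f(t)}=\infty$ (resp. $\liminf_{t\to\infty}\frac{Y_0(t)}{f(t)}=-\infty$) almost surely. 2. If $\int_1^\infty \frac{dt}{f(t)}<\infty$, then $\lim_{t\to\infty}\frac{Y_0(t)}{f(t)}=0$ almost surely. 3. If $\lambda((0,\infty))=0$ (resp. $\lambda((-\infty,0))=0$), then $\limsup_{t\to\infty}\frac{Y_0(t)}{t}=m$ (resp. $\liminf_{t\to\infty}\frac{Y_0(t)}{t}=m$) almost surely. -/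

import Mathlib

open MeasureTheory ProbabilityTheory Filter Topology Set
open scoped ENNReal NNReal

noncomputable section

/-- The space `ℝ^d` with its Euclidean norm. -/
abbrev Space (d : ℕ) : Type := EuclideanSpace ℝ (Fin d)

/-- The heat kernel `g(t,x) = (4πt)^{-d/2} exp(-|x|²/(4t)) 1_{t>0}` on `ℝ^d`. -/
def heatKernel (d : ℕ) (t : ℝ) (x : Space d) : ℝ :=
  if 0 < t then (4 * Real.pi * t) ^ (-(d : ℝ) / 2) * Real.exp (-‖x‖ ^ 2 / (4 * t)) else 0

/-- `lam` is a Lévy measure on `ℝ`. -/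
structure IsLevyMeasure (lam : Measure ℝ) : Prop where
  zero_singleton : lam {0} = 0
  lintegral_min_lt_top : ∫⁻ z, ENNReal.ofReal (min 1 (z ^ 2)) ∂lam < ⊤

/-- Lebesgue measure `dt dx` on `(0,∞) × ℝ^d`, as a measure on `ℝ × ℝ^d`. -/
def spaceTimeVolume (d : ℕ) : Measure (ℝ × Space d) :=
  ((volume : Measure ℝ).restrict (Ioi 0)).prod volume

/-- The measure `dt dx lam(dz)` on `(0,∞) × ℝ^d × ℝ`, as a measure on `ℝ × ℝ^d × ℝ`. -/
def jumpIntensity (d : ℕ) (lam : Measure ℝ) : Measure (ℝ × Space d × ℝ) :=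
  ((volume : Measure ℝ).restrict (Ioi 0)).prod ((volume : Measure (Space d)).prod lam)

/-- `N` is a Poisson random measure on `E` with intensity measure `nu`, under `P`. -/
structure IsPoissonRandomMeasure {Ω E : Type*} [MeasurableSpace Ω] [MeasurableSpace E]
    (P : Measure Ω) (N : Ω → Measure E) (nu : Measure E) : Prop where
  measurable : Measurable N
  /-- `N(A)` is Poisson distributed with parameter `nu(A)` if this is finite. -/
  map_eq : ∀ A : Set E, MeasurableSet A → nu A < ⊤ →
    P.map (fun ω => N ω A)
      = (poissonMeasure (nu A).toNNReal).map (fun n : ℕ => (n : ℝ≥0∞))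
  /-- A Poisson variable with infinite parameter is almost surely infinite. -/
  ae_eq_top : ∀ A : Set E, MeasurableSet A → nu A = ⊤ → ∀ᵐ ω ∂P, N ω A = ⊤
  /-- The values on pairwise disjoint sets are independent. -/
  iIndepFun : ∀ A : ℕ → Set E, (∀ i, MeasurableSet (A i)) →
    Pairwise (fun i j => Disjoint (A i) (A j)) → iIndepFun (fun i ω => N ω (A i)) P

/-- The drift `m₀ = m - ∫ z lam(dz)` of a noise with mean `m` and Lévy measure `lam`. -/
def noiseDrift (m : ℝ) (lam : Measure ℝ) : ℝ := m - ∫ z, z ∂lam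

/-- The integral `∫ h dΛ` of a deterministic function `h` on `(0,∞) × ℝ^d` against the noise
`Λ(dt,dx) = m₀ dt dx + ∫ z N(dt,dx,dz)`, for one realization `N` of the jump measure. -/
def noiseIntegral {d : ℕ} (m₀ : ℝ) (N : Measure (ℝ × Space d × ℝ)) (h : ℝ × Space d → ℝ) : ℝ :=
  m₀ * (∫ q, h q ∂(spaceTimeVolume d)) + ∫ p, h (p.1, p.2.1) * p.2.2 ∂N

/-- Absolute convergence of both terms in `noiseIntegral`. -/
def NoiseIntegrable {d : ℕ} (N : Measure (ℝ × Space d × ℝ)) (h : ℝ × Space d → ℝ) : Prop :=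
  Integrable h (spaceTimeVolume d) ∧ Integrable (fun p => h (p.1, p.2.1) * p.2.2) N

/-- The integrand `(s,y) ↦ g(t-s, x-y)`; it vanishes for `s ≥ t`. -/
def mildKernel {d : ℕ} (t : ℝ) (x : Space d) (q : ℝ × Space d) : ℝ :=
  heatKernel d (t - q.1) (x - q.2)

/-- The mild solution `Y(t,x) = ∫_0^t ∫ g(t-s, x-y) Λ(ds,dy)` of the heat equation with
additive noise `Λ` (mean `m`, Lévy measure `lam`, jump measure `N`) and zero initial condition. -/
def mildSolution {d : ℕ} (m : ℝ) (lam : Measure ℝ) (N : Measure (ℝ × Space d × ℝ))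
    (t : ℝ) (x : Space d) : ℝ :=
  noiseIntegral (noiseDrift m lam) N (mildKernel t x)

end

/-!
The contribution of a jump `(s, y, z)` to `Y₀(t)` is `g(t - s, y) z`. It is of order `|z| / r ^ d`
when `‖y‖ ≤ r` and `t - s` is of order `r ^ 2`, and at most a multiple of `|z| / ‖y‖ ^ d` at any
time.

If `∫ 1 / f = ∞`, we may replace `f` by `max f id`. The jumps of size at least `δ` within distance
`r n` of the origin during `[n, n + 1]`, where `r n ^ d` is of order `1 / f n`, have total intensity
`∑ 1 / f n = ∞`. Hence one of them occurs at an arbitrarily late time, and pushes the solution above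
a multiple of `f`. The negative jumps are independent of it, and by Markov's inequality their
contribution at time `t` is at most `C t` with probability `1 - O(1 / C)`.

If `∫ 1 / f < ∞`, the contribution during `[n, n + 1]` of the jumps since time `n - 1` exceeds `b`
with probability `O(1 / b)`. This follows by separating the jumps that contribute more than `b` from
the others, to which a Chernoff bound applies, and then Borel–Cantelli with `b` of order `f n` shows
that these jumps contribute `o(f)`. The older jumps contribute `O(t)`, again by a Chernoff bound
once the finitely many jumps that may contribute more than `s ^ β`, for some `β < 1`, are removed;
and `t = o(f t)` by monotonicity of `f`.

If all jumps are negative, a lower Chernoff bound gives `liminf S(t) / t ≥ ∫ |z| λ(dz)` for the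
sum `S(t)` of their absolute contributions. Equality holds by Fatou's lemma, as `S(t)` has mean
`t ∫ |z| λ(dz)`. The mirrored claims follow by reflecting the jumps at zero.
-/

section PoissonDistribution

lemma lintegral_poissonMeasure (r : ℝ≥0) (g : ℕ → ℝ≥0∞) :
    ∫⁻ n, g n ∂(poissonMeasure r)
      = ∑' n : ℕ, ENNReal.ofReal (Real.exp (-r) * r ^ n / n.factorial) * g n := by
  simp only [poissonMeasure, lintegral_sum_measure, lintegral_smul_measure, lintegral_dirac,
    smul_eq_mul]

lemma lintegral_natCast_poissonMeasure (r : ℝ≥0) :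
    ∫⁻ n : ℕ, (n : ℝ≥0∞) ∂(poissonMeasure r) = r := by
  have hterm (n : ℕ) : ENNReal.ofReal (Real.exp (-r) * r ^ n / n.factorial) * n
      = ENNReal.ofReal (Real.exp (-r) * r ^ n / n.factorial * n) := by
    rw [ENNReal.ofReal_mul (by positivity), ENNReal.ofReal_natCast]
  have hsum : HasSum (fun n : ℕ => Real.exp (-r) * (r : ℝ) ^ n / n.factorial * n) r := by
    rw [← hasSum_nat_add_iff' 1]
    simp only [Finset.range_one, Finset.sum_singleton, Nat.cast_zero, mul_zero, sub_zero]
    refine (mul_one (r : ℝ) ▸ (hasSum_one_poissonMeasure r).mul_left (r : ℝ)).congr_fun fun n => ?_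
    rw [Nat.factorial_succ]
    push_cast
    field_simp
    ring
  rw [lintegral_poissonMeasure]
  simp_rw [hterm]
  rw [← ENNReal.ofReal_tsum_of_nonneg (fun n => by positivity) hsum.summable, hsum.tsum_eq,
    ENNReal.ofReal_coe_nnreal]

lemma lintegral_exp_mul_poissonMeasure (r : ℝ≥0) (θ : ℝ) :
    ∫⁻ n : ℕ, ENNReal.ofReal (Real.exp (θ * n)) ∂(poissonMeasure r)
      = ENNReal.ofReal (Real.exp (r * (Real.exp θ - 1))) := by
  have hterm (n : ℕ) : ENNReal.ofReal (Real.exp (-r) * r ^ n / n.factorial)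
        * ENNReal.ofReal (Real.exp (θ * n))
      = ENNReal.ofReal (Real.exp (-r) * ((r * Real.exp θ) ^ n / n.factorial)) := by
    rw [← ENNReal.ofReal_mul (by positivity), mul_pow, ← Real.exp_nat_mul, mul_comm θ]
    ring_nf
  have hsum : HasSum (fun n : ℕ => Real.exp (-r) * ((r * Real.exp θ) ^ n / n.factorial))
      (Real.exp (r * (Real.exp θ - 1))) := by
    have h := (NormedSpace.expSeries_div_hasSum_exp ((r : ℝ) * Real.exp θ)).mul_left (Real.exp (-r))
    rwa [← Real.exp_eq_exp_ℝ, ← Real.exp_add, neg_add_eq_sub, ← mul_sub_one] at h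
  rw [lintegral_poissonMeasure]
  simp_rw [hterm]
  rw [← ENNReal.ofReal_tsum_of_nonneg (fun n => by positivity) hsum.summable, hsum.tsum_eq]

end PoissonDistribution

section ExponentialBounds

lemma exp_sub_one_le_mul_exp (x : ℝ) : Real.exp x - 1 ≤ x * Real.exp x := by
  have h := mul_le_mul_of_nonneg_left (Real.add_one_le_exp (-x)) (Real.exp_pos x).le
  rw [← Real.exp_add, add_neg_cancel, Real.exp_zero] at h
  linarith

lemma abs_exp_sub_one_le_abs_mul_exp_abs (x : ℝ) : |Real.exp x - 1| ≤ |x| * Real.exp |x| := by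
  rcases le_total 0 x with hx | hx
  · rw [abs_of_nonneg hx, abs_of_nonneg (by linarith [Real.add_one_le_exp x])]
    exact exp_sub_one_le_mul_exp x
  · rw [abs_of_nonpos (sub_nonpos.2 (Real.exp_le_one_iff.2 hx)), neg_sub]
    calc 1 - Real.exp x ≤ |x| := by linarith [Real.add_one_le_exp x, neg_le_abs x]
      _ ≤ |x| * Real.exp |x| :=
        le_mul_of_one_le_right (abs_nonneg x) (Real.one_le_exp (abs_nonneg x))

lemma abs_exp_mul_sub_one_le {u v b : ℝ} (hu : 0 ≤ u) (huv : u ≤ v) (hvb : v ≤ b) (θ : ℝ) :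
    |Real.exp (θ * u) - 1| ≤ |θ| * Real.exp (|θ| * b) * v :=
  calc |Real.exp (θ * u) - 1| ≤ |θ * u| * Real.exp |θ * u| := abs_exp_sub_one_le_abs_mul_exp_abs _
    _ = |θ| * Real.exp (|θ| * u) * u := by rw [abs_mul, abs_of_nonneg hu]; ring
    _ ≤ |θ| * Real.exp (|θ| * b) * v := by gcongr; exact huv.trans hvb

lemma exp_neg_le_one_sub_add_sq {x : ℝ} (hx : 0 ≤ x) : Real.exp (-x) ≤ 1 - x + x ^ 2 / 2 := by
  have hpos : 0 ≤ 1 - x + x ^ 2 / 2 := by nlinarith [sq_nonneg (x - 1)]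
  rw [Real.exp_neg, inv_le_iff_one_le_mul₀ (Real.exp_pos _)]
  calc (1 : ℝ) ≤ (1 - x + x ^ 2 / 2) * (1 + x + x ^ 2 / 2) := by nlinarith [sq_nonneg (x ^ 2)]
    _ ≤ _ := by gcongr; exact Real.quadratic_le_exp_of_nonneg hx

end ExponentialBounds

section SimpleFunctions

variable {E : Type*} [MeasurableSpace E] {μ : Measure E} {h : E → ℝ≥0∞}

lemma eapprox_le (hh : Measurable h) (n : ℕ) (x : E) : SimpleFunc.eapprox h n x ≤ h x :=
  SimpleFunc.iSup_eapprox_apply hh x ▸ le_iSup (fun n => SimpleFunc.eapprox h n x) n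

lemma tendsto_lintegral_eapprox (hh : Measurable h) (μ : Measure E) :
    Tendsto (fun n => ∫⁻ x, SimpleFunc.eapprox h n x ∂μ) atTop (𝓝 (∫⁻ x, h x ∂μ)) := by
  simp only [lintegral_eq_iSup_eapprox_lintegral hh, SimpleFunc.lintegral_eq_lintegral]
  exact tendsto_atTop_iSup fun m n hmn =>
    SimpleFunc.lintegral_mono (SimpleFunc.monotone_eapprox h hmn) le_rfl

lemma integral_comp_simpleFunc {φ : SimpleFunc E ℝ} (hφ : Integrable φ μ) {g : ℝ → ℝ}
    (hg : g 0 = 0) :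
    ∫ x, g (φ x) ∂μ = ∑ c ∈ φ.range, μ.real (φ ⁻¹' {c}) * g c := by
  have hint : Integrable (φ.map g) μ :=
    ((SimpleFunc.integrable_iff_finMeasSupp.1 hφ).map hg).integrable
  exact (SimpleFunc.integral_eq_integral _ hint).symm.trans (SimpleFunc.map_integral φ g hφ hg)

lemma integrable_exp_mul_toReal_sub_one (hh : Measurable h) {b : ℝ≥0} (hb : ∀ x, h x ≤ b)
    (hint : ∫⁻ x, h x ∂μ ≠ ⊤) (θ : ℝ) :
    Integrable (fun x => Real.exp (θ * (h x).toReal) - 1) μ :=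
  ((integrable_toReal_of_lintegral_ne_top hh.aemeasurable hint).const_mul
    (|θ| * Real.exp (|θ| * b))).mono' (Measurable.aestronglyMeasurable (by fun_prop))
      (ae_of_all _ fun x => abs_exp_mul_sub_one_le ENNReal.toReal_nonneg le_rfl
        (ENNReal.toReal_le_coe_of_le_coe (hb x)) θ)

lemma tendsto_integral_exp_mul_eapprox_sub_one (hh : Measurable h) {b : ℝ≥0}
    (hb : ∀ x, h x ≤ b) (hint : ∫⁻ x, h x ∂μ ≠ ⊤) (θ : ℝ) :
    Tendsto (fun n => ∫ x, (Real.exp (θ * (SimpleFunc.eapprox h n x).toReal) - 1) ∂μ) atTop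
      (𝓝 (∫ x, (Real.exp (θ * (h x).toReal) - 1) ∂μ)) := by
  have hfin (x) : h x ≠ ⊤ := ((hb x).trans_lt ENNReal.coe_lt_top).ne
  refine tendsto_integral_of_dominated_convergence
    (fun x => |θ| * Real.exp (|θ| * b) * (h x).toReal) (fun n => ?_) ?_
    (fun n => ae_of_all _ fun x => ?_) (ae_of_all _ fun x => ?_)
  · have := (SimpleFunc.eapprox h n).measurable
    exact Measurable.aestronglyMeasurable (by fun_prop)
  · exact (integrable_toReal_of_lintegral_ne_top hh.aemeasurable hint).const_mul _
  · exact abs_exp_mul_sub_one_le ENNReal.toReal_nonneg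
      (ENNReal.toReal_mono (hfin x) (eapprox_le hh n x))
      (ENNReal.toReal_le_coe_of_le_coe (hb x)) θ
  · exact ((Real.continuous_exp.tendsto _).comp (((ENNReal.tendsto_toReal (hfin x)).comp
      (SimpleFunc.tendsto_eapprox hh x)).const_mul θ)).sub_const 1

end SimpleFunctions

lemma indepFun_pi_inl_inr {Ω ι κ β : Type*} [MeasurableSpace Ω] [MeasurableSpace β]
    {P : Measure Ω} {X : ι ⊕ κ → Ω → β} (hX : iIndepFun X P) (hmeas : ∀ i, Measurable (X i)) :
    IndepFun (fun ω i => X (Sum.inl i) ω) (fun ω k => X (Sum.inr k) ω) P := by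
  have hdisj : Disjoint (range (Sum.inl : ι → ι ⊕ κ)) (range Sum.inr) :=
    isCompl_range_inl_range_inr.disjoint
  have hindep := indep_iSup_of_disjoint (fun i => (hmeas i).comap_le) hX.iIndep hdisj
  simp only [iSup_range] at hindep
  rw [IndepFun_iff_Indep]
  simpa only [MeasurableSpace.pi, MeasurableSpace.comap_iSup, MeasurableSpace.comap_comp,
    Function.comp_def] using hindep

namespace IsPoissonRandomMeasure

variable {Ω E : Type*} [MeasurableSpace Ω] [MeasurableSpace E] {P : Measure Ω}
  {N : Ω → Measure E} {nu : Measure E}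

lemma measurable_apply (hN : IsPoissonRandomMeasure P N nu) {A : Set E} (hA : MeasurableSet A) :
    Measurable (fun ω => N ω A) :=
  (Measure.measurable_coe hA).comp hN.measurable

lemma measurable_lintegral (hN : IsPoissonRandomMeasure P N nu) {h : E → ℝ≥0∞}
    (hh : Measurable h) : Measurable (fun ω => ∫⁻ x, h x ∂(N ω)) :=
  (Measure.measurable_lintegral hh).comp hN.measurable

lemma ae_exists_nat_eq (hN : IsPoissonRandomMeasure P N nu) {A : Set E} (hA : MeasurableSet A)
    (hfin : nu A ≠ ⊤) : ∀ᵐ ω ∂P, ∃ k : ℕ, (k : ℝ≥0∞) = N ω A := by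
  have hrange : MeasurableSet (range (fun n : ℕ => (n : ℝ≥0∞))) := (countable_range _).measurableSet
  have hlaw : ∀ᵐ x ∂(P.map (fun ω => N ω A)), x ∈ range (fun n : ℕ => (n : ℝ≥0∞)) := by
    rw [hN.map_eq A hA hfin.lt_top]
    exact (ae_map_iff (by fun_prop) hrange).2 (ae_of_all _ mem_range_self)
  exact (ae_map_iff (hN.measurable_apply hA).aemeasurable hrange).1 hlaw

lemma ae_one_le_of_ne_zero (hN : IsPoissonRandomMeasure P N nu) {A : Set E}
    (hA : MeasurableSet A) : ∀ᵐ ω ∂P, N ω A ≠ 0 → 1 ≤ N ω A := by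
  by_cases htop : nu A = ⊤
  · filter_upwards [hN.ae_eq_top A hA htop] with ω hω _
    simp [hω]
  · filter_upwards [hN.ae_exists_nat_eq hA htop] with ω ⟨k, hk⟩ h0
    rw [← hk] at h0 ⊢
    exact_mod_cast Nat.one_le_iff_ne_zero.2 (by exact_mod_cast h0)

lemma lintegral_comp_apply (hN : IsPoissonRandomMeasure P N nu) {A : Set E} (hA : MeasurableSet A)
    (hfin : nu A ≠ ⊤) {g : ℝ≥0∞ → ℝ≥0∞} (hg : Measurable g) :
    ∫⁻ ω, g (N ω A) ∂P = ∫⁻ n : ℕ, g n ∂(poissonMeasure (nu A).toNNReal) := by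
  rw [← lintegral_map hg (hN.measurable_apply hA), hN.map_eq A hA hfin.lt_top,
    lintegral_map hg (by fun_prop)]

lemma lintegral_exp_mul_apply (hN : IsPoissonRandomMeasure P N nu) {A : Set E}
    (hA : MeasurableSet A) (hfin : nu A ≠ ⊤) (θ : ℝ) :
    ∫⁻ ω, ENNReal.ofReal (Real.exp (θ * (N ω A).toReal)) ∂P
      = ENNReal.ofReal (Real.exp (nu.real A * (Real.exp θ - 1))) := by
  rw [hN.lintegral_comp_apply hA hfin (g := fun x => ENNReal.ofReal (Real.exp (θ * x.toReal)))
    (by fun_prop)]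
  exact lintegral_exp_mul_poissonMeasure _ θ

lemma iIndepFun_of_countable (hN : IsPoissonRandomMeasure P N nu) {ι : Type*} [Countable ι]
    {A : ι → Set E} (hA : ∀ i, MeasurableSet (A i))
    (hdisj : Pairwise fun i j => Disjoint (A i) (A j)) :
    ProbabilityTheory.iIndepFun (fun i ω => N ω (A i)) P := by
  obtain ⟨e, he⟩ := exists_injective_nat ι
  let B : ℕ → Set E := fun n => ⋃ (i) (_ : e i = n), A i
  have hBe (i : ι) : B (e i) = A i := by simp [B, he.eq_iff]
  have hB := hN.iIndepFun B
    (fun n => MeasurableSet.iUnion fun i => MeasurableSet.iUnion fun _ => hA i) (by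
      intro m n hmn
      simp only [B, disjoint_iUnion_left, disjoint_iUnion_right]
      rintro i rfl j rfl
      exact hdisj (fun h => hmn (by rw [h])))
  simpa only [hBe] using hB.precomp he

lemma map (hN : IsPoissonRandomMeasure P N nu) {E' : Type*} [MeasurableSpace E'] {f : E → E'}
    (hf : Measurable f) : IsPoissonRandomMeasure P (fun ω => (N ω).map f) (nu.map f) where
  measurable := (Measure.measurable_map f hf).comp hN.measurable
  map_eq A hA hfin := by
    simp only [Measure.map_apply hf hA] at hfin ⊢
    exact hN.map_eq _ (hf hA) hfin
  ae_eq_top A hA htop := by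
    simp only [Measure.map_apply hf hA] at htop ⊢
    exact hN.ae_eq_top _ (hf hA) htop
  iIndepFun A hA hdisj := by
    simp only [Measure.map_apply hf (hA _)]
    exact hN.iIndepFun _ (fun i => hf (hA i)) fun i j hij => (hdisj hij).preimage f

lemma ae_exists_apply_ne_zero (hN : IsPoissonRandomMeasure P N nu) {ι : Type*} [Countable ι]
    {A : ι → Set E} (hA : ∀ i, MeasurableSet (A i)) (htop : nu (⋃ i, A i) = ⊤) :
    ∀ᵐ ω ∂P, ∃ i, N ω (A i) ≠ 0 := by
  filter_upwards [hN.ae_eq_top _ (MeasurableSet.iUnion hA) htop] with ω hω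
  by_contra! hzero
  simp [measure_iUnion_null hzero] at hω

lemma indepFun_apply_lintegral_simpleFunc (hN : IsPoissonRandomMeasure P N nu) {ι : Type*}
    [Countable ι] {A : ι → Set E} (hA : ∀ i, MeasurableSet (A i))
    (hdisj : Pairwise fun i j => Disjoint (A i) (A j))
    {φ : SimpleFunc E ℝ≥0∞} (hφ : ∀ i, ∀ x ∈ A i, φ x = 0) :
    IndepFun (fun ω i => N ω (A i)) (fun ω => ∫⁻ x, φ x ∂(N ω)) P := by
  classical
  let S : Finset ℝ≥0∞ := φ.range \ {0}
  let C : ι ⊕ S → Set E := Sum.elim A fun c => φ ⁻¹' {(c : ℝ≥0∞)}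
  have hC (i) : MeasurableSet (C i) := by
    rcases i with i | c
    · exact hA i
    · exact φ.measurableSet_preimage _
  have hAC (i) (c : S) : Disjoint (A i) (φ ⁻¹' {(c : ℝ≥0∞)}) :=
    disjoint_left.2 fun x hx hxc =>
      (Finset.mem_sdiff.1 c.2).2 (Finset.mem_singleton.2 ((hφ i x hx).symm.trans hxc).symm)
  have hCdisj : Pairwise fun i j => Disjoint (C i) (C j) := by
    rintro (i | c) (j | c') hij
    · exact hdisj fun h => hij (congrArg _ h)
    · exact hAC i c'
    · exact (hAC j c).symm
    · exact (disjoint_singleton.2 fun h => hij (congrArg _ (Subtype.ext h))).preimage φ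
  have hsum (ω) : ∫⁻ x, φ x ∂(N ω) = ∑ c : S, (c : ℝ≥0∞) * N ω (C (Sum.inr c)) := by
    rw [SimpleFunc.lintegral_eq_lintegral, SimpleFunc.lintegral_eq_of_subset' φ subset_rfl]
    exact (Finset.sum_coe_sort S fun c => c * N ω (φ ⁻¹' {c})).symm
  simp_rw [hsum]
  exact (indepFun_pi_inl_inr (hN.iIndepFun_of_countable hC hCdisj)
    fun i => hN.measurable_apply (hC i)).comp (ψ := fun x : S → ℝ≥0∞ => ∑ c : S, (c : ℝ≥0∞) * x c)
    measurable_id (by fun_prop)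

variable [IsProbabilityMeasure P]

lemma lintegral_apply (hN : IsPoissonRandomMeasure P N nu) {A : Set E}
    (hA : MeasurableSet A) : ∫⁻ ω, N ω A ∂P = nu A := by
  by_cases htop : nu A = ⊤
  · rw [lintegral_congr_ae (hN.ae_eq_top A hA htop), htop]
    simp
  · rw [hN.lintegral_comp_apply hA htop measurable_id']
    simp only [lintegral_natCast_poissonMeasure, ENNReal.coe_toNNReal htop]

lemma bind_eq (hN : IsPoissonRandomMeasure P N nu) : P.bind N = nu := by
  ext A hA
  rw [Measure.bind_apply hA hN.measurable.aemeasurable, hN.lintegral_apply hA]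

lemma lintegral_lintegral (hN : IsPoissonRandomMeasure P N nu)
    {h : E → ℝ≥0∞} (hh : Measurable h) : ∫⁻ ω, ∫⁻ x, h x ∂(N ω) ∂P = ∫⁻ x, h x ∂nu := by
  rw [← Measure.lintegral_bind hN.measurable.aemeasurable hh.aemeasurable, hN.bind_eq]

lemma ae_eq_zero (hN : IsPoissonRandomMeasure P N nu) {A : Set E}
    (hA : MeasurableSet A) (h0 : nu A = 0) : ∀ᵐ ω ∂P, N ω A = 0 := by
  rwa [← hN.lintegral_apply hA, lintegral_eq_zero_iff (hN.measurable_apply hA)] at h0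

lemma ae_lintegral_lt_top (hN : IsPoissonRandomMeasure P N nu)
    {h : E → ℝ≥0∞} (hh : Measurable h) (hint : ∫⁻ x, h x ∂nu ≠ ⊤) :
    ∀ᵐ ω ∂P, ∫⁻ x, h x ∂(N ω) < ⊤ :=
  ae_lt_top (hN.measurable_lintegral hh) (by rwa [hN.lintegral_lintegral hh])

lemma measure_apply_ne_zero_le (hN : IsPoissonRandomMeasure P N nu)
    {A : Set E} (hA : MeasurableSet A) : P {ω | N ω A ≠ 0} ≤ nu A :=
  calc P {ω | N ω A ≠ 0} ≤ P {ω | 1 ≤ N ω A} := measure_mono_ae (hN.ae_one_le_of_ne_zero hA)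
    _ ≤ ∫⁻ ω, N ω A ∂P := by
        simpa using mul_meas_ge_le_lintegral (μ := P) (hN.measurable_apply hA) 1
    _ = nu A := hN.lintegral_apply hA

lemma ae_toReal_lintegral_simpleFunc (hN : IsPoissonRandomMeasure P N nu) {φ : SimpleFunc E ℝ}
    (hφ : ∀ x, 0 ≤ φ x) (hint : Integrable φ nu) :
    ∀ᵐ ω ∂P, (∫⁻ x, ENNReal.ofReal (φ x) ∂(N ω)).toReal
      = ∑ c ∈ φ.range, c * (N ω (φ ⁻¹' {c})).toReal := by
  have hlt := hN.ae_lintegral_lt_top (h := φ.map ENNReal.ofReal) (SimpleFunc.measurable _)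
    (by simpa using hint.lintegral_lt_top.ne)
  filter_upwards [hlt] with ω hω
  rw [SimpleFunc.lintegral_eq_lintegral, SimpleFunc.map_lintegral] at hω
  rw [show ∫⁻ x, ENNReal.ofReal (φ x) ∂(N ω) = (φ.map ENNReal.ofReal).lintegral (N ω) by
    rw [← SimpleFunc.lintegral_eq_lintegral]; rfl, SimpleFunc.map_lintegral,
    ENNReal.toReal_sum fun c hc => (ENNReal.sum_lt_top.1 hω c hc).ne]
  refine Finset.sum_congr rfl fun c hc => ?_
  obtain ⟨x, rfl⟩ := SimpleFunc.mem_range.1 hc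
  rw [ENNReal.toReal_mul, ENNReal.toReal_ofReal (hφ x)]

lemma lintegral_exp_mul_lintegral_simpleFunc (hN : IsPoissonRandomMeasure P N nu)
    {φ : SimpleFunc E ℝ} (hφ : ∀ x, 0 ≤ φ x) (hint : Integrable φ nu) (θ : ℝ) :
    ∫⁻ ω, ENNReal.ofReal (Real.exp (θ * (∫⁻ x, ENNReal.ofReal (φ x) ∂(N ω)).toReal)) ∂P
      = ENNReal.ofReal (Real.exp (∫ x, (Real.exp (θ * φ x) - 1) ∂nu)) := by
  let X : φ.range → Ω → ℝ≥0∞ := fun c ω =>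
    ENNReal.ofReal (Real.exp (θ * c * (N ω (φ ⁻¹' {(c : ℝ)})).toReal))
  have hXmeas (c) : Measurable (X c) := by
    have := hN.measurable_apply (φ.measurableSet_preimage {(c : ℝ)})
    fun_prop
  have hXindep : ProbabilityTheory.iIndepFun X P :=
    (hN.iIndepFun_of_countable (A := fun c : φ.range => φ ⁻¹' {(c : ℝ)})
      (fun c => φ.measurableSet_preimage _)
      (fun c c' h => (disjoint_singleton.2 fun hc => h (Subtype.ext hc)).preimage φ)).comp
      (fun c x => ENNReal.ofReal (Real.exp (θ * c * x.toReal))) fun c => by fun_prop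
  have hX (c : φ.range) : ∫⁻ ω, X c ω ∂P
      = ENNReal.ofReal (Real.exp (nu.real (φ ⁻¹' {(c : ℝ)}) * (Real.exp (θ * c) - 1))) := by
    by_cases hc : (c : ℝ) = 0
    · simp [X, hc]
    · exact hN.lintegral_exp_mul_apply (φ.measurableSet_preimage _)
        (SimpleFunc.measure_preimage_lt_top_of_integrable φ hint hc).ne _
  calc ∫⁻ ω, ENNReal.ofReal (Real.exp (θ * (∫⁻ x, ENNReal.ofReal (φ x) ∂(N ω)).toReal)) ∂P
      = ∫⁻ ω, ∏ c, X c ω ∂P := by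
        refine lintegral_congr_ae ?_
        filter_upwards [hN.ae_toReal_lintegral_simpleFunc hφ hint] with ω hω
        rw [hω, Finset.mul_sum, Real.exp_sum,
          ENNReal.ofReal_prod_of_nonneg fun _ _ => by positivity, ← Finset.prod_coe_sort]
        simp only [X, mul_assoc]
    _ = ∏ c, ∫⁻ ω, X c ω ∂P := lintegral_prod_eq_prod_lintegral_of_indepFun _ X hXindep hXmeas
    _ = ENNReal.ofReal (Real.exp
          (∑ c ∈ φ.range, nu.real (φ ⁻¹' {c}) * (Real.exp (θ * c) - 1))) := by
        simp_rw [hX]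
        rw [Real.exp_sum, ENNReal.ofReal_prod_of_nonneg fun _ _ => by positivity]
        exact Finset.prod_coe_sort φ.range fun c =>
          ENNReal.ofReal (Real.exp (nu.real (φ ⁻¹' {c}) * (Real.exp (θ * c) - 1)))
    _ = ENNReal.ofReal (Real.exp (∫ x, (Real.exp (θ * φ x) - 1) ∂nu)) := by
        rw [integral_comp_simpleFunc hint (g := fun u => Real.exp (θ * u) - 1) (by simp)]

/-- Equality holds, but the inequality is all that the Chernoff bounds need, and it follows from the
case of simple functions by Fatou's lemma. -/
lemma lintegral_exp_mul_lintegral_le (hN : IsPoissonRandomMeasure P N nu) {h : E → ℝ≥0∞}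
    (hh : Measurable h) {b : ℝ≥0} (hb : ∀ x, h x ≤ b) (hint : ∫⁻ x, h x ∂nu ≠ ⊤) (θ : ℝ) :
    ∫⁻ ω, ENNReal.ofReal (Real.exp (θ * (∫⁻ x, h x ∂(N ω)).toReal)) ∂P
      ≤ ENNReal.ofReal (Real.exp (∫ x, (Real.exp (θ * (h x).toReal) - 1) ∂nu)) := by
  let X : ℕ → Ω → ℝ≥0∞ := fun n ω =>
    ENNReal.ofReal (Real.exp (θ * (∫⁻ x, SimpleFunc.eapprox h n x ∂(N ω)).toReal))
  have hXmeas (n) : Measurable (X n) := by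
    have := hN.measurable_lintegral (SimpleFunc.eapprox h n).measurable
    fun_prop
  have hXlim : ∀ᵐ ω ∂P, ENNReal.ofReal (Real.exp (θ * (∫⁻ x, h x ∂(N ω)).toReal))
      = liminf (fun n => X n ω) atTop := by
    filter_upwards [hN.ae_lintegral_lt_top hh hint] with ω hω
    exact (ENNReal.tendsto_ofReal ((Real.continuous_exp.tendsto _).comp (((ENNReal.tendsto_toReal
      hω.ne).comp (tendsto_lintegral_eapprox hh _)).const_mul θ))).liminf_eq.symm
  have hX (n) : ∫⁻ ω, X n ω ∂P = ENNReal.ofReal (Real.exp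
      (∫ x, (Real.exp (θ * (SimpleFunc.eapprox h n x).toReal) - 1) ∂nu)) := by
    have hformula := hN.lintegral_exp_mul_lintegral_simpleFunc
      (φ := (SimpleFunc.eapprox h n).map ENNReal.toReal) (fun x => ENNReal.toReal_nonneg)
      (integrable_toReal_of_lintegral_ne_top (SimpleFunc.measurable _).aemeasurable
        ((lintegral_mono (eapprox_le hh n)).trans_lt hint.lt_top).ne) θ
    simpa only [SimpleFunc.map_apply, ENNReal.ofReal_toReal (SimpleFunc.eapprox_lt_top h n _).ne]
      using hformula
  calc ∫⁻ ω, ENNReal.ofReal (Real.exp (θ * (∫⁻ x, h x ∂(N ω)).toReal)) ∂P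
      = ∫⁻ ω, liminf (fun n => X n ω) atTop ∂P := lintegral_congr_ae hXlim
    _ ≤ liminf (fun n => ∫⁻ ω, X n ω ∂P) atTop := lintegral_liminf_le hXmeas
    _ = ENNReal.ofReal (Real.exp (∫ x, (Real.exp (θ * (h x).toReal) - 1) ∂nu)) := by
        simp_rw [hX]
        exact (ENNReal.tendsto_ofReal ((Real.continuous_exp.tendsto _).comp
          (tendsto_integral_exp_mul_eapprox_sub_one hh hb hint θ))).liminf_eq

/-- A Chernoff bound, for the upper tail if `0 ≤ θ` and for the lower tail if `θ ≤ 0`. -/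
lemma measure_mul_le_mul_toReal_lintegral_le (hN : IsPoissonRandomMeasure P N nu) {h : E → ℝ≥0∞}
    (hh : Measurable h) {b : ℝ≥0} (hb : ∀ x, h x ≤ b) (hint : ∫⁻ x, h x ∂nu ≠ ⊤) (θ x : ℝ) :
    P {ω | θ * x ≤ θ * (∫⁻ y, h y ∂(N ω)).toReal}
      ≤ ENNReal.ofReal (Real.exp (-(θ * x) + ∫ y, (Real.exp (θ * (h y).toReal) - 1) ∂nu)) := by
  have hmeas : Measurable fun ω => ENNReal.ofReal (Real.exp (θ * (∫⁻ y, h y ∂(N ω)).toReal)) := by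
    have := hN.measurable_lintegral hh
    fun_prop
  calc P {ω | θ * x ≤ θ * (∫⁻ y, h y ∂(N ω)).toReal}
      = P {ω | ENNReal.ofReal (Real.exp (θ * x))
          ≤ ENNReal.ofReal (Real.exp (θ * (∫⁻ y, h y ∂(N ω)).toReal))} := by
        simp only [ENNReal.ofReal_le_ofReal_iff (Real.exp_pos _).le, Real.exp_le_exp]
    _ ≤ (∫⁻ ω, ENNReal.ofReal (Real.exp (θ * (∫⁻ y, h y ∂(N ω)).toReal)) ∂P)
          / ENNReal.ofReal (Real.exp (θ * x)) :=
        meas_ge_le_lintegral_div hmeas.aemeasurable (by simp [Real.exp_pos]) ENNReal.ofReal_ne_top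
    _ ≤ ENNReal.ofReal (Real.exp (∫ y, (Real.exp (θ * (h y).toReal) - 1) ∂nu))
          / ENNReal.ofReal (Real.exp (θ * x)) := by
        gcongr
        exact hN.lintegral_exp_mul_lintegral_le hh hb hint θ
    _ = _ := by
        rw [← ENNReal.ofReal_div_of_pos (Real.exp_pos _), ← Real.exp_sub, neg_add_eq_sub]

lemma measure_lt_lintegral_le (hN : IsPoissonRandomMeasure P N nu) {h : E → ℝ≥0∞}
    (hh : Measurable h) {b x T θ : ℝ} (hb0 : 0 ≤ b) (hb : ∀ y, h y ≤ ENNReal.ofReal b)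
    (hT : 0 ≤ T) (hint : ∫⁻ y, h y ∂nu ≤ ENNReal.ofReal T) (hθ : 0 ≤ θ) :
    P {ω | ENNReal.ofReal x < ∫⁻ y, h y ∂(N ω)}
      ≤ ENNReal.ofReal (Real.exp (-θ * x + θ * Real.exp (θ * b) * T)) := by
  have hint' : ∫⁻ y, h y ∂nu ≠ ⊤ := (hint.trans_lt ENNReal.ofReal_lt_top).ne
  have hexponent : ∫ y, (Real.exp (θ * (h y).toReal) - 1) ∂nu ≤ θ * Real.exp (θ * b) * T := by
    calc ∫ y, (Real.exp (θ * (h y).toReal) - 1) ∂nu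
        ≤ ∫ y, θ * Real.exp (θ * b) * (h y).toReal ∂nu := by
          refine integral_mono (integrable_exp_mul_toReal_sub_one hh hb hint' θ)
            ((integrable_toReal_of_lintegral_ne_top hh.aemeasurable hint').const_mul _) fun y => ?_
          have hy : (h y).toReal ≤ b := ENNReal.toReal_le_of_le_ofReal hb0 (hb y)
          calc _ ≤ θ * (h y).toReal * Real.exp (θ * (h y).toReal) := exp_sub_one_le_mul_exp _
            _ ≤ θ * (h y).toReal * Real.exp (θ * b) := by gcongr
            _ = _ := by ring
      _ = θ * Real.exp (θ * b) * (∫⁻ y, h y ∂nu).toReal := by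
          rw [integral_const_mul, integral_toReal hh.aemeasurable
            (ae_lt_top hh hint')]
      _ ≤ θ * Real.exp (θ * b) * T := by
          gcongr
          exact ENNReal.toReal_le_of_le_ofReal hT hint
  calc P {ω | ENNReal.ofReal x < ∫⁻ y, h y ∂(N ω)}
      ≤ P {ω | θ * x ≤ θ * (∫⁻ y, h y ∂(N ω)).toReal} := by
        refine measure_mono_ae ?_
        filter_upwards [hN.ae_lintegral_lt_top hh hint'] with ω hω hlt
        have hle := (ENNReal.ofReal_le_iff_le_toReal hω.ne).1 (le_of_lt hlt)
        exact mul_le_mul_of_nonneg_left hle hθ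
    _ ≤ _ := hN.measure_mul_le_mul_toReal_lintegral_le hh hb hint' θ x
    _ ≤ _ := by
        rw [neg_mul]
        gcongr

lemma measure_lintegral_lt_le (hN : IsPoissonRandomMeasure P N nu) {h : E → ℝ≥0∞}
    (hh : Measurable h) {b x θ : ℝ} (hb0 : 0 ≤ b) (hb : ∀ y, h y ≤ ENNReal.ofReal b)
    (hint : ∫⁻ y, h y ∂nu ≠ ⊤) (hθ : 0 ≤ θ) :
    P {ω | ∫⁻ y, h y ∂(N ω) < ENNReal.ofReal x}
      ≤ ENNReal.ofReal (Real.exp (θ * x - θ * (1 - θ * b / 2) * (∫⁻ y, h y ∂nu).toReal)) := by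
  have hexponent : ∫ y, (Real.exp (-θ * (h y).toReal) - 1) ∂nu
      ≤ -(θ * (1 - θ * b / 2)) * (∫⁻ y, h y ∂nu).toReal := by
    rw [← integral_toReal hh.aemeasurable (ae_lt_top hh hint), ← integral_const_mul]
    refine integral_mono (integrable_exp_mul_toReal_sub_one hh hb hint (-θ))
      ((integrable_toReal_of_lintegral_ne_top hh.aemeasurable hint).const_mul _) fun y => ?_
    have hy : (h y).toReal ≤ b := ENNReal.toReal_le_of_le_ofReal hb0 (hb y)
    calc Real.exp (-θ * (h y).toReal) - 1
        ≤ -(θ * (h y).toReal) + θ * (h y).toReal * (θ * (h y).toReal) / 2 := by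
          rw [neg_mul]
          linarith [exp_neg_le_one_sub_add_sq (mul_nonneg hθ (ENNReal.toReal_nonneg (a := h y))),
            sq (θ * (h y).toReal)]
      _ ≤ -(θ * (h y).toReal) + θ * (h y).toReal * (θ * b) / 2 := by gcongr
      _ = -(θ * (1 - θ * b / 2)) * (h y).toReal := by ring
  calc P {ω | ∫⁻ y, h y ∂(N ω) < ENNReal.ofReal x}
      ≤ P {ω | -θ * x ≤ -θ * (∫⁻ y, h y ∂(N ω)).toReal} := by
        refine measure_mono fun ω hω => ?_
        have hlt := (ENNReal.lt_ofReal_iff_toReal_lt (hω.trans ENNReal.ofReal_lt_top).ne).1 hω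
        exact mul_le_mul_of_nonpos_left hlt.le (neg_nonpos.2 hθ)
    _ ≤ _ := hN.measure_mul_le_mul_toReal_lintegral_le hh hb hint (-θ) x
    _ ≤ _ := by
        refine ENNReal.ofReal_le_ofReal (Real.exp_le_exp.2 ?_)
        linarith

lemma ae_exists_apply_eq_zero (hN : IsPoissonRandomMeasure P N nu) {A : ℕ → Set E}
    (hA : ∀ n, MeasurableSet (A n)) (hlim : Tendsto (fun n => nu (A n)) atTop (𝓝 0)) :
    ∀ᵐ ω ∂P, ∃ n, N ω (A n) = 0 :=
  le_antisymm (ge_of_tendsto' hlim fun n =>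
    (measure_mono fun ω (hω : ¬∃ n, N ω (A n) = 0) h => hω ⟨n, h⟩).trans
      (hN.measure_apply_ne_zero_le (hA n))) zero_le

lemma measure_lt_setLIntegral_le (hN : IsPoissonRandomMeasure P N nu) {A : Set E}
    (hA : MeasurableSet A) {h : E → ℝ≥0∞} (hh : Measurable h) {b x T θ : ℝ} (hb0 : 0 ≤ b)
    (hb : ∀ y ∈ A, h y ≤ ENNReal.ofReal b) (hT : 0 ≤ T)
    (hint : ∫⁻ y in A, h y ∂nu ≤ ENNReal.ofReal T) (hθ : 0 ≤ θ) :
    P {ω | ENNReal.ofReal x < ∫⁻ y in A, h y ∂(N ω)}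
      ≤ ENNReal.ofReal (Real.exp (-θ * x + θ * Real.exp (θ * b) * T)) := by
  simp only [← lintegral_indicator hA] at hint ⊢
  exact hN.measure_lt_lintegral_le (hh.indicator hA) hb0
    (fun y => indicator_apply_le' (hb y) fun _ => zero_le) hT hint hθ

lemma measure_setLIntegral_lt_le (hN : IsPoissonRandomMeasure P N nu) {A : Set E}
    (hA : MeasurableSet A) {h : E → ℝ≥0∞} (hh : Measurable h) {b x θ : ℝ} (hb0 : 0 ≤ b)
    (hb : ∀ y ∈ A, h y ≤ ENNReal.ofReal b) (hint : ∫⁻ y in A, h y ∂nu ≠ ⊤) (hθ : 0 ≤ θ) :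
    P {ω | ∫⁻ y in A, h y ∂(N ω) < ENNReal.ofReal x}
      ≤ ENNReal.ofReal
        (Real.exp (θ * x - θ * (1 - θ * b / 2) * (∫⁻ y in A, h y ∂nu).toReal)) := by
  simp only [← lintegral_indicator hA] at hint ⊢
  exact hN.measure_lintegral_lt_le (hh.indicator hA) hb0
    (fun y => indicator_apply_le' (hb y) fun _ => zero_le) hint hθ

lemma ae_setLIntegral_lt_top (hN : IsPoissonRandomMeasure P N nu) {A : Set E}
    (hA : MeasurableSet A) (hfin : nu A ≠ ⊤) {h : E → ℝ≥0∞} (hh : Measurable h)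
    (hlt : ∀ x, h x ≠ ⊤) : ∀ᵐ ω ∂P, ∫⁻ x in A, h x ∂(N ω) < ⊤ := by
  let B : ℕ → Set E := fun n => A ∩ {x | (n : ℝ≥0∞) < h x}
  have hB (n) : MeasurableSet (B n) := hA.inter (measurableSet_lt measurable_const hh)
  have hBanti : Antitone B := fun m n hmn =>
    inter_subset_inter_right _ fun x (hx : (n : ℝ≥0∞) < h x) => (Nat.cast_le.2 hmn).trans_lt hx
  have hBempty : ⋂ n, B n = ∅ := by
    refine eq_empty_of_forall_notMem fun x hx => ?_
    obtain ⟨n, hn⟩ := ENNReal.exists_nat_gt (hlt x)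
    exact lt_asymm hn (mem_iInter.1 hx n).2
  have hBlim : Tendsto (fun n => nu (B n)) atTop (𝓝 0) := by
    have := tendsto_measure_iInter_atTop (μ := nu) (fun n => (hB n).nullMeasurableSet) hBanti
      ⟨0, measure_ne_top_of_subset inter_subset_left hfin⟩
    rwa [hBempty, measure_empty] at this
  filter_upwards [hN.ae_exists_apply_eq_zero hB hBlim, hN.ae_exists_nat_eq hA hfin]
    with ω ⟨n, hn⟩ ⟨k, hk⟩
  calc ∫⁻ x in A, h x ∂(N ω) ≤ ∫⁻ _ in A, (n : ℝ≥0∞) ∂(N ω) := by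
        refine lintegral_mono_ae ((ae_restrict_iff' hA).2 ?_)
        filter_upwards [measure_eq_zero_iff_ae_notMem.1 hn] with x hx hxA
        exact not_lt.1 fun hlt => hx ⟨hxA, hlt⟩
    _ = n * k := by rw [setLIntegral_const, hk]
    _ < ⊤ := ENNReal.mul_lt_top (ENNReal.natCast_lt_top n) (ENNReal.natCast_lt_top k)

lemma measure_inter_lintegral_le (hN : IsPoissonRandomMeasure P N nu) {ι : Type*} [Countable ι]
    {A : ι → Set E} (hA : ∀ i, MeasurableSet (A i))
    (hdisj : Pairwise fun i j => Disjoint (A i) (A j)) {h : E → ℝ≥0∞} (hh : Measurable h)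
    (h0 : ∀ i, ∀ x ∈ A i, h x = 0) {s : Set (ι → ℝ≥0∞)} (hs : MeasurableSet s) (a : ℝ≥0∞) :
    P ((fun ω i => N ω (A i)) ⁻¹' s ∩ {ω | ∫⁻ x, h x ∂(N ω) ≤ a})
      = P ((fun ω i => N ω (A i)) ⁻¹' s) * P {ω | ∫⁻ x, h x ∂(N ω) ≤ a} := by
  set F : Set Ω := (fun ω i => N ω (A i)) ⁻¹' s
  have hF : MeasurableSet F := measurable_pi_iff.2 (fun i => hN.measurable_apply (hA i)) hs
  let G : ℕ → Set Ω := fun n => {ω | ∫⁻ x, SimpleFunc.eapprox h n x ∂(N ω) ≤ a}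
  have hGmeas (n) : MeasurableSet (G n) := measurableSet_le
    (hN.measurable_lintegral (SimpleFunc.eapprox h n).measurable) measurable_const
  have hGanti : Antitone G := fun m n hmn ω hω =>
    (lintegral_mono (SimpleFunc.monotone_eapprox h hmn)).trans hω
  have hG : {ω | ∫⁻ x, h x ∂(N ω) ≤ a} = ⋂ n, G n := by
    ext ω
    simp only [mem_ofPred_eq, mem_iInter, G, lintegral_eq_iSup_eapprox_lintegral hh, iSup_le_iff,
      SimpleFunc.lintegral_eq_lintegral]
  have hFG (n) : P (F ∩ G n) = P F * P (G n) :=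
    (hN.indepFun_apply_lintegral_simpleFunc hA hdisj fun i x hx => le_antisymm
      ((eapprox_le hh n x).trans_eq (h0 i x hx)) zero_le).measure_inter_preimage_eq_mul
      s (Iic a) hs measurableSet_Iic
  have hlimG : Tendsto (fun n => P (G n)) atTop (𝓝 (P (⋂ n, G n))) :=
    tendsto_measure_iInter_atTop (fun n => (hGmeas n).nullMeasurableSet) hGanti
      ⟨0, measure_ne_top _ _⟩
  have hlimFG : Tendsto (fun n => P (F ∩ G n)) atTop (𝓝 (P (⋂ n, F ∩ G n))) :=
    tendsto_measure_iInter_atTop (fun n => (hF.inter (hGmeas n)).nullMeasurableSet)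
      (fun m n hmn => inter_subset_inter_right _ (hGanti hmn)) ⟨0, measure_ne_top _ _⟩
  rw [hG, inter_iInter]
  refine tendsto_nhds_unique hlimFG ?_
  simp_rw [hFG]
  exact ENNReal.Tendsto.const_mul hlimG (Or.inr (measure_ne_top _ _))

/-- The event is split according to the first set that is charged, which is a property of the
counts and therefore independent of the integrals. -/
lemma le_measure_iUnion_apply_ne_zero_inter (hN : IsPoissonRandomMeasure P N nu)
    {A : ℕ → Set E} (hA : ∀ i, MeasurableSet (A i))
    (hdisj : Pairwise fun i j => Disjoint (A i) (A j)) (htop : nu (⋃ i, A i) = ⊤)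
    {h : ℕ → E → ℝ≥0∞} (hh : ∀ i, Measurable (h i)) (h0 : ∀ j i, ∀ x ∈ A i, h j x = 0)
    {a : ℕ → ℝ≥0∞} {p : ℝ≥0∞} (hp : ∀ i, p ≤ P {ω | ∫⁻ x, h i x ∂(N ω) ≤ a i}) :
    p ≤ P (⋃ i, {ω | N ω (A i) ≠ 0} ∩ {ω | ∫⁻ x, h i x ∂(N ω) ≤ a i}) := by
  let charged : ℕ → Set (ℕ → ℝ≥0∞) := fun i => {x | x i ≠ 0}
  have hcharged : ∀ i, MeasurableSet (disjointed charged i) := MeasurableSet.disjointed fun i =>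
    measurable_pi_apply i (measurableSet_singleton 0).compl
  let F : ℕ → Set Ω := fun i => (fun ω j => N ω (A j)) ⁻¹' disjointed charged i
  let G : ℕ → Set Ω := fun i => {ω | ∫⁻ x, h i x ∂(N ω) ≤ a i}
  have hF (i) : MeasurableSet (F i) :=
    measurable_pi_iff.2 (fun j => hN.measurable_apply (hA j)) (hcharged i)
  have hG (i) : MeasurableSet (G i) :=
    measurableSet_le (hN.measurable_lintegral (hh i)) measurable_const
  have hFdisj : Pairwise fun i j => Disjoint (F i) (F j) := fun i j hij =>
    (disjoint_disjointed charged hij).preimage _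
  have hFuniv : P (⋃ i, F i) = 1 := by
    refine (measure_congr (Filter.EventuallyEq.symm ?_)).trans measure_univ
    filter_upwards [hN.ae_exists_apply_ne_zero hA htop] with ω hω
    have hmem : ω ∈ ⋃ i, F i := by
      rw [← preimage_iUnion, iUnion_disjointed]
      exact mem_iUnion.2 hω
    exact (eq_true hmem).symm
  calc p = ∑' i, P (F i) * p := by
        rw [ENNReal.tsum_mul_right, ← measure_iUnion hFdisj hF, hFuniv, one_mul]
    _ ≤ ∑' i, P (F i) * P (G i) := by gcongr with i; exact hp i
    _ = ∑' i, P (F i ∩ G i) := by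
        simp_rw [F, G, hN.measure_inter_lintegral_le hA hdisj (hh _) (h0 _) (hcharged _)]
    _ = P (⋃ i, F i ∩ G i) := by
        refine (measure_iUnion (fun i j hij => ?_) fun i => (hF i).inter (hG i)).symm
        exact (hFdisj hij).mono inter_subset_left inter_subset_left
    _ ≤ _ := measure_mono (iUnion_mono fun i => inter_subset_inter_left _
        (preimage_mono (disjointed_subset charged i)))

end IsPoissonRandomMeasure

section HeatKernel

variable {d : ℕ}

lemma heatKernel_nonneg (t : ℝ) (x : Space d) : 0 ≤ heatKernel d t x := by
  unfold heatKernel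
  split_ifs <;> positivity

lemma heatKernel_of_nonpos {t : ℝ} (ht : t ≤ 0) (x : Space d) : heatKernel d t x = 0 :=
  if_neg (not_lt.2 ht)

lemma heatKernel_neg (t : ℝ) (x : Space d) : heatKernel d t (-x) = heatKernel d t x := by
  simp only [heatKernel, norm_neg]

lemma mildKernel_zero (t : ℝ) (q : ℝ × Space d) :
    mildKernel t 0 q = heatKernel d (t - q.1) q.2 := by
  rw [mildKernel, zero_sub, heatKernel_neg]

@[fun_prop]
lemma measurable_heatKernel : Measurable (fun q : ℝ × Space d => heatKernel d q.1 q.2) :=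
  Measurable.ite (measurableSet_lt measurable_const measurable_fst) (by fun_prop) measurable_const

lemma heatKernel_eq_exp_mul {t : ℝ} (ht : 0 < t) (x : Space d) :
    heatKernel d t x
      = (4 * Real.pi * t) ^ (-(d : ℝ) / 2) * Real.exp (-(1 / (4 * t)) * ‖x‖ ^ 2) := by
  rw [heatKernel, if_pos ht]
  congr 2
  ring

lemma lintegral_heatKernel {t : ℝ} (ht : 0 < t) :
    ∫⁻ x : Space d, ENNReal.ofReal (heatKernel d t x) = 1 := by
  have hpos : 0 < (4 * Real.pi * t) ^ ((d : ℝ) / 2) := by positivity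
  have hgauss : ∫ x : Space d, Real.exp (-(1 / (4 * t)) * ‖x‖ ^ 2)
      = (4 * Real.pi * t) ^ ((d : ℝ) / 2) := by
    rw [GaussianFourier.integral_rexp_neg_mul_sq_norm (V := Space d) (by positivity),
      finrank_euclideanSpace, Fintype.card_fin]
    congr 1
    field_simp
  have hint : Integrable (heatKernel d t) := by
    rw [funext (heatKernel_eq_exp_mul ht)]
    exact (Integrable.of_integral_ne_zero (hgauss ▸ hpos.ne')).const_mul _
  rw [← ofReal_integral_eq_lintegral_ofReal hint (ae_of_all _ (heatKernel_nonneg t)),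
    funext (heatKernel_eq_exp_mul ht), integral_const_mul, hgauss, neg_div,
    Real.rpow_neg (by positivity), inv_mul_cancel₀ hpos.ne', ENNReal.ofReal_one]

lemma sq_heatKernel {t : ℝ} (ht : 0 < t) (x : Space d) :
    heatKernel d t x ^ 2 = ((4 * Real.pi * t) ^ d)⁻¹ * Real.exp (-(‖x‖ ^ 2 / (2 * t))) := by
  rw [heatKernel, if_pos ht, mul_pow, ← Real.rpow_natCast, ← Real.rpow_mul (by positivity),
    ← Real.exp_nat_mul]
  congr 1
  · rw [show -(d : ℝ) / 2 * (2 : ℕ) = -(d : ℝ) by push_cast; ring, Real.rpow_neg (by positivity),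
      Real.rpow_natCast]
  · congr 1
    push_cast
    field_simp
    ring

lemma sq_heatKernel_mul_pow_le {t : ℝ} (ht : 0 < t) (x : Space d) (n : ℕ) :
    heatKernel d t x ^ 2 * (‖x‖ ^ 2) ^ n ≤ (2 * t) ^ n / (4 * Real.pi * t) ^ d * n.factorial := by
  set u := ‖x‖ ^ 2 / (2 * t) with hu
  have hx : ‖x‖ ^ 2 = 2 * t * u := by rw [hu, mul_div_cancel₀ _ (by positivity)]
  have hpow : u ^ n ≤ n.factorial * Real.exp u := by
    rw [← div_le_iff₀' (by positivity)]
    exact Real.pow_div_factorial_le_exp u (by positivity) n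
  calc heatKernel d t x ^ 2 * (‖x‖ ^ 2) ^ n
      = (2 * t) ^ n / (4 * Real.pi * t) ^ d * (Real.exp u)⁻¹ * u ^ n := by
        rw [sq_heatKernel ht, ← hu, Real.exp_neg, hx, mul_pow (2 * t)]
        ring
    _ ≤ (2 * t) ^ n / (4 * Real.pi * t) ^ d * (Real.exp u)⁻¹ * (n.factorial * Real.exp u) := by
        gcongr
    _ = (2 * t) ^ n / (4 * Real.pi * t) ^ d * n.factorial := by field_simp

/-- A constant bounding both `heatKernel d t x * ‖x‖ ^ d` for all times and
`heatKernel d t x * ‖x‖ ^ (2 * d)` for bounded times. -/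
noncomputable def heatBound (d : ℕ) : ℝ := √((2 * d).factorial)

lemma one_le_heatBound : 1 ≤ heatBound d := by
  rw [heatBound, Real.one_le_sqrt]
  exact_mod_cast Nat.factorial_pos _

lemma heatKernel_mul_pow_le (t : ℝ) (x : Space d) :
    heatKernel d t x * ‖x‖ ^ d ≤ heatBound d := by
  rcases le_or_gt t 0 with ht | ht
  · rw [heatKernel_of_nonpos ht, zero_mul]
    exact zero_le_one.trans one_le_heatBound
  refine Real.le_sqrt_of_sq_le ?_
  calc (heatKernel d t x * ‖x‖ ^ d) ^ 2 = heatKernel d t x ^ 2 * (‖x‖ ^ 2) ^ d := by ring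
    _ ≤ (2 * t) ^ d / (4 * Real.pi * t) ^ d * d.factorial := sq_heatKernel_mul_pow_le ht x d
    _ ≤ 1 * (2 * d).factorial := by
        gcongr
        · rw [div_le_one (by positivity)]
          gcongr
          linarith [Real.pi_gt_three]
        · omega
    _ = (2 * d).factorial := one_mul _

lemma heatKernel_mul_pow_sq_le {t : ℝ} (ht2 : t ≤ 2) (x : Space d) :
    heatKernel d t x * (‖x‖ ^ d) ^ 2 ≤ heatBound d := by
  rcases le_or_gt t 0 with ht | ht
  · rw [heatKernel_of_nonpos ht, zero_mul]
    exact zero_le_one.trans one_le_heatBound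
  refine Real.le_sqrt_of_sq_le ?_
  calc (heatKernel d t x * (‖x‖ ^ d) ^ 2) ^ 2
      = heatKernel d t x ^ 2 * (‖x‖ ^ 2) ^ (2 * d) := by ring
    _ ≤ (2 * t) ^ (2 * d) / (4 * Real.pi * t) ^ d * (2 * d).factorial :=
        sq_heatKernel_mul_pow_le ht x (2 * d)
    _ ≤ 1 * (2 * d).factorial := by
        gcongr
        rw [div_le_one (by positivity), pow_mul]
        gcongr
        nlinarith [Real.pi_gt_three]
    _ = (2 * d).factorial := one_mul _

lemma heatKernel_le_one {t : ℝ} (ht : 1 ≤ t) (x : Space d) : heatKernel d t x ≤ 1 := by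
  rw [heatKernel, if_pos (by linarith), neg_div, neg_div]
  refine mul_le_one₀ (Real.rpow_le_one_of_one_le_of_nonpos ?_ ?_) (Real.exp_pos _).le
    (Real.exp_le_one_iff.2 ?_)
  · nlinarith [Real.pi_gt_three]
  · exact neg_nonpos.2 (by positivity)
  · exact neg_nonpos.2 (by positivity)

lemma monotoneOn_rpow_mul_heatKernel (x : Space d) :
    MonotoneOn (fun t => t ^ ((d : ℝ) / 2) * heatKernel d t x) (Ioi 0) := by
  have hrescaled {r : ℝ} (hr : 0 < r) : r ^ ((d : ℝ) / 2) * heatKernel d r x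
      = (4 * Real.pi) ^ (-(d : ℝ) / 2) * Real.exp (-(‖x‖ ^ 2 / (4 * r))) := by
    have hne : r ^ ((d : ℝ) / 2) ≠ 0 := by positivity
    rw [heatKernel, if_pos hr, Real.mul_rpow (by positivity) hr.le, neg_div, neg_div,
      Real.rpow_neg hr.le]
    field_simp
  intro s (hs : 0 < s) t _ hst
  dsimp only
  rw [hrescaled hs, hrescaled (hs.trans_le hst)]
  gcongr

/-- A lower bound for `r ^ d * heatKernel d t x` in the parabolic region `r ^ 2 ≤ t ≤ 2 * r ^ 2`,
`‖x‖ ≤ r`. -/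
noncomputable def heatLowerBound (d : ℕ) : ℝ :=
  (8 * Real.pi) ^ (-(d : ℝ) / 2) * Real.exp (-(1 / 4))

lemma heatLowerBound_pos : 0 < heatLowerBound d := by
  unfold heatLowerBound
  positivity

lemma heatLowerBound_mul_inv_pow_le {r t : ℝ} (hr : 0 < r) (hrt : r ^ 2 ≤ t) (htr : t ≤ 2 * r ^ 2)
    {x : Space d} (hx : ‖x‖ ≤ r) :
    heatLowerBound d * (r ^ d)⁻¹ ≤ heatKernel d t x := by
  have ht : 0 < t := (pow_pos hr 2).trans_le hrt
  have hscale : (r ^ d)⁻¹ = (r ^ 2) ^ (-(d : ℝ) / 2) := by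
    rw [← Real.rpow_natCast r 2, ← Real.rpow_mul hr.le, ← Real.rpow_natCast r d,
      ← Real.rpow_neg hr.le]
    congr 1
    push_cast
    ring
  have hpow : (8 * Real.pi * r ^ 2) ^ (-(d : ℝ) / 2) ≤ (4 * Real.pi * t) ^ (-(d : ℝ) / 2) := by
    refine Real.rpow_le_rpow_of_nonpos (by positivity) ?_ ?_
    · nlinarith [Real.pi_pos]
    · rw [neg_div]
      exact neg_nonpos.2 (by positivity)
  have hexponent : -(1 / 4) ≤ -‖x‖ ^ 2 / (4 * t) := by
    have hxt : ‖x‖ ^ 2 ≤ t := (pow_le_pow_left₀ (norm_nonneg x) hx 2).trans hrt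
    rw [neg_div, neg_le_neg_iff, div_le_div_iff₀ (by positivity) (by positivity)]
    linarith
  rw [heatKernel, if_pos ht, heatLowerBound, hscale, mul_right_comm,
    ← Real.mul_rpow (by positivity) (by positivity)]
  gcongr

lemma volume_norm_pow_lt (hd : 1 ≤ d) (a : ℝ) :
    volume {x : Space d | ‖x‖ ^ d < a}
      = volume (Metric.ball (0 : Space d) 1) * ENNReal.ofReal a := by
  have hd0 : d ≠ 0 := Nat.one_le_iff_ne_zero.1 hd
  have : Nonempty (Fin d) := ⟨⟨0, hd⟩⟩
  rcases le_or_gt a 0 with ha | ha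
  · have hempty : {x : Space d | ‖x‖ ^ d < a} = ∅ :=
      eq_empty_of_forall_notMem fun x hx => not_lt.2 (ha.trans (by positivity)) hx
    rw [hempty, measure_empty, ENNReal.ofReal_of_nonpos ha, mul_zero]
  · have hball : {x : Space d | ‖x‖ ^ d < a} = Metric.ball (0 : Space d) (a ^ ((d : ℝ)⁻¹)) := by
      ext x
      rw [mem_ball_zero_iff, Real.lt_rpow_inv_iff_of_pos (norm_nonneg _) ha.le (by positivity),
        Real.rpow_natCast, mem_ofPred_eq]
    rw [hball, Measure.addHaar_ball _ _ (by positivity), finrank_euclideanSpace,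
      Fintype.card_fin, Real.rpow_inv_natCast_pow ha.le hd0, mul_comm]

lemma map_norm_pow_volume (hd : 1 ≤ d) :
    (volume : Measure (Space d)).map (fun x => ‖x‖ ^ d)
      = volume (Metric.ball (0 : Space d) 1) • (volume : Measure ℝ).restrict (Ioi 0) := by
  have hIio (a : ℝ) : (volume : Measure (Space d)).map (fun x => ‖x‖ ^ d) (Iio a)
      = volume (Metric.ball (0 : Space d) 1) * ENNReal.ofReal a := by
    rw [Measure.map_apply (by fun_prop) measurableSet_Iio]
    exact volume_norm_pow_lt hd a
  refine Measure.ext_of_generateFrom_of_iUnion (range Iio) (fun n : ℕ => Iio (n : ℝ))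
    ((BorelSpace.measurable_eq (α := ℝ)).trans (borel_eq_generateFrom_Iio ℝ)) isPiSystem_Iio
    (eq_univ_of_forall fun x => mem_iUnion.2 (exists_nat_gt x)) (fun n => ⟨n, rfl⟩) ?_ ?_
  · intro n
    rw [hIio]
    exact (ENNReal.mul_lt_top measure_ball_lt_top ENNReal.ofReal_lt_top).ne
  · rintro _ ⟨a, rfl⟩
    rw [hIio, Measure.smul_apply, smul_eq_mul, Measure.restrict_apply measurableSet_Iio,
      Iio_inter_Ioi, Real.volume_Ioo, sub_zero]

lemma lintegral_norm_pow (hd : 1 ≤ d) {φ : ℝ → ℝ≥0∞} (hφ : Measurable φ) :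
    ∫⁻ x : Space d, φ (‖x‖ ^ d)
      = volume (Metric.ball (0 : Space d) 1) * ∫⁻ v in Ioi 0, φ v := by
  rw [← lintegral_map (μ := volume) (g := fun x : Space d => ‖x‖ ^ d) hφ (by fun_prop),
    map_norm_pow_volume hd, lintegral_smul_measure, smul_eq_mul]

end HeatKernel

section LevyMeasure

variable {lam : Measure ℝ}

lemma IsLevyMeasure.measure_lt_abs_lt_top (hlam : IsLevyMeasure lam) {δ : ℝ} (hδ : 0 < δ) :
    lam {z | δ < |z|} < ⊤ := by
  have hpos : ENNReal.ofReal (min 1 (δ ^ 2)) ≠ 0 := (ENNReal.ofReal_pos.2 (by positivity)).ne'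
  have hsub : {z | δ < |z|}
      ⊆ {z | ENNReal.ofReal (min 1 (δ ^ 2)) ≤ ENNReal.ofReal (min 1 (z ^ 2))} := fun z hz =>
    ENNReal.ofReal_le_ofReal
      (min_le_min_left _ (sq_le_sq.2 ((abs_of_pos hδ).trans_le (le_of_lt hz))))
  calc lam {z | δ < |z|}
      ≤ (∫⁻ z, ENNReal.ofReal (min 1 (z ^ 2)) ∂lam) / ENNReal.ofReal (min 1 (δ ^ 2)) :=
        (measure_mono hsub).trans
          (meas_ge_le_lintegral_div (by fun_prop) hpos ENNReal.ofReal_ne_top)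
    _ < ⊤ := ENNReal.div_lt_top hlam.lintegral_min_lt_top.ne hpos

lemma IsLevyMeasure.sigmaFinite (hlam : IsLevyMeasure lam) : SigmaFinite lam := by
  refine ⟨⟨⟨fun n : ℕ => {0} ∪ {z | 1 / ((n : ℝ) + 1) < |z|}, fun _ => trivial, fun n => ?_, ?_⟩⟩⟩
  · refine (measure_union_le _ _).trans_lt ?_
    rw [hlam.zero_singleton, zero_add]
    exact hlam.measure_lt_abs_lt_top (by positivity)
  · refine eq_univ_of_forall fun z => mem_iUnion.2 ?_
    rcases eq_or_ne z 0 with hz | hz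
    · exact ⟨0, Or.inl hz⟩
    · obtain ⟨n, hn⟩ := exists_nat_one_div_lt (abs_pos.2 hz)
      exact ⟨n, Or.inr hn⟩

lemma IsLevyMeasure.ae_ne_zero (hlam : IsLevyMeasure lam) : ∀ᵐ z ∂lam, z ≠ 0 :=
  measure_eq_zero_iff_ae_notMem.1 hlam.zero_singleton

lemma one_le_abs_log_of_abs_le_exp_neg_one {z : ℝ} (hz0 : z ≠ 0) (hz : |z| ≤ Real.exp (-1)) :
    1 ≤ |Real.log z| := by
  have hlog : Real.log z ≤ -1 := by
    rw [← Real.log_abs]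
    exact (Real.log_le_iff_le_exp (abs_pos.2 hz0)).2 hz
  exact le_abs.2 (Or.inr (by linarith))

lemma abs_le_rpow_add_indicator_log_add_min_sq {p : ℝ} (hp : 1 ≤ p) (z : ℝ) :
    |z| ≤ |z| ^ p + (Icc (-1) 1).indicator (fun z => |z * Real.log z|) z + 9 * min 1 (z ^ 2) := by
  have hrpow : 0 ≤ |z| ^ p := by positivity
  have hind : 0 ≤ (Icc (-1) 1).indicator (fun z => |z * Real.log z|) z :=
    indicator_nonneg (fun _ _ => abs_nonneg _) _
  have hmin : 0 ≤ 9 * min 1 (z ^ 2) := by positivity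
  rcases le_or_gt 1 |z| with hlarge | hsmall
  · linarith [Real.self_le_rpow_of_one_le hlarge hp]
  rcases le_or_gt |z| (Real.exp (-1)) with htiny | hmedium
  · have hlog : |z| ≤ (Icc (-1) 1).indicator (fun z => |z * Real.log z|) z := by
      rw [indicator_of_mem (show z ∈ Icc (-1) 1 from abs_le.1 hsmall.le), abs_mul]
      rcases eq_or_ne z 0 with rfl | hz0
      · simp
      · exact le_mul_of_one_le_right (abs_nonneg z)
          (one_le_abs_log_of_abs_le_exp_neg_one hz0 htiny)
    linarith
  · have hthird : 1 / 3 ≤ |z| := by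
      refine le_trans ?_ hmedium.le
      rw [Real.exp_neg, one_div]
      exact inv_anti₀ (Real.exp_pos 1) Real.exp_one_lt_three.le
    rw [← sq_abs z, min_eq_right (by nlinarith)] at *
    nlinarith

lemma IsLevyMeasure.lintegral_abs_lt_top (hlam : IsLevyMeasure lam)
    (hmoment : ∃ ε : ℝ, 0 < ε ∧ Integrable (fun z : ℝ => |z| ^ (1 + ε)) lam)
    (hlog : IntegrableOn (fun z : ℝ => |z * Real.log z|) (Icc (-1) 1) lam) :
    ∫⁻ z, ENNReal.ofReal |z| ∂lam < ⊤ := by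
  obtain ⟨ε, hε, hrpow⟩ := hmoment
  have hmin : Integrable (fun z => min 1 (z ^ 2)) lam :=
    ⟨(by fun_prop : Measurable _).aestronglyMeasurable, by
      rw [hasFiniteIntegral_iff_ofReal (ae_of_all _ fun z => by positivity)]
      exact hlam.lintegral_min_lt_top⟩
  have hdom := (hrpow.add (hlog.integrable_indicator measurableSet_Icc)).add (hmin.const_mul 9)
  refine (hdom.mono' (by fun_prop) (ae_of_all _ fun z => ?_)).lintegral_lt_top
  rw [Real.norm_eq_abs, abs_abs]
  exact abs_le_rpow_add_indicator_log_add_min_sq (by linarith) z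

end LevyMeasure

section JumpIntensity

variable {d : ℕ} {lam : Measure ℝ} [SFinite lam]

lemma lintegral_jumpIntensity {h : ℝ × Space d × ℝ → ℝ≥0∞} (hh : Measurable h) :
    ∫⁻ p, h p ∂(jumpIntensity d lam) = ∫⁻ s in Ioi 0, ∫⁻ z, ∫⁻ y, h (s, y, z) ∂volume ∂lam := by
  rw [jumpIntensity, lintegral_prod _ hh.aemeasurable]
  exact lintegral_congr fun s => lintegral_prod_symm _ (by fun_prop)

lemma setLIntegral_jumpIntensity_prod {I : Set ℝ} (hI : MeasurableSet I) (B : Set (Space d × ℝ))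
    {φ : Space d × ℝ → ℝ≥0∞} (hφ : Measurable φ) :
    ∫⁻ p in I ×ˢ B, φ p.2 ∂(jumpIntensity d lam)
      = volume (I ∩ Ioi 0) * ∫⁻ q in B, φ q ∂(volume.prod lam) := by
  rw [jumpIntensity, ← Measure.prod_restrict, Measure.restrict_restrict hI,
    ← lintegral_map hφ measurable_snd, Measure.map_snd_prod, lintegral_smul_measure,
    Measure.restrict_apply_univ, smul_eq_mul]

lemma jumpIntensity_prod {I : Set ℝ} (hI : MeasurableSet I) (B : Set (Space d × ℝ)) :
    jumpIntensity d lam (I ×ˢ B) = volume (I ∩ Ioi 0) * (volume.prod lam) B := by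
  rw [jumpIntensity, Measure.prod_prod, Measure.restrict_apply hI]

lemma prod_norm_pow_lt (hd : 1 ≤ d) {φ : ℝ → ℝ} (hφ : Measurable φ) :
    (volume.prod lam) {q : Space d × ℝ | ‖q.1‖ ^ d < φ q.2}
      = volume (Metric.ball (0 : Space d) 1) * ∫⁻ z, ENNReal.ofReal (φ z) ∂lam := by
  rw [Measure.prod_apply_symm (measurableSet_lt (by fun_prop) (by fun_prop)),
    ← lintegral_const_mul _ (by fun_prop)]
  exact lintegral_congr fun z => volume_norm_pow_lt hd (φ z)

lemma jumpIntensity_space_eq_zero (hd : 1 ≤ d) :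
    jumpIntensity d lam {p | p.2.1 = 0} = 0 := by
  have : Nonempty (Fin d) := ⟨⟨0, hd⟩⟩
  have hprod : {p : ℝ × Space d × ℝ | p.2.1 = 0} = univ ×ˢ ({0} ×ˢ univ) := by
    ext p
    simp
  rw [hprod, jumpIntensity, Measure.prod_prod, Measure.prod_prod, measure_singleton, zero_mul,
    mul_zero]

end JumpIntensity

section JumpPotentials

variable {d : ℕ} {lam : Measure ℝ}

/-- The absolute contribution of a jump `(s, y, z)` to the solution at `(t, 0)`. -/
noncomputable def jumpHeat (t : ℝ) (p : ℝ × Space d × ℝ) : ℝ≥0∞ :=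
  ENNReal.ofReal (heatKernel d (t - p.1) p.2.1 * |p.2.2|)

@[fun_prop]
lemma measurable_jumpHeat (t : ℝ) : Measurable (jumpHeat (d := d) t) := by
  unfold jumpHeat
  fun_prop

/-- Up to the factor `heatBound d`, a bound for the contribution at the origin of a jump of size
`z` at `y` at all times up to two units after its occurrence. -/
noncomputable def recentJump (q : Space d × ℝ) : ℝ≥0∞ :=
  ENNReal.ofReal (|q.2| * min (‖q.1‖ ^ d)⁻¹ ((‖q.1‖ ^ d) ^ 2)⁻¹)

@[fun_prop]
lemma measurable_recentJump : Measurable (recentJump (d := d)) := by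
  unfold recentJump
  fun_prop

/-- Up to the factor `heatBound d`, a bound for the contribution at the origin of a jump of size
`z` at `y` at all times from one unit after its occurrence on. -/
noncomputable def pastJump (q : Space d × ℝ) : ℝ≥0∞ :=
  ENNReal.ofReal (|q.2| * min 1 (‖q.1‖ ^ d)⁻¹)

@[fun_prop]
lemma measurable_pastJump : Measurable (pastJump (d := d)) := by
  unfold pastJump
  fun_prop

lemma jumpHeat_eq_zero {t : ℝ} {p : ℝ × Space d × ℝ} (ht : t ≤ p.1) : jumpHeat t p = 0 := by
  rw [jumpHeat, heatKernel_of_nonpos (sub_nonpos.2 ht), zero_mul, ENNReal.ofReal_zero]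

lemma jumpHeat_le_mul {s t C m : ℝ} {y : Space d} {z : ℝ} (hC : 0 ≤ C)
    (h : heatKernel d (t - s) y ≤ C * m) :
    jumpHeat t (s, y, z) ≤ ENNReal.ofReal C * ENNReal.ofReal (|z| * m) := by
  rw [jumpHeat, ← ENNReal.ofReal_mul hC, mul_left_comm, mul_comm]
  gcongr

lemma heatKernel_le_heatBound_mul_inv (t : ℝ) {y : Space d} (hy : y ≠ 0) :
    heatKernel d t y ≤ heatBound d * (‖y‖ ^ d)⁻¹ := by
  have := norm_pos_iff.2 hy
  rw [← div_eq_mul_inv, le_div_iff₀ (by positivity)]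
  exact heatKernel_mul_pow_le t y

lemma jumpHeat_le_recentJump {t : ℝ} {p : ℝ × Space d × ℝ} (hp : p.2.1 ≠ 0) (ht : t - p.1 ≤ 2) :
    jumpHeat t p ≤ ENNReal.ofReal (heatBound d) * recentJump p.2 := by
  have := norm_pos_iff.2 hp
  have hC : 0 ≤ heatBound d := zero_le_one.trans one_le_heatBound
  refine jumpHeat_le_mul hC ?_
  rw [mul_min_of_nonneg _ _ hC]
  refine le_min (heatKernel_le_heatBound_mul_inv _ hp) ?_
  rw [← div_eq_mul_inv, le_div_iff₀ (by positivity)]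
  exact heatKernel_mul_pow_sq_le ht _

lemma jumpHeat_le_pastJump {t : ℝ} {p : ℝ × Space d × ℝ} (hp : p.2.1 ≠ 0) (ht : 1 ≤ t - p.1) :
    jumpHeat t p ≤ ENNReal.ofReal (heatBound d) * pastJump p.2 := by
  have hC : 0 ≤ heatBound d := zero_le_one.trans one_le_heatBound
  refine jumpHeat_le_mul hC ?_
  rw [mul_min_of_nonneg _ _ hC, mul_one]
  exact le_min ((heatKernel_le_one ht _).trans one_le_heatBound)
    (heatKernel_le_heatBound_mul_inv _ hp)

lemma lintegral_heatKernel_eq_indicator (t : ℝ) :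
    ∫⁻ y : Space d, ENNReal.ofReal (heatKernel d t y) = (Ioi 0).indicator 1 t := by
  rcases le_or_gt t 0 with ht | ht
  · simp [heatKernel_of_nonpos ht, ht]
  · rw [lintegral_heatKernel ht, indicator_of_mem (mem_Ioi.2 ht), Pi.one_apply]

lemma lintegral_indicator_mul_heatKernel_mul [SFinite lam] (t : ℝ) {I : Set ℝ}
    (hI : MeasurableSet I) {w : ℝ → ℝ≥0∞} (hw : Measurable w) :
    ∫⁻ p, I.indicator 1 p.1 * ENNReal.ofReal (heatKernel d (t - p.1) p.2.1) * w p.2.2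
      ∂(jumpIntensity d lam) = volume (I ∩ Ioo 0 t) * ∫⁻ z, w z ∂lam := by
  have : Measurable (I.indicator (1 : ℝ → ℝ≥0∞)) := measurable_one.indicator hI
  have hkernel (s : ℝ) : Measurable (fun y : Space d => ENNReal.ofReal (heatKernel d (t - s) y)) :=
    (measurable_heatKernel.comp (measurable_prodMk_left (x := t - s))).ennreal_ofReal
  have hspace (s z : ℝ) : ∫⁻ y : Space d,
      I.indicator 1 s * ENNReal.ofReal (heatKernel d (t - s) y) * w z
      = (I ∩ Iio t).indicator 1 s * w z := by
    rw [lintegral_mul_const _ ((hkernel s).const_mul _), lintegral_const_mul _ (hkernel s),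
      lintegral_heatKernel_eq_indicator]
    rw [inter_indicator_one, Pi.mul_apply]
    simp only [indicator_apply, mem_Ioi, sub_pos, mem_Iio, Pi.one_apply]
  rw [lintegral_jumpIntensity (by fun_prop)]
  simp_rw [hspace, lintegral_const_mul _ hw]
  rw [lintegral_mul_const _ (measurable_one.indicator (hI.inter measurableSet_Iio)),
    lintegral_indicator_one (hI.inter measurableSet_Iio),
    Measure.restrict_apply (hI.inter measurableSet_Iio), inter_assoc, Iio_inter_Ioi]

lemma lintegral_jumpHeat [SFinite lam] (t : ℝ) :
    ∫⁻ p, jumpHeat t p ∂(jumpIntensity d lam)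
      = ENNReal.ofReal t * ∫⁻ z, ENNReal.ofReal |z| ∂lam := by
  have hfactor := lintegral_indicator_mul_heatKernel_mul (d := d) (lam := lam) t MeasurableSet.univ
    (w := fun z => ENNReal.ofReal |z|) (by fun_prop)
  rw [univ_inter, Real.volume_Ioo, sub_zero] at hfactor
  rw [← hfactor]
  refine lintegral_congr fun p => ?_
  rw [jumpHeat, ENNReal.ofReal_mul (heatKernel_nonneg _ _), indicator_univ, Pi.one_apply, one_mul]

lemma lt_div_of_lt_mul_inv {a b v : ℝ} (hb : 0 < b) (hv : 0 ≤ v) (h : b < a * v⁻¹) :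
    v < a / b := by
  rcases hv.eq_or_lt with rfl | hv
  · rw [inv_zero, mul_zero] at h
    exact absurd h hb.not_gt
  · rw [← div_eq_mul_inv, lt_div_iff₀ hv] at h
    rwa [lt_div_iff₀' hb]

lemma prod_lt_recentJump_le (hd : 1 ≤ d) [SFinite lam] {b : ℝ} (hb : 0 < b) :
    (volume.prod lam) {q : Space d × ℝ | ENNReal.ofReal b < recentJump q}
      ≤ volume (Metric.ball (0 : Space d) 1) *
        ((∫⁻ z, ENNReal.ofReal |z| ∂lam) / ENNReal.ofReal b) := by
  have hsub : {q : Space d × ℝ | ENNReal.ofReal b < recentJump q}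
      ⊆ {q | ‖q.1‖ ^ d < |q.2| / b} := fun q hq =>
    lt_div_of_lt_mul_inv hb (by positivity) ((ENNReal.ofReal_lt_ofReal_iff'.1 hq).1.trans_le
      (mul_le_mul_of_nonneg_left (min_le_left _ _) (abs_nonneg _)))
  refine (measure_mono hsub).trans_eq ?_
  rw [prod_norm_pow_lt hd (by fun_prop : Measurable fun z : ℝ => |z| / b)]
  simp_rw [ENNReal.ofReal_div_of_pos hb, div_eq_mul_inv]
  rw [lintegral_mul_const _ (by fun_prop)]

lemma lintegral_Icc_inv_le {a b : ℝ} (ha : 0 < a) (hab : Real.log a⁻¹ ≤ b) :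
    ∫⁻ v in Icc a 1, ENNReal.ofReal v⁻¹ ≤ ENNReal.ofReal b := by
  rcases le_or_gt a 1 with ha1 | ha1
  · have hint : IntegrableOn (fun v : ℝ => v⁻¹) (Icc a 1) :=
      (continuousOn_id.inv₀ fun x hx => (ha.trans_le hx.1).ne').integrableOn_Icc
    have hnonneg : ∀ᵐ v ∂volume.restrict (Icc a 1), 0 ≤ v⁻¹ :=
      ae_restrict_of_forall_mem measurableSet_Icc fun v hv => inv_nonneg.2 (ha.le.trans hv.1)
    rw [← ofReal_integral_eq_lintegral_ofReal hint hnonneg, integral_Icc_eq_integral_Ioc,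
      ← intervalIntegral.integral_of_le ha1, integral_inv_of_pos ha one_pos, one_div]
    exact ENNReal.ofReal_le_ofReal hab
  · rw [Icc_eq_empty ha1.not_ge, setLIntegral_empty]
    exact zero_le

lemma lintegral_Ioi_inv_sq : ∫⁻ v in Ioi (1 : ℝ), ENNReal.ofReal (v ^ 2)⁻¹ = 1 := by
  have hrpow : ∀ v ∈ Ioi (1 : ℝ), v ^ (-2 : ℝ) = (v ^ 2)⁻¹ := fun v hv => by
    rw [Real.rpow_neg (zero_le_one.trans (le_of_lt hv)), Real.rpow_two]
  have hint : IntegrableOn (fun v : ℝ => (v ^ 2)⁻¹) (Ioi 1) :=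
    (integrableOn_Ioi_rpow_of_lt (by norm_num : (-2 : ℝ) < -1) one_pos).congr_fun hrpow
      measurableSet_Ioi
  rw [← ofReal_integral_eq_lintegral_ofReal hint (ae_of_all _ fun v => by positivity),
    ← setIntegral_congr_fun measurableSet_Ioi hrpow,
    integral_Ioi_rpow_of_lt (by norm_num) one_pos]
  norm_num

lemma log_inv_abs_div_le {z b : ℝ} (hz : z ≠ 0) (hb : 0 < b) :
    Real.log (|z| / b)⁻¹ ≤ Real.log b + (Icc (-1) 1).indicator (fun z => |Real.log z|) z := by
  rw [inv_div, Real.log_div hb.ne' (abs_pos.2 hz).ne', Real.log_abs]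
  by_cases hmem : z ∈ Icc (-1) 1
  · rw [indicator_of_mem hmem]
    linarith [neg_le_abs (Real.log z)]
  · have hlog : 0 ≤ Real.log z := by
      rw [← Real.log_abs]
      exact Real.log_nonneg (not_le.1 fun h => hmem (abs_le.1 h)).le
    rw [indicator_of_notMem hmem]
    linarith

lemma indicator_mul_min_inv_le {a b v : ℝ} (ha : 0 ≤ a) (hb : 0 < b) (hv : 0 < v) :
    {v : ℝ | a * min v⁻¹ (v ^ 2)⁻¹ ≤ b}.indicator
        (fun v => ENNReal.ofReal (a * min v⁻¹ (v ^ 2)⁻¹)) v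
      ≤ ENNReal.ofReal a * ((Ioi 1).indicator (fun v => ENNReal.ofReal (v ^ 2)⁻¹) v
        + (Icc (a / b) 1).indicator (fun v => ENNReal.ofReal v⁻¹) v) := by
  refine indicator_apply_le' (fun hle => ?_) fun _ => zero_le
  rw [ENNReal.ofReal_mul ha]
  gcongr
  rcases le_or_gt v 1 with hv1 | hv1
  · have hmin : min v⁻¹ (v ^ 2)⁻¹ = v⁻¹ :=
      min_eq_left (inv_anti₀ (by positivity) (by nlinarith))
    rw [mem_ofPred_eq, hmin, ← div_eq_mul_inv, div_le_comm₀ hv hb] at hle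
    rw [hmin, indicator_of_mem (show v ∈ Icc (a / b) 1 from ⟨hle, hv1⟩)]
    exact le_add_left le_rfl
  · rw [indicator_of_mem (mem_Ioi.2 hv1)]
    exact le_add_right (ENNReal.ofReal_le_ofReal (min_le_right _ _))

lemma lintegral_indicator_mul_min_inv_le {z b : ℝ} (hz : z ≠ 0) (hb : 1 ≤ b) :
    ∫⁻ v in Ioi (0 : ℝ), {v : ℝ | |z| * min v⁻¹ (v ^ 2)⁻¹ ≤ b}.indicator
        (fun v => ENNReal.ofReal (|z| * min v⁻¹ (v ^ 2)⁻¹)) v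
      ≤ ENNReal.ofReal |z| * ENNReal.ofReal (1 + Real.log b)
        + (Icc (-1 : ℝ) 1).indicator (fun z => ENNReal.ofReal |z * Real.log z|) z := by
  have hb0 : 0 < b := one_pos.trans_le hb
  set c : ℝ := (Icc (-1 : ℝ) 1).indicator (fun z => |Real.log z|) z with hc
  have hc0 : 0 ≤ c := indicator_nonneg (fun _ _ => abs_nonneg _) _
  calc _ ≤ ∫⁻ v in Ioi (0 : ℝ),
          ENNReal.ofReal |z| * ((Ioi 1).indicator (fun v => ENNReal.ofReal (v ^ 2)⁻¹) v
            + (Icc (|z| / b) 1).indicator (fun v => ENNReal.ofReal v⁻¹) v) :=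
        setLIntegral_mono' measurableSet_Ioi fun v hv =>
          indicator_mul_min_inv_le (abs_nonneg z) hb0 hv
    _ ≤ ENNReal.ofReal |z| * ((∫⁻ v in Ioi (1 : ℝ), ENNReal.ofReal (v ^ 2)⁻¹)
          + ∫⁻ v in Icc (|z| / b) 1, ENNReal.ofReal v⁻¹) := by
        have hmeas : Measurable ((Ioi 1).indicator fun v : ℝ => ENNReal.ofReal (v ^ 2)⁻¹) :=
          Measurable.indicator (by fun_prop) measurableSet_Ioi
        refine (setLIntegral_le_lintegral _ _).trans_eq ?_
        rw [lintegral_const_mul' _ _ ENNReal.ofReal_ne_top, lintegral_add_left hmeas,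
          lintegral_indicator measurableSet_Ioi, lintegral_indicator measurableSet_Icc]
    _ ≤ ENNReal.ofReal |z| * (1 + ENNReal.ofReal (Real.log b + c)) := by
        rw [lintegral_Ioi_inv_sq]
        gcongr
        have := abs_pos.2 hz
        exact lintegral_Icc_inv_le (by positivity) (log_inv_abs_div_le hz hb0)
    _ = _ := by
        rw [← ENNReal.ofReal_one, ← ENNReal.ofReal_add zero_le_one
          (add_nonneg (Real.log_nonneg hb) hc0), ← add_assoc, ENNReal.ofReal_add
          (add_nonneg zero_le_one (Real.log_nonneg hb)) hc0, mul_add]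
        congr 1
        simp only [hc, indicator_apply, abs_mul]
        split_ifs
        · rw [ENNReal.ofReal_mul (abs_nonneg z)]
        · simp

lemma setLIntegral_recentJump_le (hd : 1 ≤ d) (hlam : IsLevyMeasure lam) {b : ℝ} (hb : 1 ≤ b) :
    ∫⁻ q in {q : Space d × ℝ | recentJump q ≤ ENNReal.ofReal b}, recentJump q ∂(volume.prod lam)
      ≤ volume (Metric.ball (0 : Space d) 1) *
        ((∫⁻ z, ENNReal.ofReal |z| ∂lam) * ENNReal.ofReal (1 + Real.log b)
          + ∫⁻ z in Icc (-1) 1, ENNReal.ofReal |z * Real.log z| ∂lam) := by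
  have := hlam.sigmaFinite
  have hset : MeasurableSet {q : Space d × ℝ | recentJump q ≤ ENNReal.ofReal b} :=
    measurableSet_le measurable_recentJump measurable_const
  have hspace (z : ℝ) : ∫⁻ y : Space d,
      {q | recentJump q ≤ ENNReal.ofReal b}.indicator recentJump (y, z)
      = volume (Metric.ball (0 : Space d) 1) * ∫⁻ v in Ioi (0 : ℝ),
        {v : ℝ | |z| * min v⁻¹ (v ^ 2)⁻¹ ≤ b}.indicator
          (fun v => ENNReal.ofReal (|z| * min v⁻¹ (v ^ 2)⁻¹)) v := by
    rw [← lintegral_norm_pow hd (Measurable.indicator (by fun_prop)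
      (measurableSet_le (by fun_prop) measurable_const))]
    simp only [indicator_apply, mem_ofPred_eq, recentJump,
      ENNReal.ofReal_le_ofReal_iff (zero_le_one.trans hb)]
  have : Measurable ((Icc (-1) 1).indicator fun z : ℝ => ENNReal.ofReal |z * Real.log z|) :=
    Measurable.indicator (by fun_prop) measurableSet_Icc
  rw [← lintegral_indicator hset,
    lintegral_prod_symm _ (measurable_recentJump.indicator hset).aemeasurable]
  simp_rw [hspace]
  rw [lintegral_const_mul' _ _ measure_ball_lt_top.ne, ← lintegral_indicator measurableSet_Icc,
    ← lintegral_mul_const _ (by fun_prop), ← lintegral_add_left (by fun_prop)]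
  gcongr 1
  refine lintegral_mono_ae ?_
  filter_upwards [hlam.ae_ne_zero] with z hz
  exact lintegral_indicator_mul_min_inv_le hz hb

/-- The jumps whose later contribution may exceed the power `β` of the time of their occurrence.
For suitable `β < 1` there are only finitely many of them. -/
def largeJumps (d : ℕ) (β : ℝ) : Set (ℝ × Space d × ℝ) :=
  {p | ENNReal.ofReal (max 1 p.1 ^ β) < pastJump p.2}

lemma measurableSet_largeJumps (β : ℝ) : MeasurableSet (largeJumps d β) :=
  measurableSet_lt (by fun_prop) (by fun_prop)

lemma prod_lt_pastJump_le (hd : 1 ≤ d) [SFinite lam] {b r : ℝ} (hb : 0 < b) (hr : 1 ≤ r) :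
    (volume.prod lam) {q : Space d × ℝ | ENNReal.ofReal b < pastJump q}
      ≤ ENNReal.ofReal (b ^ (-r)) *
        (volume (Metric.ball (0 : Space d) 1) * ∫⁻ z, ENNReal.ofReal (|z| ^ r) ∂lam) := by
  have hsub : {q : Space d × ℝ | ENNReal.ofReal b < pastJump q}
      ⊆ {q | ‖q.1‖ ^ d < b ^ (-r) * |q.2| ^ r} := by
    intro q hq
    have hlt : b < |q.2| * min 1 (‖q.1‖ ^ d)⁻¹ := (ENNReal.ofReal_lt_ofReal_iff'.1 hq).1
    rw [mul_min_of_nonneg _ _ (abs_nonneg _), mul_one, lt_min_iff] at hlt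
    calc ‖q.1‖ ^ d < |q.2| / b := lt_div_of_lt_mul_inv hb (by positivity) hlt.2
      _ ≤ (|q.2| / b) ^ r := Real.self_le_rpow_of_one_le ((one_le_div₀ hb).2 hlt.1.le) hr
      _ = b ^ (-r) * |q.2| ^ r := by
          rw [Real.div_rpow (abs_nonneg _) hb.le, Real.rpow_neg hb.le, div_eq_inv_mul]
  refine (measure_mono hsub).trans_eq ?_
  rw [prod_norm_pow_lt hd (by fun_prop : Measurable fun z : ℝ => b ^ (-r) * |z| ^ r)]
  simp_rw [ENNReal.ofReal_mul (Real.rpow_nonneg hb.le (-r))]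
  rw [lintegral_const_mul _ (by fun_prop), mul_left_comm]

lemma lintegral_Ioi_max_one_rpow_lt_top {γ : ℝ} (hγ : γ < -1) :
    ∫⁻ s in Ioi (0 : ℝ), ENNReal.ofReal (max 1 s ^ γ) < ⊤ := by
  rw [← Ioc_union_Ioi_eq_Ioi zero_le_one]
  refine (lintegral_union_le _ _ _).trans_lt (ENNReal.add_lt_top.2 ⟨?_, ?_⟩)
  · rw [setLIntegral_congr_fun (g := 1) measurableSet_Ioc fun s hs => by
      simp [max_eq_left hs.2]]
    simp
  · rw [setLIntegral_congr_fun (g := fun s => ENNReal.ofReal (s ^ γ)) measurableSet_Ioi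
      fun s hs => by simp only [max_eq_right (le_of_lt (mem_Ioi.1 hs))]]
    exact (integrableOn_Ioi_rpow_of_lt hγ one_pos).lintegral_lt_top

lemma jumpIntensity_largeJumps_lt_top (hd : 1 ≤ d) [SFinite lam] {r β : ℝ} (hr : 1 ≤ r)
    (hβ : 1 < β * r) (hmoment : Integrable (fun z : ℝ => |z| ^ r) lam) :
    jumpIntensity d lam (largeJumps d β) < ⊤ := by
  rw [jumpIntensity, Measure.prod_apply (measurableSet_largeJumps β)]
  have hfibre (s : ℝ) : (volume.prod lam) (Prod.mk s ⁻¹' largeJumps d β)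
      ≤ ENNReal.ofReal (max 1 s ^ (-(β * r))) *
        (volume (Metric.ball (0 : Space d) 1) * ∫⁻ z, ENNReal.ofReal (|z| ^ r) ∂lam) := by
    rw [← mul_neg, Real.rpow_mul (by positivity)]
    exact prod_lt_pastJump_le hd (by positivity) hr
  refine (lintegral_mono hfibre).trans_lt ?_
  rw [lintegral_mul_const _ (by fun_prop)]
  exact ENNReal.mul_lt_top (lintegral_Ioi_max_one_rpow_lt_top (neg_lt_neg hβ))
    (ENNReal.mul_lt_top measure_ball_lt_top hmoment.lintegral_lt_top)

end JumpPotentials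

section IntegralTest

variable {g : ℝ → ℝ≥0∞} {f : ℝ → ℝ}

lemma ofReal_sub_mul_le_setLIntegral_Ioc {a b : ℝ} (hg : AntitoneOn g (Ioc a b)) :
    ENNReal.ofReal (b - a) * g b ≤ ∫⁻ t in Ioc a b, g t :=
  calc ENNReal.ofReal (b - a) * g b = ∫⁻ _ in Ioc a b, g b := by
        rw [setLIntegral_const, Real.volume_Ioc, mul_comm]
    _ ≤ ∫⁻ t in Ioc a b, g t := setLIntegral_mono' measurableSet_Ioc fun _ ht =>
        hg ht ⟨ht.1.trans_le ht.2, le_rfl⟩ ht.2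

lemma setLIntegral_Ioc_le_ofReal_sub_mul {a b : ℝ} (hg : AntitoneOn g (Icc a b)) :
    ∫⁻ t in Ioc a b, g t ≤ ENNReal.ofReal (b - a) * g a :=
  calc ∫⁻ t in Ioc a b, g t ≤ ∫⁻ _ in Ioc a b, g a := setLIntegral_mono' measurableSet_Ioc
        fun _ ht => hg ⟨le_rfl, ht.1.le.trans ht.2⟩ (Ioc_subset_Icc_self ht) ht.1.le
    _ = ENNReal.ofReal (b - a) * g a := by rw [setLIntegral_const, Real.volume_Ioc, mul_comm]

lemma tendsto_setLIntegral_Ioi_atTop {a₀ : ℝ} (hint : ∫⁻ t in Ioi a₀, g t ≠ ⊤) :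
    Tendsto (fun a => ∫⁻ t in Ioi a, g t) atTop (𝓝 0) := by
  have hempty : ⋂ a : ℝ, Ioi a = ∅ :=
    eq_empty_of_forall_notMem fun x hx => lt_irrefl x (mem_iInter.1 hx x)
  have hdensity : ∀ a, volume.withDensity g (Ioi a) = ∫⁻ t in Ioi a, g t := fun a =>
    withDensity_apply _ measurableSet_Ioi
  have hlim := tendsto_measure_iInter_atTop (μ := volume.withDensity g) (s := fun a : ℝ => Ioi a)
    (fun a => measurableSet_Ioi.nullMeasurableSet) (fun a b hab => Ioi_subset_Ioi hab)
    ⟨a₀, by rwa [hdensity]⟩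
  simpa only [Function.comp_def, hempty, measure_empty, hdensity] using hlim

lemma tsum_lt_top_of_setLIntegral_lt_top (hg : AntitoneOn g (Ioi 0))
    (hint : ∫⁻ t in Ioi (1 : ℝ), g t < ⊤) : ∑' n : ℕ, g ((n + 2 : ℕ) : ℝ) < ⊤ := by
  have hdisj : Pairwise (Function.onFun Disjoint fun n : ℕ => Ioc (1 + (n : ℝ)) (1 + n + 1)) :=
    fun m n hmn => by
      simpa using! pairwise_disjoint_Ioc_add_intCast (1 : ℝ) (Nat.cast_injective.ne hmn)
  refine lt_of_le_of_lt ?_ hint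
  calc ∑' n : ℕ, g ((n + 2 : ℕ) : ℝ)
      ≤ ∑' n : ℕ, ∫⁻ t in Ioc (1 + (n : ℝ)) (1 + n + 1), g t := by
        refine ENNReal.tsum_le_tsum fun n => ?_
        have hle := ofReal_sub_mul_le_setLIntegral_Ioc (hg.mono fun t ht =>
          (by positivity : (0 : ℝ) < 1 + n).trans ht.1 : AntitoneOn g (Ioc (1 + n) (1 + n + 1)))
        rw [show ((n + 2 : ℕ) : ℝ) = 1 + n + 1 by push_cast; ring]
        rwa [add_sub_cancel_left, ENNReal.ofReal_one, one_mul] at hle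
    _ = ∫⁻ t in ⋃ n : ℕ, Ioc (1 + (n : ℝ)) (1 + n + 1), g t :=
        (lintegral_iUnion (fun n => measurableSet_Ioc) hdisj _).symm
    _ ≤ ∫⁻ t in Ioi (1 : ℝ), g t := lintegral_mono_set <| iUnion_subset fun n t ht =>
        (le_add_of_nonneg_right n.cast_nonneg).trans_lt ht.1

lemma setLIntegral_Ioi_eq_top (hg : AntitoneOn g (Ioi 0)) (hg1 : g 1 ≠ ⊤)
    (hint : ∫⁻ t in Ioi (1 : ℝ), g t = ⊤) (a : ℝ) : ∫⁻ t in Ioi a, g t = ⊤ := by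
  have hfin : ∫⁻ t in Ioc 1 (max 1 a), g t ≠ ⊤ :=
    ne_top_of_le_ne_top (ENNReal.mul_ne_top ENNReal.ofReal_ne_top hg1)
      (setLIntegral_Ioc_le_ofReal_sub_mul (hg.mono fun t ht => one_pos.trans_le ht.1))
  have hunion := lintegral_union_le (μ := volume) g (Ioc 1 (max 1 a)) (Ioi (max 1 a))
  rw [Ioc_union_Ioi_eq_Ioi (le_max_left 1 a), hint, top_le_iff, ENNReal.add_eq_top] at hunion
  exact eq_top_mono (lintegral_mono_set (Ioi_subset_Ioi (le_max_right 1 a)))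
    (hunion.resolve_left hfin)

lemma exists_nat_mem_Ioc_add_mul {a r t : ℝ} (hr : 0 < r) (hat : a < t) :
    ∃ k : ℕ, t ∈ Ioc (a + k * r) (a + (k + 1) * r) := by
  obtain ⟨k, hk⟩ := Nat.exists_eq_succ_of_ne_zero
    (Nat.ceil_pos.2 (div_pos (sub_pos.2 hat) hr)).ne'
  have hlow := (lt_div_iff₀ hr).1 (Nat.lt_ceil.1 (hk ▸ k.lt_succ_self : k < ⌈(t - a) / r⌉₊))
  have hup := (div_le_iff₀ hr).1 (Nat.ceil_le.1 hk.le)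
  push_cast at hup
  exact ⟨k, by linarith, by linarith⟩

lemma tsum_eq_top_of_setLIntegral_eq_top (hg : AntitoneOn g (Ioi 0)) (hg1 : g 1 ≠ ⊤)
    (hint : ∫⁻ t in Ioi (1 : ℝ), g t = ⊤) {b : ℝ} (hb : 0 < b) :
    ∑' n : ℕ, g (n + b) = ⊤ := by
  have hcover : Ioi b ⊆ ⋃ n : ℕ, Ioc ((n : ℝ) + b) (n + b + 1) := fun t ht => by
    obtain ⟨k, hlow, hup⟩ := exists_nat_mem_Ioc_add_mul one_pos (mem_Ioi.1 ht)
    exact mem_iUnion.2 ⟨k, by linarith, by linarith⟩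
  rw [← top_le_iff, ← setLIntegral_Ioi_eq_top hg hg1 hint b]
  calc ∫⁻ t in Ioi b, g t ≤ ∫⁻ t in ⋃ n : ℕ, Ioc ((n : ℝ) + b) (n + b + 1), g t :=
        lintegral_mono_set hcover
    _ ≤ ∑' n : ℕ, ∫⁻ t in Ioc ((n : ℝ) + b) (n + b + 1), g t := lintegral_iUnion_le _ _
    _ ≤ ∑' n : ℕ, g (n + b) := by
        refine ENNReal.tsum_le_tsum fun n => ?_
        have hle := setLIntegral_Ioc_le_ofReal_sub_mul (hg.mono fun t ht =>
          (by positivity : (0 : ℝ) < n + b).trans_le ht.1 :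
            AntitoneOn g (Icc (n + b) (n + b + 1)))
        rwa [add_sub_cancel_left, ENNReal.ofReal_one, one_mul] at hle

lemma antitoneOn_ofReal_one_div (hfpos : ∀ t, 0 < t → 0 < f t) (hfmono : MonotoneOn f (Ioi 0)) :
    AntitoneOn (fun t => ENNReal.ofReal (1 / f t)) (Ioi 0) := fun s hs _ ht hst =>
  ENNReal.ofReal_le_ofReal (one_div_le_one_div_of_le (hfpos s hs) (hfmono hs ht hst))

lemma tendsto_div_of_lintegral_lt_top (hfpos : ∀ t, 0 < t → 0 < f t)
    (hfmono : MonotoneOn f (Ioi 0))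
    (hint : (∫⁻ t in Ioi (1 : ℝ), ENNReal.ofReal (1 / f t)) < ⊤) :
    Tendsto (fun t => t / f t) atTop (𝓝 0) := by
  have hanti := antitoneOn_ofReal_one_div hfpos hfmono
  have htail :
      Tendsto (fun t => 2 * ∫⁻ u in Ioi (t / 2), ENNReal.ofReal (1 / f u)) atTop (𝓝 0) := by
    simpa using! ENNReal.Tendsto.const_mul (a := 2) ((tendsto_setLIntegral_Ioi_atTop hint.ne).comp
      (tendsto_id.atTop_div_const (two_pos : (0 : ℝ) < 2))) (Or.inr (by simp))
  have hbound : ∀ᶠ t in atTop,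
      ENNReal.ofReal (t / f t) ≤ 2 * ∫⁻ u in Ioi (t / 2), ENNReal.ofReal (1 / f u) := by
    filter_upwards [eventually_gt_atTop 0] with t ht
    calc ENNReal.ofReal (t / f t)
        = 2 * (ENNReal.ofReal (t - t / 2) * ENNReal.ofReal (1 / f t)) := by
          rw [sub_half, ← ENNReal.ofReal_mul (by positivity), ← ENNReal.ofReal_ofNat 2,
            ← ENNReal.ofReal_mul (by positivity)]
          congr 1
          field_simp
      _ ≤ 2 * ∫⁻ u in Ioc (t / 2) t, ENNReal.ofReal (1 / f u) := by
          gcongr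
          exact ofReal_sub_mul_le_setLIntegral_Ioc
            (hanti.mono fun u hu => (half_pos ht).trans hu.1)
      _ ≤ 2 * ∫⁻ u in Ioi (t / 2), ENNReal.ofReal (1 / f u) := by
          gcongr
          exact Ioc_subset_Ioi_self
  have hlim : Tendsto (fun t => ENNReal.ofReal (t / f t)) atTop (𝓝 0) :=
    tendsto_of_tendsto_of_tendsto_of_le_of_le' tendsto_const_nhds htail
      (Eventually.of_forall fun _ => zero_le) hbound
  have hreal := (ENNReal.tendsto_toReal ENNReal.zero_ne_top).comp hlim
  refine hreal.congr' ?_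
  filter_upwards [eventually_gt_atTop 0] with t ht
  exact ENNReal.toReal_ofReal (div_nonneg ht.le (hfpos t ht).le)

lemma lintegral_one_div_max_eq_top (hfpos : ∀ t, 0 < t → 0 < f t) (hfmono : MonotoneOn f (Ioi 0))
    (hint : (∫⁻ t in Ioi (1 : ℝ), ENNReal.ofReal (1 / f t)) = ⊤) :
    (∫⁻ t in Ioi (1 : ℝ), ENNReal.ofReal (1 / max (f t) t)) = ⊤ := by
  by_contra hcon
  have hmax : ∀ t, 0 < t → 0 < max (f t) t := fun t ht => lt_max_of_lt_right ht
  have hmono : MonotoneOn (fun t => max (f t) t) (Ioi 0) := fun s hs t ht hst =>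
    max_le_max (hfmono hs ht hst) hst
  have hlim := tendsto_div_of_lintegral_lt_top hmax hmono (lt_top_iff_ne_top.2 hcon)
  obtain ⟨T, hT⟩ := eventually_atTop.1 (hlim.eventually (gt_mem_nhds one_pos))
  have hf_eq : ∀ t ∈ Ioi (max 1 T), ENNReal.ofReal (1 / f t)
      = ENNReal.ofReal (1 / max (f t) t) := fun t ht => by
    have hlt := hT t ((le_max_right 1 T).trans (le_of_lt ht))
    rw [div_lt_one (hmax t (one_pos.trans_le ((le_max_left 1 T).trans (le_of_lt ht)))),
      lt_max_iff, or_iff_left (lt_irrefl t)] at hlt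
    rw [max_eq_left hlt.le]
  refine hcon (top_le_iff.1 ?_)
  calc ⊤ = ∫⁻ t in Ioi (max 1 T), ENNReal.ofReal (1 / f t) := (setLIntegral_Ioi_eq_top
        (antitoneOn_ofReal_one_div hfpos hfmono) ENNReal.ofReal_ne_top hint _).symm
    _ = ∫⁻ t in Ioi (max 1 T), ENNReal.ofReal (1 / max (f t) t) :=
        setLIntegral_congr_fun measurableSet_Ioi hf_eq
    _ ≤ ∫⁻ t in Ioi (1 : ℝ), ENNReal.ofReal (1 / max (f t) t) :=
        lintegral_mono_set (Ioi_subset_Ioi (le_max_left 1 T))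

end IntegralTest

section BorelCantelli

variable {Ω : Type*} [MeasurableSpace Ω] {P : Measure Ω}

lemma ae_eventually_notMem_of_eventually_le {s : ℕ → Set Ω} {a : ℕ → ℝ≥0∞} {k : ℕ}
    (hs : ∀ᶠ n in atTop, P (s n) ≤ a n) (ha : ∑' n, a (n + k) < ⊤) :
    ∀ᵐ ω ∂P, ∀ᶠ n in atTop, ω ∉ s n := by
  obtain ⟨M, hM⟩ := eventually_atTop.1 hs
  have hsum : ∑' n, P (s (n + (M + k))) ≠ ⊤ := by
    refine (lt_of_le_of_lt ?_ ha).ne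
    calc ∑' n, P (s (n + (M + k))) ≤ ∑' n, a (n + M + k) := ENNReal.tsum_le_tsum fun n => by
          rw [← add_assoc]
          exact hM _ (by omega)
      _ ≤ ∑' n, a (n + k) := ENNReal.tsum_comp_le_tsum_of_injective (add_left_injective M)
          fun n => a (n + k)
  filter_upwards [ae_eventually_notMem hsum] with ω hω
  exact (tendsto_add_atTop_iff_nat (f := fun n => n) 0).1 tendsto_id |>.eventually
    (map_add_atTop_eq_nat (M + k) ▸ eventually_map.2 hω)

lemma summable_exp_neg_mul_rpow {a c : ℝ} (ha : 0 < a) (hc : 0 < c) :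
    Summable fun n : ℕ => Real.exp (-c * (n : ℝ) ^ a) := by
  have hdecay : (fun x : ℝ => Real.exp (-c * x)) =o[atTop] fun x => x ^ (-(2 / a)) :=
    isLittleO_exp_neg_mul_rpow_atTop hc _
  have hgrowth : Tendsto (fun n : ℕ => (n : ℝ) ^ a) atTop atTop :=
    (tendsto_rpow_atTop ha).comp tendsto_natCast_atTop_atTop
  have hpow (n : ℕ) : ((n : ℝ) ^ a) ^ (-(2 / a)) = (n : ℝ) ^ (-2 : ℝ) := by
    rw [← Real.rpow_mul n.cast_nonneg]
    congr 1
    field_simp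
  refine summable_of_isBigO_nat (Real.summable_nat_rpow.2 (by norm_num : (-2 : ℝ) < -1)) ?_
  simpa only [Function.comp_def, hpow] using (hdecay.comp_tendsto hgrowth).isBigO

lemma tsum_ofReal_exp_lt_top {a c : ℝ} (ha : 0 < a) (hc : 0 < c) :
    ∑' n : ℕ, ENNReal.ofReal (Real.exp (-c * (n : ℝ) ^ a)) < ⊤ := by
  rw [← ENNReal.ofReal_tsum_of_nonneg (fun n => (Real.exp_pos _).le)
    (summable_exp_neg_mul_rpow ha hc)]
  exact ENNReal.ofReal_lt_top

end BorelCantelli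

section RecentAndPastSums

variable {d : ℕ}

/-- The contribution at time `n + 2` of the jumps of `M` up to time `n - 1`. For `t ∈ [n, n + 1]`,
their contribution at time `t` is at most a constant multiple of it. -/
noncomputable def pastSum (M : Measure (ℝ × Space d × ℝ)) (n : ℕ) : ℝ≥0∞ :=
  ∫⁻ p in Iic ((n : ℝ) - 1) ×ˢ univ, jumpHeat ((n : ℝ) + 2) p ∂M

/-- A bound, up to a constant factor and simultaneously for all `t ∈ [n, n + 1]`, for the
contribution at time `t` of the jumps of `M` after time `n - 1`. -/
noncomputable def recentSum (M : Measure (ℝ × Space d × ℝ)) (n : ℕ) : ℝ≥0∞ :=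
  ∫⁻ p in Ioc ((n : ℝ) - 1) (n + 1) ×ˢ univ, recentJump p.2 ∂M

lemma heatKernel_le_rpow_mul_heatKernel {s t a : ℝ} (hs : 0 < s) (hst : s ≤ t) (hta : t ≤ a * s)
    (x : Space d) : heatKernel d s x ≤ a ^ ((d : ℝ) / 2) * heatKernel d t x := by
  have ha : 0 ≤ a := nonneg_of_mul_nonneg_left (hs.le.trans (hst.trans hta)) hs
  refine le_of_mul_le_mul_left ?_ (Real.rpow_pos_of_pos hs ((d : ℝ) / 2))
  calc s ^ ((d : ℝ) / 2) * heatKernel d s x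
      ≤ t ^ ((d : ℝ) / 2) * heatKernel d t x :=
        monotoneOn_rpow_mul_heatKernel x hs (hs.trans_le hst) hst
    _ ≤ (a * s) ^ ((d : ℝ) / 2) * heatKernel d t x := by
        have : 0 < t := hs.trans_le hst
        have := heatKernel_nonneg t x
        gcongr
    _ = s ^ ((d : ℝ) / 2) * (a ^ ((d : ℝ) / 2) * heatKernel d t x) := by
        rw [Real.mul_rpow ha hs.le]
        ring

lemma jumpHeat_le_rpow_mul_jumpHeat {s t a : ℝ} {p : ℝ × Space d × ℝ} (hs : p.1 < s)
    (hst : s ≤ t) (hta : t - p.1 ≤ a * (s - p.1)) :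
    jumpHeat s p ≤ ENNReal.ofReal (a ^ ((d : ℝ) / 2)) * jumpHeat t p := by
  have hs' : 0 < s - p.1 := sub_pos.2 hs
  have ha : 0 ≤ a := nonneg_of_mul_nonneg_left (by linarith) hs'
  rw [jumpHeat, jumpHeat, ← ENNReal.ofReal_mul (by positivity), ← mul_assoc]
  gcongr
  exact heatKernel_le_rpow_mul_heatKernel hs' (by linarith) hta _

lemma lintegral_jumpHeat_le_pastSum_add_recentSum {M : Measure (ℝ × Space d × ℝ)}
    (hM : ∀ᵐ p ∂M, p.2.1 ≠ 0) {n : ℕ} {t : ℝ} (hnt : n ≤ t) (htn : t ≤ n + 1) :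
    ∫⁻ p, jumpHeat t p ∂M ≤ ENNReal.ofReal (3 ^ ((d : ℝ) / 2)) * pastSum M n
      + ENNReal.ofReal (heatBound d) * recentSum M n := by
  set past : Set (ℝ × Space d × ℝ) := Iic ((n : ℝ) - 1) ×ˢ univ
  set recent : Set (ℝ × Space d × ℝ) := Ioc ((n : ℝ) - 1) (n + 1) ×ˢ univ
  have hpast : MeasurableSet past := measurableSet_Iic.prod .univ
  have hrecent : MeasurableSet recent := measurableSet_Ioc.prod .univ
  have hzero : ∫⁻ p in (past ∪ recent)ᶜ, jumpHeat t p ∂M = 0 :=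
    setLIntegral_eq_zero (hpast.union hrecent).compl fun p hp => jumpHeat_eq_zero <| by
      by_contra! hlt
      rcases le_or_gt p.1 (n - 1) with hle | hgt
      · exact hp (Or.inl ⟨hle, mem_univ _⟩)
      · exact hp (Or.inr ⟨⟨hgt, by linarith⟩, mem_univ _⟩)
  rw [← lintegral_add_compl _ (hpast.union hrecent), hzero, add_zero, pastSum, recentSum,
    ← lintegral_const_mul _ (measurable_jumpHeat _), ← lintegral_const_mul _ (by fun_prop)]
  refine (lintegral_union_le _ _ _).trans (add_le_add ?_ ?_)
  · refine setLIntegral_mono' hpast fun p hp => ?_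
    have hp1 : p.1 ≤ n - 1 := hp.1
    exact jumpHeat_le_rpow_mul_jumpHeat (by linarith) (by linarith) (by linarith)
  · refine lintegral_mono_ae ((ae_restrict_iff' hrecent).2 ?_)
    filter_upwards [hM] with p hp0 hp
    exact jumpHeat_le_recentJump hp0 (by linarith [hp.1.1])

lemma recentSum_le_add (M : Measure (ℝ × Space d × ℝ)) (n : ℕ) (b : ℝ≥0∞) :
    recentSum M n
      ≤ ∫⁻ p in Ioc ((n : ℝ) - 1) (n + 1) ×ˢ {q | b < recentJump q}, recentJump p.2 ∂M
        + ∫⁻ p in Ioc ((n : ℝ) - 1) (n + 1) ×ˢ {q | recentJump q ≤ b}, recentJump p.2 ∂M := by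
  have hcover : {q : Space d × ℝ | b < recentJump q} ∪ {q | recentJump q ≤ b} = univ :=
    eq_univ_of_forall fun q => lt_or_ge b (recentJump q)
  rw [recentSum, ← hcover, prod_union]
  exact lintegral_union_le _ _ _

end RecentAndPastSums

section UpperBounds

variable {Ω : Type*} [MeasurableSpace Ω] {P : Measure Ω} {d : ℕ} {lam : Measure ℝ}
  {N : Ω → Measure (ℝ × Space d × ℝ)}

lemma exists_jumpIntensity_recentJump_le (hd : 1 ≤ d) (hlam : IsLevyMeasure lam)
    (hκ : ∫⁻ z, ENNReal.ofReal |z| ∂lam < ⊤)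
    (hlog : IntegrableOn (fun z : ℝ => |z * Real.log z|) (Icc (-1) 1) lam) :
    ∃ c : ℝ, 0 ≤ c ∧ ∀ (n : ℕ) (b : ℝ), 1 ≤ b →
      jumpIntensity d lam (Ioc ((n : ℝ) - 1) (n + 1) ×ˢ {q | ENNReal.ofReal b < recentJump q})
        ≤ ENNReal.ofReal (c / b) ∧
      ∫⁻ p in Ioc ((n : ℝ) - 1) (n + 1) ×ˢ {q | recentJump q ≤ ENNReal.ofReal b},
        recentJump p.2 ∂(jumpIntensity d lam) ≤ ENNReal.ofReal (c * (1 + Real.log b)) := by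
  have := hlam.sigmaFinite
  set κ := ∫⁻ z, ENNReal.ofReal |z| ∂lam
  set L := ∫⁻ z in Icc (-1) 1, ENNReal.ofReal |z * Real.log z| ∂lam
  set w := volume (Metric.ball (0 : Space d) 1)
  have hc : 2 * (w * (κ + L)) ≠ ⊤ := by
    have hL : L ≠ ⊤ := hlog.lintegral_lt_top.ne
    have hw : w ≠ ⊤ := measure_ball_lt_top.ne
    finiteness
  have hvol (n : ℕ) : volume (Ioc ((n : ℝ) - 1) (n + 1) ∩ Ioi 0) ≤ 2 := by
    refine (measure_mono inter_subset_left).trans_eq ?_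
    rw [Real.volume_Ioc, add_sub_sub_cancel, one_add_one_eq_two, ENNReal.ofReal_ofNat]
  refine ⟨(2 * (w * (κ + L))).toReal, ENNReal.toReal_nonneg, fun n b hb => ⟨?_, ?_⟩⟩
  · have hb0 : 0 < b := one_pos.trans_le hb
    rw [jumpIntensity_prod measurableSet_Ioc, ENNReal.ofReal_div_of_pos hb0,
      ENNReal.ofReal_toReal hc]
    refine (mul_le_mul' (hvol n) (prod_lt_recentJump_le hd hb0)).trans ?_
    rw [← mul_div_assoc, ← mul_div_assoc]
    gcongr
    exact le_self_add
  · have hlog0 : 0 ≤ Real.log b := Real.log_nonneg hb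
    rw [setLIntegral_jumpIntensity_prod measurableSet_Ioc _ measurable_recentJump,
      ENNReal.ofReal_mul ENNReal.toReal_nonneg, ENNReal.ofReal_toReal hc, mul_assoc, mul_assoc,
      add_mul]
    refine (mul_le_mul' (hvol n) (setLIntegral_recentJump_le hd hlam hb)).trans ?_
    gcongr
    exact le_mul_of_one_le_right zero_le (ENNReal.one_le_ofReal.2 (by linarith))

lemma chernoff_exponent_le {b c : ℝ} (hb : 1 ≤ b) (hc : 0 ≤ c) :
    -(Real.log b / 4 / b) * (8 * b)
        + Real.log b / 4 / b * Real.exp (Real.log b / 4 / b * b) * (c * (1 + Real.log b))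
      ≤ -Real.log b + 5 * c := by
  have hb0 : 0 < b := one_pos.trans_le hb
  set l := Real.log b
  set q := b ^ (1 / 4 : ℝ) with hq
  have hl : 0 ≤ l := Real.log_nonneg hb
  have hq1 : 1 ≤ q := Real.one_le_rpow hb (by norm_num)
  have hq4 : q ^ 4 = b := by
    rw [← Real.rpow_natCast, ← Real.rpow_mul hb0.le]
    norm_num
  have hlq : l ≤ 4 * q := by
    linarith [Real.log_le_rpow_div hb0.le (by norm_num : (0 : ℝ) < 1 / 4)]
  have hexp : Real.exp (l / 4 / b * b) = q := by
    rw [div_mul_cancel₀ _ hb0.ne', hq, Real.rpow_def_of_pos hb0, mul_one_div]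
  have hlinear : -(l / 4 / b) * (8 * b) = -2 * l := by
    field_simp
    ring
  have hfrac : l * (1 + l) / (4 * q ^ 3) ≤ 5 := by
    rw [div_le_iff₀ (by positivity)]
    calc l * (1 + l) ≤ 4 * q * (1 + 4 * q) := by gcongr
      _ ≤ 5 * (4 * q ^ 3) := by nlinarith [mul_nonneg (sub_nonneg.2 hq1) (sub_nonneg.2 hq1)]
  have hquad : l / 4 / b * q * (c * (1 + l)) ≤ 5 * c :=
    calc l / 4 / b * q * (c * (1 + l)) = l * (1 + l) / (4 * q ^ 3) * c := by
          rw [← hq4]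
          field_simp
      _ ≤ 5 * c := by gcongr
  rw [hexp, hlinear]
  linarith

variable [IsProbabilityMeasure P]

lemma IsPoissonRandomMeasure.ae_ae_space_ne_zero [SFinite lam]
    (hN : IsPoissonRandomMeasure P N (jumpIntensity d lam)) (hd : 1 ≤ d) :
    ∀ᵐ ω ∂P, ∀ᵐ p ∂(N ω), p.2.1 ≠ 0 := by
  have hmeas : MeasurableSet {p : ℝ × Space d × ℝ | p.2.1 = 0} :=
    measurable_snd.fst (measurableSet_singleton (0 : Space d))
  filter_upwards [hN.ae_eq_zero hmeas (jumpIntensity_space_eq_zero hd)] with ω hω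
  exact measure_eq_zero_iff_ae_notMem.1 hω

lemma ae_pastSum_lt_top (hN : IsPoissonRandomMeasure P N (jumpIntensity d lam)) [SFinite lam]
    (hκ : ∫⁻ z, ENNReal.ofReal |z| ∂lam < ⊤) : ∀ᵐ ω ∂P, ∀ n, pastSum (N ω) n < ⊤ := by
  refine ae_all_iff.2 fun n => ?_
  have hint : ∫⁻ p, jumpHeat ((n : ℝ) + 2) p ∂(jumpIntensity d lam) ≠ ⊤ := by
    rw [lintegral_jumpHeat]
    finiteness
  filter_upwards [hN.ae_lintegral_lt_top (measurable_jumpHeat _) hint] with ω hω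
  exact (setLIntegral_le_lintegral _ _).trans_lt hω

lemma ae_recentSum_lt_top (hN : IsPoissonRandomMeasure P N (jumpIntensity d lam)) (hd : 1 ≤ d)
    (hlam : IsLevyMeasure lam) (hκ : ∫⁻ z, ENNReal.ofReal |z| ∂lam < ⊤)
    (hlog : IntegrableOn (fun z : ℝ => |z * Real.log z|) (Icc (-1) 1) lam) :
    ∀ᵐ ω ∂P, ∀ n, recentSum (N ω) n < ⊤ := by
  obtain ⟨c, -, hc⟩ := exists_jumpIntensity_recentJump_le hd hlam hκ hlog
  refine ae_all_iff.2 fun n => ?_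
  have hlarge := hN.ae_setLIntegral_lt_top (h := fun p => recentJump p.2)
    (measurableSet_Ioc.prod (measurableSet_lt measurable_const measurable_recentJump))
    ((hc n 1 le_rfl).1.trans_lt ENNReal.ofReal_lt_top).ne (by fun_prop)
    fun _ => ENNReal.ofReal_ne_top
  have hsmallSet : MeasurableSet (Ioc ((n : ℝ) - 1) (n + 1) ×ˢ
      {q : Space d × ℝ | recentJump q ≤ ENNReal.ofReal 1}) :=
    measurableSet_Ioc.prod (measurableSet_le measurable_recentJump measurable_const)
  have hsmall := hN.ae_lintegral_lt_top
    (Measurable.indicator (f := fun p => recentJump p.2) (by fun_prop) hsmallSet)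
    (by
      rw [lintegral_indicator hsmallSet]
      exact ((hc n 1 le_rfl).2.trans_lt ENNReal.ofReal_lt_top).ne)
  filter_upwards [hlarge, hsmall] with ω hωlarge hωsmall
  rw [lintegral_indicator hsmallSet] at hωsmall
  exact (recentSum_le_add _ n _).trans_lt (ENNReal.add_lt_top.2 ⟨hωlarge, hωsmall⟩)

/-- A jump exceeding `b` occurs with probability `O(1 / b)`; the remaining jumps are controlled by
Chernoff's bound with parameter `log b / (4 b)`. -/
lemma exists_measure_lt_recentSum_le (hN : IsPoissonRandomMeasure P N (jumpIntensity d lam))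
    (hd : 1 ≤ d) (hlam : IsLevyMeasure lam) (hκ : ∫⁻ z, ENNReal.ofReal |z| ∂lam < ⊤)
    (hlog : IntegrableOn (fun z : ℝ => |z * Real.log z|) (Icc (-1) 1) lam) :
    ∃ C : ℝ, 0 ≤ C ∧ ∀ (n : ℕ) (b : ℝ), 1 ≤ b →
      P {ω | ENNReal.ofReal (8 * b) < recentSum (N ω) n} ≤ ENNReal.ofReal (C / b) := by
  obtain ⟨c, hc0, hc⟩ := exists_jumpIntensity_recentJump_le hd hlam hκ hlog
  refine ⟨c + Real.exp (5 * c), by positivity, fun n b hb => ?_⟩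
  have hb0 : 0 < b := one_pos.trans_le hb
  have hl0 : 0 ≤ Real.log b := Real.log_nonneg hb
  set large := Ioc ((n : ℝ) - 1) (n + 1) ×ˢ {q : Space d × ℝ | ENNReal.ofReal b < recentJump q}
  set small := Ioc ((n : ℝ) - 1) (n + 1) ×ˢ {q : Space d × ℝ | recentJump q ≤ ENNReal.ofReal b}
  have hlarge : P {ω | N ω large ≠ 0} ≤ ENNReal.ofReal (c / b) :=
    (hN.measure_apply_ne_zero_le (measurableSet_Ioc.prod
      (measurableSet_lt measurable_const measurable_recentJump))).trans (hc n b hb).1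
  have hsmall : P {ω | ENNReal.ofReal (8 * b) < ∫⁻ p in small, recentJump p.2 ∂(N ω)}
      ≤ ENNReal.ofReal (Real.exp (5 * c) / b) := by
    refine (hN.measure_lt_setLIntegral_le (θ := Real.log b / 4 / b)
      (measurableSet_Ioc.prod (measurableSet_le measurable_recentJump measurable_const))
      (by fun_prop) hb0.le (fun p hp => hp.2) (by positivity) (hc n b hb).2
      (by positivity)).trans (ENNReal.ofReal_le_ofReal ?_)
    refine (Real.exp_le_exp.2 (chernoff_exponent_le hb hc0)).trans_eq ?_
    rw [Real.exp_add, Real.exp_neg, Real.exp_log hb0, mul_comm, div_eq_mul_inv]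
  calc P {ω | ENNReal.ofReal (8 * b) < recentSum (N ω) n}
      ≤ P ({ω | N ω large ≠ 0}
          ∪ {ω | ENNReal.ofReal (8 * b) < ∫⁻ p in small, recentJump p.2 ∂(N ω)}) := by
        refine measure_mono fun ω hω => ?_
        by_cases hω0 : N ω large = 0
        · have hle := recentSum_le_add (N ω) n (ENNReal.ofReal b)
          rw [setLIntegral_measure_zero _ _ hω0, zero_add] at hle
          exact Or.inr (lt_of_lt_of_le hω hle)
        · exact Or.inl hω0
    _ ≤ ENNReal.ofReal (c / b) + ENNReal.ofReal (Real.exp (5 * c) / b) :=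
        (measure_union_le _ _).trans (add_le_add hlarge hsmall)
    _ = ENNReal.ofReal ((c + Real.exp (5 * c)) / b) := by
        rw [← ENNReal.ofReal_add (by positivity) (by positivity), ← add_div]

lemma ae_eventually_recentSum_le (hN : IsPoissonRandomMeasure P N (jumpIntensity d lam))
    (hd : 1 ≤ d) (hlam : IsLevyMeasure lam) (hκ : ∫⁻ z, ENNReal.ofReal |z| ∂lam < ⊤)
    (hlog : IntegrableOn (fun z : ℝ => |z * Real.log z|) (Icc (-1) 1) lam) {f : ℝ → ℝ}
    (hfpos : ∀ t, 0 < t → 0 < f t) (hfmono : MonotoneOn f (Ioi 0))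
    (hint : (∫⁻ t in Ioi (1 : ℝ), ENNReal.ofReal (1 / f t)) < ⊤) {η : ℝ} (hη : 0 < η) :
    ∀ᵐ ω ∂P, ∀ᶠ n : ℕ in atTop, recentSum (N ω) n ≤ ENNReal.ofReal (η * f n) := by
  obtain ⟨C, hC0, hC⟩ := exists_measure_lt_recentSum_le hN hd hlam hκ hlog
  have hgrowth : ∀ᶠ n : ℕ in atTop, 1 ≤ η / 8 * f n := by
    have hlim := (tendsto_div_of_lintegral_lt_top hfpos hfmono hint).comp
      tendsto_natCast_atTop_atTop
    filter_upwards [hlim.eventually (gt_mem_nhds (by positivity : 0 < η / 8)),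
      eventually_ge_atTop 1] with n hn hn1
    have hn1' : (1 : ℝ) ≤ n := Nat.one_le_cast.2 hn1
    rw [Function.comp_apply, div_lt_iff₀ (hfpos n (by linarith))] at hn
    exact hn1'.trans hn.le
  have htail : ∀ᶠ n : ℕ in atTop, P {ω | ENNReal.ofReal (η * f n) < recentSum (N ω) n}
      ≤ ENNReal.ofReal (C / (η / 8)) * ENNReal.ofReal (1 / f n) := by
    filter_upwards [hgrowth] with n hn
    have hbound := hC n (η / 8 * f n) hn
    rwa [show 8 * (η / 8 * f n) = η * f n by ring, ← div_div, div_eq_mul_one_div (C / (η / 8)),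
      ENNReal.ofReal_mul (p := C / (η / 8)) (by positivity)] at hbound
  have hsum : ∑' n : ℕ, ENNReal.ofReal (C / (η / 8)) * ENNReal.ofReal (1 / f ((n + 2 : ℕ) : ℝ))
      < ⊤ := by
    rw [ENNReal.tsum_mul_left]
    exact ENNReal.mul_lt_top ENNReal.ofReal_lt_top
      (tsum_lt_top_of_setLIntegral_lt_top (antitoneOn_ofReal_one_div hfpos hfmono) hint)
  filter_upwards [ae_eventually_notMem_of_eventually_le htail hsum] with ω hω
  exact hω.mono fun n hn => not_lt.1 hn

/-- The jumps up to time `n - 1` that are not in `largeJumps d β`. The null set `y = 0`, on which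
`pastJump` does not dominate `jumpHeat` because `0⁻¹ = 0`, is removed. -/
def moderatePastJumps (d : ℕ) (β : ℝ) (n : ℕ) : Set (ℝ × Space d × ℝ) :=
  {p | p.1 ≤ (n : ℝ) - 1 ∧ p ∉ largeJumps d β ∧ p.2.1 ≠ 0}

lemma measurableSet_moderatePastJumps (β : ℝ) (n : ℕ) :
    MeasurableSet (moderatePastJumps d β n) :=
  (measurableSet_le measurable_fst measurable_const).inter <|
    (measurableSet_largeJumps β).compl.inter
      (measurable_snd.fst (measurableSet_singleton (0 : Space d)).compl)

lemma jumpHeat_le_of_mem_moderatePastJumps {β : ℝ} (hβ : 0 ≤ β) {n : ℕ} (hn : 1 ≤ n)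
    {p : ℝ × Space d × ℝ} (hp : p ∈ moderatePastJumps d β n) :
    jumpHeat ((n : ℝ) + 2) p ≤ ENNReal.ofReal (heatBound d * (n : ℝ) ^ β) := by
  obtain ⟨hpast, hsmall, hp0⟩ := hp
  rw [ENNReal.ofReal_mul (zero_le_one.trans one_le_heatBound)]
  refine (jumpHeat_le_pastJump hp0 (by linarith)).trans ?_
  gcongr
  refine (not_lt.1 hsmall).trans (ENNReal.ofReal_le_ofReal ?_)
  gcongr
  exact max_le (Nat.one_le_cast.2 hn) (by linarith)

lemma measure_lt_setLIntegral_moderatePastJumps_le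
    (hN : IsPoissonRandomMeasure P N (jumpIntensity d lam)) [SFinite lam]
    (hκ : ∫⁻ z, ENNReal.ofReal |z| ∂lam < ⊤) {β : ℝ} (hβ : 0 ≤ β) {n : ℕ} (hn : 1 ≤ n) :
    P {ω | ENNReal.ofReal
        ((3 * Real.exp 1 * (∫⁻ z, ENNReal.ofReal |z| ∂lam).toReal + heatBound d) * n)
        < ∫⁻ p in moderatePastJumps d β n, jumpHeat ((n : ℝ) + 2) p ∂(N ω)}
      ≤ ENNReal.ofReal (Real.exp (-1 * (n : ℝ) ^ (1 - β))) := by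
  set κ := (∫⁻ z, ENNReal.ofReal |z| ∂lam).toReal
  have hC : 0 < heatBound d := one_pos.trans_le one_le_heatBound
  have hn1 : (1 : ℝ) ≤ n := Nat.one_le_cast.2 hn
  have : 0 ≤ κ := ENNReal.toReal_nonneg
  have hmean : ∫⁻ p in moderatePastJumps d β n, jumpHeat ((n : ℝ) + 2) p ∂(jumpIntensity d lam)
      ≤ ENNReal.ofReal (3 * n * κ) :=
    calc _ ≤ ENNReal.ofReal ((n + 2) * κ) := by
          rw [ENNReal.ofReal_mul (by positivity), ENNReal.ofReal_toReal hκ.ne,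
            ← lintegral_jumpHeat (d := d)]
          exact setLIntegral_le_lintegral _ _
      _ ≤ ENNReal.ofReal (3 * n * κ) := by
          gcongr
          linarith
  have hb : 0 < heatBound d * (n : ℝ) ^ β := by positivity
  refine (hN.measure_lt_setLIntegral_le (θ := (heatBound d * (n : ℝ) ^ β)⁻¹)
    (measurableSet_moderatePastJumps β n) (measurable_jumpHeat _) hb.le
    (fun p hp => jumpHeat_le_of_mem_moderatePastJumps hβ hn hp) (by positivity) hmean
    (by positivity)).trans_eq ?_
  rw [inv_mul_cancel₀ hb.ne', Real.rpow_sub (by positivity), Real.rpow_one]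
  congr 2
  field_simp
  ring

lemma pastSum_le_moderate_add_large {M : Measure (ℝ × Space d × ℝ)} (hM : ∀ᵐ p ∂M, p.2.1 ≠ 0)
    (β : ℝ) (n : ℕ) :
    pastSum M n ≤ ∫⁻ p in moderatePastJumps d β n, jumpHeat ((n : ℝ) + 2) p ∂M
      + ENNReal.ofReal (heatBound d) * ∫⁻ p in largeJumps d β, pastJump p.2 ∂M := by
  have hmoderate := measurableSet_moderatePastJumps (d := d) β n
  have hlarge := measurableSet_largeJumps (d := d) β
  rw [pastSum, ← lintegral_const_mul _ (by fun_prop),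
    ← lintegral_indicator (measurableSet_Iic.prod .univ), ← lintegral_indicator hmoderate,
    ← lintegral_indicator hlarge,
    ← lintegral_add_left ((measurable_jumpHeat _).indicator hmoderate)]
  refine lintegral_mono_ae ?_
  filter_upwards [hM] with p hp0
  refine indicator_apply_le' (fun hp => ?_) fun _ => zero_le
  have hpast : p.1 ≤ n - 1 := hp.1
  by_cases hplarge : p ∈ largeJumps d β
  · rw [indicator_of_mem hplarge]
    exact le_add_left (jumpHeat_le_pastJump hp0 (by linarith))
  · rw [indicator_of_mem (show p ∈ moderatePastJumps d β n from ⟨hpast, hplarge, hp0⟩)]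
    exact le_add_right le_rfl

lemma ae_eventually_pastSum_le (hN : IsPoissonRandomMeasure P N (jumpIntensity d lam))
    (hd : 1 ≤ d) [SFinite lam]
    (hmoment : ∃ ε : ℝ, 0 < ε ∧ Integrable (fun z : ℝ => |z| ^ (1 + ε)) lam)
    (hκ : ∫⁻ z, ENNReal.ofReal |z| ∂lam < ⊤) :
    ∀ᵐ ω ∂P, ∃ K : ℝ, 0 ≤ K ∧ ∀ᶠ n : ℕ in atTop, pastSum (N ω) n ≤ ENNReal.ofReal (K * n) := by
  obtain ⟨ε, hε, hmoment⟩ := hmoment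
  obtain ⟨β, hβ, hβ1⟩ : ∃ β, 1 / (1 + ε) < β ∧ β < 1 :=
    exists_between ((div_lt_one (by positivity)).2 (by linarith))
  have hβ0 : 0 < β := lt_trans (by positivity) hβ
  rw [div_lt_iff₀ (by positivity)] at hβ
  have hsum : ∑' n : ℕ, ENNReal.ofReal (Real.exp (-1 * ((n + 0 : ℕ) : ℝ) ^ (1 - β))) < ⊤ :=
    tsum_ofReal_exp_lt_top (sub_pos.2 hβ1) one_pos
  have hmoderate := ae_eventually_notMem_of_eventually_le
    ((eventually_ge_atTop 1).mono fun n hn =>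
      measure_lt_setLIntegral_moderatePastJumps_le hN hκ hβ0.le hn) hsum
  have hlarge := hN.ae_setLIntegral_lt_top (measurableSet_largeJumps β)
    (jumpIntensity_largeJumps_lt_top hd (by linarith) hβ hmoment).ne
    (h := fun p => pastJump p.2) (by fun_prop) fun _ => ENNReal.ofReal_ne_top
  filter_upwards [hmoderate, hlarge, hN.ae_ae_space_ne_zero hd] with ω hωmoderate hωlarge hω0
  set K₀ := 3 * Real.exp 1 * (∫⁻ z, ENNReal.ofReal |z| ∂lam).toReal + heatBound d
  have hC : 0 < heatBound d := one_pos.trans_le one_le_heatBound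
  have : 0 ≤ K₀ := by positivity
  set L := (∫⁻ p in largeJumps d β, pastJump p.2 ∂(N ω)).toReal
  have : 0 ≤ L := ENNReal.toReal_nonneg
  refine ⟨K₀ + heatBound d * L, by positivity, ?_⟩
  filter_upwards [hωmoderate, eventually_ge_atTop 1] with n hn hn1
  calc pastSum (N ω) n
      ≤ ENNReal.ofReal (K₀ * n) + ENNReal.ofReal (heatBound d) * ENNReal.ofReal L := by
        rw [ENNReal.ofReal_toReal hωlarge.ne]
        exact (pastSum_le_moderate_add_large hω0 β n).trans (by gcongr; exact not_lt.1 hn)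
    _ = ENNReal.ofReal (K₀ * n + heatBound d * L) := by
        rw [← ENNReal.ofReal_mul hC.le, ← ENNReal.ofReal_add (by positivity) (by positivity)]
    _ ≤ ENNReal.ofReal ((K₀ + heatBound d * L) * n) := by
        have hle : heatBound d * L ≤ heatBound d * L * n :=
          le_mul_of_one_le_right (by positivity) (Nat.one_le_cast.2 hn1)
        exact ENNReal.ofReal_le_ofReal (by linarith)

end UpperBounds

section Solution

variable {d : ℕ} {lam : Measure ℝ}

lemma measurable_mildKernel (t : ℝ) (x : Space d) : Measurable (mildKernel t x) :=
  measurable_heatKernel.comp (f := fun q : ℝ × Space d => (t - q.1, x - q.2)) (by fun_prop)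

lemma mildKernel_nonneg (t : ℝ) (x : Space d) (q : ℝ × Space d) : 0 ≤ mildKernel t x q :=
  heatKernel_nonneg _ _

lemma lintegral_mildKernel (t : ℝ) (x : Space d) :
    ∫⁻ q, ENNReal.ofReal (mildKernel t x q) ∂(spaceTimeVolume d) = ENNReal.ofReal t := by
  have hspace (s : ℝ) : ∫⁻ y : Space d, ENNReal.ofReal (mildKernel t x (s, y))
      = (Iio t).indicator 1 s := by
    simp only [mildKernel]
    rw [lintegral_sub_left_eq_self (fun y => ENNReal.ofReal (heatKernel d (t - s) y)) x,
      lintegral_heatKernel_eq_indicator]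
    simp [indicator_apply]
  rw [spaceTimeVolume, lintegral_prod _ (measurable_mildKernel t x).ennreal_ofReal.aemeasurable]
  simp_rw [hspace]
  rw [lintegral_indicator_one measurableSet_Iio, Measure.restrict_apply measurableSet_Iio,
    Iio_inter_Ioi, Real.volume_Ioo, sub_zero]

lemma integrable_mildKernel (t : ℝ) (x : Space d) :
    Integrable (mildKernel t x) (spaceTimeVolume d) := by
  refine ⟨(measurable_mildKernel t x).aestronglyMeasurable, ?_⟩
  rw [hasFiniteIntegral_iff_ofReal (ae_of_all _ (mildKernel_nonneg t x)), lintegral_mildKernel]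
  exact ENNReal.ofReal_lt_top

lemma integral_mildKernel {t : ℝ} (ht : 0 ≤ t) (x : Space d) :
    ∫ q, mildKernel t x q ∂(spaceTimeVolume d) = t := by
  rw [integral_eq_lintegral_of_nonneg_ae (ae_of_all _ (mildKernel_nonneg t x))
    (measurable_mildKernel t x).aestronglyMeasurable, lintegral_mildKernel,
    ENNReal.toReal_ofReal ht]

lemma measurable_mildKernel_mul (t : ℝ) (x : Space d) :
    Measurable fun p : ℝ × Space d × ℝ => mildKernel t x (p.1, p.2.1) * p.2.2 :=
  ((measurable_mildKernel t x).comp (f := fun p : ℝ × Space d × ℝ => (p.1, p.2.1))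
    (by fun_prop)).mul (by fun_prop)

lemma jumpHeat_eq_ofReal_abs (t : ℝ) (p : ℝ × Space d × ℝ) :
    jumpHeat t p = ENNReal.ofReal |mildKernel t 0 (p.1, p.2.1) * p.2.2| := by
  rw [jumpHeat, abs_mul, abs_of_nonneg (mildKernel_nonneg t 0 _), mildKernel_zero]

lemma integrable_mildKernel_mul {t : ℝ} {M : Measure (ℝ × Space d × ℝ)}
    (hM : ∫⁻ p, jumpHeat t p ∂M < ⊤) :
    Integrable (fun p => mildKernel t 0 (p.1, p.2.1) * p.2.2) M := by
  refine ⟨(measurable_mildKernel_mul t 0).aestronglyMeasurable, ?_⟩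
  rw [hasFiniteIntegral_iff_norm]
  simpa only [Real.norm_eq_abs, ← jumpHeat_eq_ofReal_abs] using hM

lemma mildSolution_eq {t : ℝ} (ht : 0 ≤ t) (m : ℝ) (M : Measure (ℝ × Space d × ℝ)) (x : Space d) :
    mildSolution m lam M t x
      = noiseDrift m lam * t + ∫ p, mildKernel t x (p.1, p.2.1) * p.2.2 ∂M := by
  rw [mildSolution, noiseIntegral, integral_mildKernel ht]

lemma abs_mildSolution_le {t : ℝ} (ht : 0 ≤ t) (m : ℝ) (M : Measure (ℝ × Space d × ℝ)) :
    |mildSolution m lam M t 0| ≤ |noiseDrift m lam| * t + (∫⁻ p, jumpHeat t p ∂M).toReal := by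
  rw [mildSolution_eq ht]
  refine (abs_add_le _ _).trans ?_
  rw [abs_mul, abs_of_nonneg ht]
  gcongr
  rw [← Real.norm_eq_abs]
  refine (norm_integral_le_lintegral_norm _).trans (le_of_eq ?_)
  simp only [Real.norm_eq_abs, ← jumpHeat_eq_ofReal_abs]

lemma tendsto_mildSolution_div {M : Measure (ℝ × Space d × ℝ)} (hM : ∀ᵐ p ∂M, p.2.1 ≠ 0)
    {f : ℝ → ℝ} (hfpos : ∀ t, 0 < t → 0 < f t) (hfmono : MonotoneOn f (Ioi 0))
    (hlim : Tendsto (fun t => t / f t) atTop (𝓝 0)) {K : ℝ} (hK : 0 ≤ K)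
    (hpast : ∀ᶠ n : ℕ in atTop, pastSum M n ≤ ENNReal.ofReal (K * n))
    (hrecent : ∀ η > 0, ∀ᶠ n : ℕ in atTop, recentSum M n ≤ ENNReal.ofReal (η * f n)) (m : ℝ) :
    Tendsto (fun t : ℝ => mildSolution m lam M t 0 / f t) atTop (𝓝 0) := by
  rw [Metric.tendsto_nhds]
  intro δ hδ
  set C := heatBound d
  have hC : 0 < C := one_pos.trans_le one_le_heatBound
  set η := δ / 2 / C
  set A := |noiseDrift m lam| + 3 ^ ((d : ℝ) / 2) * K
  have hlinear : ∀ᶠ t in atTop, A * (t / f t) < δ / 2 :=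
    (hlim.const_mul A).eventually (gt_mem_nhds (by rw [mul_zero]; positivity))
  filter_upwards [tendsto_nat_floor_atTop.eventually hpast,
    tendsto_nat_floor_atTop.eventually (hrecent η (by positivity)), hlinear,
    eventually_ge_atTop (1 : ℝ)] with t htpast htrecent htlinear ht1
  have ht0 : 0 < t := by linarith
  have hft : 0 < f t := hfpos t ht0
  set n := ⌊t⌋₊
  have hnt : (n : ℝ) ≤ t := Nat.floor_le ht0.le
  have hn0 : (0 : ℝ) < n := Nat.cast_pos.2 ((Nat.one_le_floor_iff t).2 ht1)
  have hfnt : f n ≤ f t := hfmono hn0 ht0 hnt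
  have hjumps : (∫⁻ p, jumpHeat t p ∂M).toReal ≤ 3 ^ ((d : ℝ) / 2) * (K * t) + C * (η * f t) := by
    refine ENNReal.toReal_le_of_le_ofReal (by positivity) ?_
    refine (lintegral_jumpHeat_le_pastSum_add_recentSum hM hnt
      (Nat.lt_floor_add_one t).le).trans ?_
    rw [ENNReal.ofReal_add (by positivity) (by positivity), ENNReal.ofReal_mul (by positivity),
      ENNReal.ofReal_mul (p := C) hC.le]
    gcongr
    · exact htpast.trans (by gcongr)
    · exact htrecent.trans (by gcongr)
  rw [mul_div_assoc', div_lt_iff₀ hft] at htlinear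
  rw [Real.dist_eq, sub_zero, abs_div, abs_of_pos hft, div_lt_iff₀ hft]
  calc |mildSolution m lam M t 0|
      ≤ |noiseDrift m lam| * t + (3 ^ ((d : ℝ) / 2) * (K * t) + C * (η * f t)) := by
        linarith [abs_mildSolution_le (lam := lam) ht0.le m M]
    _ = A * t + δ / 2 * f t := by
        rw [← mul_assoc C, mul_div_cancel₀ _ hC.ne']
        ring
    _ < δ * f t := by linarith

variable {Ω : Type*} [MeasurableSpace Ω] {P : Measure Ω} [IsProbabilityMeasure P]
  {N : Ω → Measure (ℝ × Space d × ℝ)}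

lemma ae_forall_lintegral_jumpHeat_lt_top
    (hN : IsPoissonRandomMeasure P N (jumpIntensity d lam)) (hd : 1 ≤ d)
    (hlam : IsLevyMeasure lam) (hκ : ∫⁻ z, ENNReal.ofReal |z| ∂lam < ⊤)
    (hlog : IntegrableOn (fun z : ℝ => |z * Real.log z|) (Icc (-1) 1) lam) :
    ∀ᵐ ω ∂P, ∀ t : ℝ, 0 ≤ t → ∫⁻ p, jumpHeat t p ∂(N ω) < ⊤ := by
  have := hlam.sigmaFinite
  filter_upwards [ae_pastSum_lt_top hN hκ, ae_recentSum_lt_top hN hd hlam hκ hlog,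
    hN.ae_ae_space_ne_zero hd] with ω hpast hrecent hω0 t ht
  exact (lintegral_jumpHeat_le_pastSum_add_recentSum hω0 (Nat.floor_le ht)
    (Nat.lt_floor_add_one t).le).trans_lt (ENNReal.add_lt_top.2
      ⟨ENNReal.mul_lt_top ENNReal.ofReal_lt_top (hpast _),
        ENNReal.mul_lt_top ENNReal.ofReal_lt_top (hrecent _)⟩)

lemma ae_tendsto_mildSolution_div (hN : IsPoissonRandomMeasure P N (jumpIntensity d lam))
    (hd : 1 ≤ d) (m : ℝ) (hlam : IsLevyMeasure lam)
    (hmoment : ∃ ε : ℝ, 0 < ε ∧ Integrable (fun z : ℝ => |z| ^ (1 + ε)) lam)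
    (hlog : IntegrableOn (fun z : ℝ => |z * Real.log z|) (Icc (-1) 1) lam) {f : ℝ → ℝ}
    (hfpos : ∀ t, 0 < t → 0 < f t) (hfmono : MonotoneOn f (Ioi 0))
    (hint : (∫⁻ t in Ioi (1 : ℝ), ENNReal.ofReal (1 / f t)) < ⊤) :
    ∀ᵐ ω ∂P, Tendsto (fun t : ℝ => mildSolution m lam (N ω) t 0 / f t) atTop (𝓝 0) := by
  have := hlam.sigmaFinite
  have hκ := hlam.lintegral_abs_lt_top hmoment hlog
  have hrecent : ∀ᵐ ω ∂P, ∀ k : ℕ, ∀ᶠ n : ℕ in atTop,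
      recentSum (N ω) n ≤ ENNReal.ofReal (1 / ((k : ℝ) + 1) * f n) :=
    ae_all_iff.2 fun k =>
      ae_eventually_recentSum_le hN hd hlam hκ hlog hfpos hfmono hint (by positivity)
  filter_upwards [ae_eventually_pastSum_le hN hd hmoment hκ, hrecent, hN.ae_ae_space_ne_zero hd]
    with ω ⟨K, hK, hωpast⟩ hωrecent hω0
  refine tendsto_mildSolution_div hω0 hfpos hfmono
    (tendsto_div_of_lintegral_lt_top hfpos hfmono hint) hK hωpast (fun η hη => ?_) m
  obtain ⟨k, hk⟩ := exists_nat_one_div_lt hη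
  filter_upwards [hωrecent k, eventually_ge_atTop 1] with n hn hn1
  have hfn : 0 < f n := hfpos n (Nat.cast_pos.2 hn1)
  exact hn.trans (by gcongr)

end Solution

section LawOfLargeNumbers

variable {Ω : Type*} [MeasurableSpace Ω] {P : Measure Ω}
  {d : ℕ} {lam : Measure ℝ} {N : Ω → Measure (ℝ × Space d × ℝ)}

/-- The contribution at time `t` of the jumps of `M` of size at most `b` up to time `t - L`. These
contributions are bounded by `b` if `1 ≤ L`, and barely decrease during `[t, t + 1]` if `L` is
large. -/
noncomputable def boundedPastSum (M : Measure (ℝ × Space d × ℝ)) (b L t : ℝ) : ℝ≥0∞ :=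
  ∫⁻ p in Iic (t - L) ×ˢ {q | |q.2| ≤ b}, jumpHeat t p ∂M

lemma measurableSet_boundedPast (b s : ℝ) :
    MeasurableSet (Iic s ×ˢ {q : Space d × ℝ | |q.2| ≤ b}) :=
  measurableSet_Iic.prod (measurableSet_le (by fun_prop) measurable_const)

lemma boundedPastSum_jumpIntensity [SFinite lam] (b : ℝ) {L : ℝ} (hL : 0 < L) (t : ℝ) :
    boundedPastSum (jumpIntensity d lam) b L t
      = ENNReal.ofReal (t - L) * ∫⁻ z in {z | |z| ≤ b}, ENNReal.ofReal |z| ∂lam := by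
  have hb : MeasurableSet {z : ℝ | |z| ≤ b} := measurableSet_le (by fun_prop) measurable_const
  have hfactor := lintegral_indicator_mul_heatKernel_mul (d := d) (lam := lam) t
    (measurableSet_Iic (a := t - L)) (w := {z | |z| ≤ b}.indicator fun z => ENNReal.ofReal |z|)
    (Measurable.indicator (by fun_prop) hb)
  have htime : Iic (t - L) ∩ Ioo 0 t = Ioc 0 (t - L) := by
    rw [← Ioi_inter_Iio, ← Ioi_inter_Iic, inter_left_comm,
      inter_eq_left.2 (Iic_subset_Iio.2 (sub_lt_self t hL))]
  rw [htime, Real.volume_Ioc, sub_zero, lintegral_indicator hb] at hfactor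
  rw [← hfactor, boundedPastSum, ← lintegral_indicator (measurableSet_boundedPast _ _)]
  refine lintegral_congr fun p => ?_
  by_cases hp : p.1 ≤ t - L <;> by_cases hz : |p.2.2| ≤ b <;>
    simp [hp, hz, jumpHeat, ENNReal.ofReal_mul (heatKernel_nonneg _ _)]

lemma boundedPastSum_le_mul_lintegral_jumpHeat (M : Measure (ℝ × Space d × ℝ)) (b : ℝ) {L s t : ℝ}
    (hL : 0 < L) (hst : s ≤ t) (hts : t ≤ s + 1) :
    boundedPastSum M b L s
      ≤ ENNReal.ofReal ((1 + 1 / L) ^ ((d : ℝ) / 2)) * ∫⁻ p, jumpHeat t p ∂M := by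
  rw [← lintegral_const_mul _ (measurable_jumpHeat _)]
  refine (setLIntegral_mono' (measurableSet_boundedPast b _) fun p hp => ?_).trans
    (setLIntegral_le_lintegral _ _)
  have hp1 : p.1 ≤ s - L := hp.1
  refine jumpHeat_le_rpow_mul_jumpHeat (by linarith) hst ?_
  have hlag : 1 ≤ (s - p.1) / L := (one_le_div hL).2 (by linarith)
  calc t - p.1 ≤ (s - p.1) + (s - p.1) / L := by linarith
    _ = (1 + 1 / L) * (s - p.1) := by ring

lemma lower_chernoff_exponent_le {b k c L t : ℝ} (hb : 0 ≤ b) (hk : 0 ≤ k) (hck : c < k)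
    (hL : 0 ≤ L) (hLt : L ≤ t) {θ : ℝ} (hθ : θ = (k - c) / (b * k + 1)) :
    θ * (c * t) - θ * (1 - θ * b / 2) * ((t - L) * k)
      ≤ θ * L * k + -(θ * (k - c) / 2) * t := by
  have : 0 < k - c := sub_pos.2 hck
  have hθ0 : 0 ≤ θ := hθ ▸ by positivity
  have hθbk : θ * (b * k) ≤ k - c := by
    rw [hθ, div_mul_eq_mul_div, div_le_iff₀ (by positivity)]
    linarith
  have hquad : θ * (θ * (b * k)) * (t - L) ≤ θ * (k - c) * t := by
    have : 0 ≤ t - L := sub_nonneg.2 hLt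
    gcongr
    linarith
  linarith

lemma exists_truncation {c : ℝ≥0∞} (hc : c < ∫⁻ z, ENNReal.ofReal |z| ∂lam) :
    ∃ b : ℝ, 0 ≤ b ∧ c < ∫⁻ z in {z | |z| ≤ b}, ENNReal.ofReal |z| ∂lam := by
  have hcover : ⋃ n : ℕ, {z : ℝ | |z| ≤ n} = univ :=
    eq_univ_of_forall fun z => mem_iUnion.2 (exists_nat_ge |z|)
  have hmono : Monotone fun n : ℕ => {z : ℝ | |z| ≤ n} := fun m n hmn z (hz : |z| ≤ m) =>
    hz.trans (Nat.cast_le.2 hmn)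
  rw [← setLIntegral_univ, ← hcover, setLIntegral_iUnion_of_directed _ hmono.directed_le,
    lt_iSup_iff] at hc
  obtain ⟨n, hn⟩ := hc
  exact ⟨n, n.cast_nonneg, hn⟩

lemma exists_one_add_one_div_rpow_lt (a : ℝ) {r : ℝ} (hr : 1 < r) :
    ∃ L : ℝ, 1 ≤ L ∧ (1 + 1 / L) ^ a < r := by
  have hbase : Tendsto (fun L : ℝ => 1 + 1 / L) atTop (𝓝 1) := by
    simpa using tendsto_inv_atTop_zero.const_add (1 : ℝ)
  have hpow := hbase.rpow_const (p := a) (Or.inl one_ne_zero)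
  rw [Real.one_rpow] at hpow
  exact ((eventually_ge_atTop 1).and (hpow.eventually (gt_mem_nhds hr))).exists

lemma noiseDrift_eq_add_of_measure_Ioi_eq_zero (m : ℝ) (hneg : lam (Ioi 0) = 0) :
    noiseDrift m lam = m + (∫⁻ z, ENNReal.ofReal |z| ∂lam).toReal := by
  have hae : ∀ᵐ z ∂lam, -z = |z| := by
    filter_upwards [measure_eq_zero_iff_ae_notMem.1 hneg] with z hz
    rw [abs_of_nonpos (not_lt.1 hz)]
  rw [noiseDrift, sub_eq_add_neg, ← integral_neg, integral_congr_ae hae,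
    integral_eq_lintegral_of_nonneg_ae (ae_of_all _ abs_nonneg) (by fun_prop)]

lemma mildSolution_eq_sub_of_ae_nonpos {M : Measure (ℝ × Space d × ℝ)}
    (hM : ∀ᵐ p ∂M, p.2.2 ≤ 0) {t : ℝ} (ht : 0 ≤ t) (m : ℝ) :
    mildSolution m lam M t 0
      = noiseDrift m lam * t - (∫⁻ p, jumpHeat t p ∂M).toReal := by
  have hae : ∀ᵐ p ∂M, mildKernel t 0 (p.1, p.2.1) * p.2.2
      = -|mildKernel t 0 (p.1, p.2.1) * p.2.2| := by
    filter_upwards [hM] with p hp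
    rw [abs_of_nonpos (mul_nonpos_of_nonneg_of_nonpos (mildKernel_nonneg t 0 _) hp), neg_neg]
  rw [mildSolution_eq ht, integral_congr_ae hae, integral_neg, ← sub_eq_add_neg,
    integral_eq_lintegral_of_nonneg_ae (ae_of_all _ fun p => abs_nonneg _)
      (measurable_mildKernel_mul t 0).norm.aestronglyMeasurable]
  simp only [← jumpHeat_eq_ofReal_abs]

lemma limsup_coe_sub_coe_eq {ι : Type*} {l : Filter ι} [l.NeBot] (a : ℝ) (u : ι → ℝ≥0∞) :
    limsup (fun i => (a : EReal) - (u i : EReal)) l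
      = (a : EReal) - ((liminf u l : ℝ≥0∞) : EReal) := by
  have hpair : Continuous fun x : ℝ≥0∞ => ((a : EReal), -(x : EReal)) :=
    continuous_const.prodMk (continuous_neg.comp continuous_coe_ennreal_ereal)
  have hcont : Continuous fun x : ℝ≥0∞ => (a : EReal) - (x : EReal) :=
    continuous_iff_continuousAt.2 fun x =>
      (EReal.continuousAt_add (p := ((a : EReal), -(x : EReal))) (.inl (EReal.coe_ne_top a))
        (.inl (EReal.coe_ne_bot a))).comp
        (f := fun x : ℝ≥0∞ => ((a : EReal), -(x : EReal))) hpair.continuousAt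
  have hanti : Antitone fun x : ℝ≥0∞ => (a : EReal) - (x : EReal) := fun x y hxy =>
    EReal.sub_le_sub le_rfl (EReal.coe_ennreal_le_coe_ennreal_iff.2 hxy)
  exact (hanti.map_liminf_of_continuousAt u hcont.continuousAt).symm

variable [IsProbabilityMeasure P]

lemma measure_boundedPastSum_lt_le [SFinite lam]
    (hN : IsPoissonRandomMeasure P N (jumpIntensity d lam))
    {b : ℝ} (hb : 0 ≤ b) (hfin : ∫⁻ z in {z | |z| ≤ b}, ENNReal.ofReal |z| ∂lam ≠ ⊤)
    {L t : ℝ} (hL : 1 ≤ L) (hLt : L ≤ t) {θ : ℝ} (hθ : 0 ≤ θ) (x : ℝ) :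
    P {ω | boundedPastSum (N ω) b L t < ENNReal.ofReal x}
      ≤ ENNReal.ofReal (Real.exp (θ * x - θ * (1 - θ * b / 2) *
        ((t - L) * (∫⁻ z in {z | |z| ≤ b}, ENNReal.ofReal |z| ∂lam).toReal))) := by
  have hmean := boundedPastSum_jumpIntensity (d := d) (lam := lam) b (one_pos.trans_le hL) t
  have hmean' : ((t - L) * (∫⁻ z in {z | |z| ≤ b}, ENNReal.ofReal |z| ∂lam).toReal)
      = (boundedPastSum (jumpIntensity d lam) b L t).toReal := by
    rw [hmean, ENNReal.toReal_mul, ENNReal.toReal_ofReal (sub_nonneg.2 hLt)]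
  rw [hmean']
  refine hN.measure_setLIntegral_lt_le (measurableSet_boundedPast b _) (measurable_jumpHeat t) hb
    (fun p hp => ENNReal.ofReal_le_ofReal ?_) ?_ hθ
  · have hp1 : p.1 ≤ t - L := hp.1
    have hkernel := heatKernel_le_one (d := d) (show 1 ≤ t - p.1 by linarith) p.2.1
    exact (mul_le_of_le_one_left (abs_nonneg _) hkernel).trans hp.2
  · change boundedPastSum (jumpIntensity d lam) b L t ≠ ⊤
    rw [hmean]
    exact ENNReal.mul_ne_top ENNReal.ofReal_ne_top hfin

lemma ae_eventually_le_boundedPastSum [SFinite lam]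
    (hN : IsPoissonRandomMeasure P N (jumpIntensity d lam))
    {b : ℝ} (hb : 0 ≤ b) (hfin : ∫⁻ z in {z | |z| ≤ b}, ENNReal.ofReal |z| ∂lam ≠ ⊤)
    {L : ℝ} (hL : 1 ≤ L) {c : ℝ}
    (hc : c < (∫⁻ z in {z | |z| ≤ b}, ENNReal.ofReal |z| ∂lam).toReal) :
    ∀ᵐ ω ∂P, ∀ᶠ n : ℕ in atTop, ENNReal.ofReal (c * n) ≤ boundedPastSum (N ω) b L n := by
  set k := (∫⁻ z in {z | |z| ≤ b}, ENNReal.ofReal |z| ∂lam).toReal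
  have hk : 0 ≤ k := ENNReal.toReal_nonneg
  have : 0 < k - c := sub_pos.2 hc
  set θ := (k - c) / (b * k + 1)
  have hθ : 0 < θ := by positivity
  have htail : ∀ᶠ n : ℕ in atTop, P {ω | boundedPastSum (N ω) b L n < ENNReal.ofReal (c * n)}
      ≤ ENNReal.ofReal (Real.exp (θ * L * k)) *
        ENNReal.ofReal (Real.exp (-(θ * (k - c) / 2) * (n : ℝ) ^ (1 : ℝ))) := by
    filter_upwards [tendsto_natCast_atTop_atTop.eventually_ge_atTop L] with n hn
    refine (measure_boundedPastSum_lt_le hN hb hfin hL hn hθ.le _).trans ?_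
    rw [← ENNReal.ofReal_mul (Real.exp_pos _).le, ← Real.exp_add, Real.rpow_one]
    gcongr
    exact lower_chernoff_exponent_le hb hk hc (zero_le_one.trans hL) hn rfl
  have hsum : ∑' n : ℕ, ENNReal.ofReal (Real.exp (θ * L * k)) *
      ENNReal.ofReal (Real.exp (-(θ * (k - c) / 2) * ((n + 0 : ℕ) : ℝ) ^ (1 : ℝ))) < ⊤ := by
    rw [ENNReal.tsum_mul_left]
    exact ENNReal.mul_lt_top ENNReal.ofReal_lt_top
      (tsum_ofReal_exp_lt_top one_pos (by positivity))
  filter_upwards [ae_eventually_notMem_of_eventually_le htail hsum] with ω hω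
  exact hω.mono fun n hn => not_lt.1 hn

lemma ae_eventually_le_lintegral_jumpHeat
    [SFinite lam] (hN : IsPoissonRandomMeasure P N (jumpIntensity d lam))
    (hκ : ∫⁻ z, ENNReal.ofReal |z| ∂lam < ⊤) {c : ℝ} (hc0 : 0 ≤ c)
    (hc : ENNReal.ofReal c < ∫⁻ z, ENNReal.ofReal |z| ∂lam) :
    ∀ᵐ ω ∂P, ∀ᶠ t : ℝ in atTop, ENNReal.ofReal (c * t) ≤ ∫⁻ p, jumpHeat t p ∂(N ω) := by
  obtain ⟨b, hb, hcb⟩ := exists_truncation hc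
  have hfin : ∫⁻ z in {z | |z| ≤ b}, ENNReal.ofReal |z| ∂lam ≠ ⊤ :=
    ((setLIntegral_le_lintegral _ _).trans_lt hκ).ne
  rw [ENNReal.ofReal_lt_iff_lt_toReal hc0 hfin] at hcb
  obtain ⟨c₂, hcc₂, hc₂k⟩ := exists_between hcb
  obtain ⟨c₁, hcc₁, hc₁c₂⟩ := exists_between hcc₂
  have hc₁0 : 0 < c₁ := hc0.trans_lt hcc₁
  obtain ⟨L, hL, hratio⟩ := exists_one_add_one_div_rpow_lt ((d : ℝ) / 2)
    ((one_lt_div hc₁0).2 hc₁c₂)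
  have hL0 : 0 < L := one_pos.trans_le hL
  set r := (1 + 1 / L) ^ ((d : ℝ) / 2)
  have hr : 0 < r := by positivity
  filter_upwards [ae_eventually_le_boundedPastSum hN hb hfin hL hc₂k] with ω hω
  filter_upwards [tendsto_nat_floor_atTop.eventually hω, eventually_ge_atTop (0 : ℝ),
    eventually_ge_atTop (c₁ / (c₁ - c))] with t hpast ht0 ht
  rw [div_le_iff₀ (sub_pos.2 hcc₁)] at ht
  refine (ENNReal.mul_le_mul_iff_right (ENNReal.ofReal_pos.2 hr).ne' ENNReal.ofReal_ne_top).1 ?_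
  refine le_trans ?_ (hpast.trans (boundedPastSum_le_mul_lintegral_jumpHeat (N ω) b hL0
    (Nat.floor_le ht0) (Nat.lt_floor_add_one t).le))
  rw [← ENNReal.ofReal_mul hr.le]
  refine ENNReal.ofReal_le_ofReal ?_
  have hfloor : c * t ≤ c₁ * ⌊t⌋₊ :=
    calc c * t ≤ c₁ * (t - 1) := by linarith
      _ ≤ c₁ * ⌊t⌋₊ := by
        gcongr
        linarith [Nat.lt_floor_add_one t]
  calc r * (c * t) ≤ r * (c₁ * ⌊t⌋₊) := by gcongr
    _ ≤ c₂ / c₁ * (c₁ * ⌊t⌋₊) := by gcongr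
    _ = c₂ * ⌊t⌋₊ := by field_simp

lemma ae_le_liminf_lintegral_jumpHeat_div
    [SFinite lam] (hN : IsPoissonRandomMeasure P N (jumpIntensity d lam))
    (hκ : ∫⁻ z, ENNReal.ofReal |z| ∂lam < ⊤) :
    ∀ᵐ ω ∂P, ∫⁻ z, ENNReal.ofReal |z| ∂lam
      ≤ liminf (fun t : ℝ => (∫⁻ p, jumpHeat t p ∂(N ω)) / ENNReal.ofReal t) atTop := by
  have hrat : ∀ᵐ ω ∂P, ∀ q : ℚ, 0 ≤ q →
      ENNReal.ofReal q < ∫⁻ z, ENNReal.ofReal |z| ∂lam →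
        ∀ᶠ t : ℝ in atTop, ENNReal.ofReal (q * t) ≤ ∫⁻ p, jumpHeat t p ∂(N ω) := by
    refine ae_all_iff.2 fun q => ?_
    simp only [eventually_imp_distrib_left]
    exact fun hq => ae_eventually_le_lintegral_jumpHeat hN hκ (Rat.cast_nonneg.2 hq)
  filter_upwards [hrat] with ω hω
  refine le_of_forall_lt fun a ha => ?_
  obtain ⟨q, hq0, haq, hq⟩ := ENNReal.lt_iff_exists_rat_btwn.1 ha
  refine haq.trans_le (le_liminf_of_le (by isBoundedDefault) ?_)
  filter_upwards [hω q hq0 hq, eventually_gt_atTop 0] with t ht ht0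
  rw [ENNReal.le_div_iff_mul_le (Or.inl (ENNReal.ofReal_pos.2 ht0).ne')
    (Or.inl ENNReal.ofReal_ne_top)]
  exact (ENNReal.ofReal_mul (Rat.cast_nonneg.2 hq0)).symm.trans_le ht

/-- By Fatou's lemma, the liminf has mean at most `∫ |z| lam(dz)`, which is also a lower bound. -/
lemma ae_liminf_lintegral_jumpHeat_div_eq
    [SFinite lam] (hN : IsPoissonRandomMeasure P N (jumpIntensity d lam))
    (hκ : ∫⁻ z, ENNReal.ofReal |z| ∂lam < ⊤) :
    ∀ᵐ ω ∂P, liminf (fun t : ℝ => (∫⁻ p, jumpHeat t p ∂(N ω)) / ENNReal.ofReal t) atTop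
      = ∫⁻ z, ENNReal.ofReal |z| ∂lam := by
  set κ := ∫⁻ z, ENNReal.ofReal |z| ∂lam
  let ratio (ω : Ω) (t : ℝ) : ℝ≥0∞ := (∫⁻ p, jumpHeat t p ∂(N ω)) / ENNReal.ofReal t
  have hshift : Tendsto (fun n : ℕ => (n : ℝ) + 1) atTop atTop :=
    tendsto_atTop_add_const_right _ _ tendsto_natCast_atTop_atTop
  have hle (ω : Ω) : liminf (ratio ω) atTop ≤ liminf (fun n : ℕ => ratio ω (n + 1)) atTop :=
    hshift.liminf_le_liminf_comp
  have hmeas (n : ℕ) : Measurable fun ω => ratio ω (n + 1) :=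
    (hN.measurable_lintegral (measurable_jumpHeat _)).div_const _
  have hmean (n : ℕ) : ∫⁻ ω, ratio ω (n + 1) ∂P = κ := by
    simp only [ratio, ENNReal.div_eq_inv_mul]
    rw [lintegral_const_mul _ (hN.measurable_lintegral (measurable_jumpHeat _)),
      hN.lintegral_lintegral (measurable_jumpHeat _), lintegral_jumpHeat, ← mul_assoc,
      ENNReal.inv_mul_cancel (ENNReal.ofReal_pos.2 (by positivity)).ne' ENNReal.ofReal_ne_top,
      one_mul]
  have hfatou : ∫⁻ ω, liminf (fun n : ℕ => ratio ω (n + 1)) atTop ∂P ≤ ∫⁻ _, κ ∂P := by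
    refine (lintegral_liminf_le hmeas).trans_eq ?_
    simp [hmean]
  have hlower := ae_le_liminf_lintegral_jumpHeat_div hN hκ
  have heq := ae_eq_of_ae_le_of_lintegral_le (hlower.mono fun ω hω => hω.trans (hle ω))
    (by simpa using hκ.ne) (Measurable.liminf hmeas).aemeasurable hfatou
  filter_upwards [hlower, heq] with ω hω hωeq
  exact le_antisymm ((hle ω).trans_eq hωeq.symm) hω

lemma IsPoissonRandomMeasure.ae_ae_jump_nonpos
    [SFinite lam] (hN : IsPoissonRandomMeasure P N (jumpIntensity d lam)) (hneg : lam (Ioi 0) = 0) :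
    ∀ᵐ ω ∂P, ∀ᵐ p ∂(N ω), p.2.2 ≤ 0 := by
  have hzero : jumpIntensity d lam (univ ×ˢ univ ×ˢ Ioi 0) = 0 := by
    rw [jumpIntensity, Measure.prod_prod, Measure.prod_prod, hneg, mul_zero, mul_zero]
  have hmeas : MeasurableSet (univ ×ˢ univ ×ˢ Ioi 0 : Set (ℝ × Space d × ℝ)) :=
    .prod .univ (.prod .univ measurableSet_Ioi)
  filter_upwards [hN.ae_eq_zero hmeas hzero] with ω hω
  filter_upwards [measure_eq_zero_iff_ae_notMem.1 hω] with p hp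
  exact not_lt.1 fun hpos => hp ⟨mem_univ _, mem_univ _, hpos⟩

lemma ae_limsup_mildSolution_div_eq (hN : IsPoissonRandomMeasure P N (jumpIntensity d lam))
    (hd : 1 ≤ d) (m : ℝ) (hlam : IsLevyMeasure lam)
    (hκ : ∫⁻ z, ENNReal.ofReal |z| ∂lam < ⊤)
    (hlog : IntegrableOn (fun z : ℝ => |z * Real.log z|) (Icc (-1) 1) lam)
    (hneg : lam (Ioi 0) = 0) :
    ∀ᵐ ω ∂P, limsup (fun t : ℝ => ((mildSolution m lam (N ω) t 0 / t : ℝ) : EReal)) atTop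
      = (m : EReal) := by
  have := hlam.sigmaFinite
  filter_upwards [hN.ae_ae_jump_nonpos hneg, ae_liminf_lintegral_jumpHeat_div_eq hN hκ,
    ae_forall_lintegral_jumpHeat_lt_top hN hd hlam hκ hlog] with ω hωneg hωliminf hωfin
  have hratio : (fun t : ℝ => ((mildSolution m lam (N ω) t 0 / t : ℝ) : EReal)) =ᶠ[atTop]
      fun t => (noiseDrift m lam : EReal)
        - (((∫⁻ p, jumpHeat t p ∂(N ω)) / ENNReal.ofReal t : ℝ≥0∞) : EReal) := by
    filter_upwards [eventually_gt_atTop 0] with t ht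
    have hfin : (∫⁻ p, jumpHeat t p ∂(N ω)) / ENNReal.ofReal t ≠ ⊤ :=
      ENNReal.div_ne_top (hωfin t ht.le).ne (ENNReal.ofReal_pos.2 ht).ne'
    rw [mildSolution_eq_sub_of_ae_nonpos hωneg ht.le, sub_div, mul_div_cancel_right₀ _ ht.ne',
      ← EReal.coe_ennreal_toReal hfin, ENNReal.toReal_div, ENNReal.toReal_ofReal ht.le,
      EReal.coe_sub]
  rw [limsup_congr hratio, limsup_coe_sub_coe_eq, hωliminf,
    noiseDrift_eq_add_of_measure_Ioi_eq_zero m hneg, ← EReal.coe_ennreal_toReal hκ.ne,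
    ← EReal.coe_sub, add_sub_cancel_right]

end LawOfLargeNumbers

section NegativeJumps

variable {Ω : Type*} [MeasurableSpace Ω] {P : Measure Ω} {d : ℕ} {lam : Measure ℝ}
  {N : Ω → Measure (ℝ × Space d × ℝ)}

/-- The absolute value of the contribution of the jump `p` to the solution at `(t, 0)` if this
contribution is negative, and `0` otherwise. -/
noncomputable def negJumpHeat (t : ℝ) (p : ℝ × Space d × ℝ) : ℝ≥0∞ :=
  ENNReal.ofReal (-(mildKernel t 0 (p.1, p.2.1) * p.2.2))

lemma measurable_negJumpHeat (t : ℝ) : Measurable (negJumpHeat (d := d) t) :=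
  (measurable_mildKernel_mul t 0).neg.ennreal_ofReal

lemma negJumpHeat_le_jumpHeat (t : ℝ) (p : ℝ × Space d × ℝ) :
    negJumpHeat t p ≤ jumpHeat t p := by
  rw [jumpHeat_eq_ofReal_abs, negJumpHeat]
  exact ENNReal.ofReal_le_ofReal (neg_le_abs _)

lemma negJumpHeat_of_nonneg (t : ℝ) {p : ℝ × Space d × ℝ} (hp : 0 ≤ p.2.2) :
    negJumpHeat t p = 0 := by
  rw [negJumpHeat, ENNReal.ofReal_eq_zero, neg_nonpos]
  exact mul_nonneg (mildKernel_nonneg t 0 _) hp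

lemma lintegral_negJumpHeat_jumpIntensity_le [SFinite lam] (t : ℝ) :
    ∫⁻ p, negJumpHeat t p ∂(jumpIntensity d lam)
      ≤ ENNReal.ofReal t * ∫⁻ z, ENNReal.ofReal |z| ∂lam :=
  (lintegral_mono fun p => negJumpHeat_le_jumpHeat t p).trans_eq (lintegral_jumpHeat t)

lemma le_measure_lintegral_negJumpHeat_le [IsProbabilityMeasure P] [SFinite lam]
    (hN : IsPoissonRandomMeasure P N (jumpIntensity d lam)) {C t : ℝ} (hC : 0 < C) (ht : 0 < t) :
    1 - (∫⁻ z, ENNReal.ofReal |z| ∂lam) / ENNReal.ofReal C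
      ≤ P {ω | ∫⁻ p, negJumpHeat t p ∂(N ω) ≤ ENNReal.ofReal (C * t)} := by
  have hmeas := hN.measurable_lintegral (measurable_negJumpHeat (d := d) t)
  have hmarkov : P {ω | ENNReal.ofReal (C * t) < ∫⁻ p, negJumpHeat t p ∂(N ω)}
      ≤ (∫⁻ z, ENNReal.ofReal |z| ∂lam) / ENNReal.ofReal C :=
    calc P {ω | ENNReal.ofReal (C * t) < ∫⁻ p, negJumpHeat t p ∂(N ω)}
        ≤ P {ω | ENNReal.ofReal (C * t) ≤ ∫⁻ p, negJumpHeat t p ∂(N ω)} :=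
          measure_mono (ofPred_subset_ofPred.2 fun _ => le_of_lt)
      _ ≤ (∫⁻ ω, ∫⁻ p, negJumpHeat t p ∂(N ω) ∂P) / ENNReal.ofReal (C * t) :=
          meas_ge_le_lintegral_div hmeas.aemeasurable
            (ENNReal.ofReal_pos.2 (mul_pos hC ht)).ne' ENNReal.ofReal_ne_top
      _ ≤ (ENNReal.ofReal t * ∫⁻ z, ENNReal.ofReal |z| ∂lam) / ENNReal.ofReal (C * t) := by
          rw [hN.lintegral_lintegral (measurable_negJumpHeat t)]
          gcongr
          exact lintegral_negJumpHeat_jumpIntensity_le t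
      _ = (∫⁻ z, ENNReal.ofReal |z| ∂lam) / ENNReal.ofReal C := by
          rw [mul_comm C t, ENNReal.ofReal_mul ht.le]
          exact ENNReal.mul_div_mul_left _ _ (ENNReal.ofReal_pos.2 ht).ne' ENNReal.ofReal_ne_top
  have hcompl : {ω | ∫⁻ p, negJumpHeat t p ∂(N ω) ≤ ENNReal.ofReal (C * t)}
      = {ω | ENNReal.ofReal (C * t) < ∫⁻ p, negJumpHeat t p ∂(N ω)}ᶜ := by
    ext ω
    simp only [mem_ofPred_eq, mem_compl_iff, not_lt]
  rw [hcompl, prob_compl_eq_one_sub (measurableSet_lt measurable_const hmeas)]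
  exact tsub_le_tsub_left hmarkov 1

lemma le_mildSolution_of_lintegral_negJumpHeat_le {M : Measure (ℝ × Space d × ℝ)} {t : ℝ}
    (ht : 0 ≤ t) (hM : ∫⁻ p, jumpHeat t p ∂M < ⊤) (m : ℝ) {a b : ℝ} (hb : 0 ≤ b)
    (hpos : ENNReal.ofReal a ≤ ∫⁻ p, ENNReal.ofReal (mildKernel t 0 (p.1, p.2.1) * p.2.2) ∂M)
    (hneg : ∫⁻ p, negJumpHeat t p ∂M ≤ ENNReal.ofReal b) :
    noiseDrift m lam * t + (a - b) ≤ mildSolution m lam M t 0 := by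
  have hfin : ∫⁻ p, ENNReal.ofReal (mildKernel t 0 (p.1, p.2.1) * p.2.2) ∂M ≠ ⊤ :=
    ne_top_of_le_ne_top hM.ne (lintegral_mono fun p => by
      rw [jumpHeat_eq_ofReal_abs]
      exact ENNReal.ofReal_le_ofReal (le_abs_self _))
  rw [mildSolution_eq ht,
    integral_eq_lintegral_pos_part_sub_lintegral_neg_part (integrable_mildKernel_mul hM)]
  gcongr
  · exact (ENNReal.ofReal_le_iff_le_toReal hfin).1 hpos
  · exact ENNReal.toReal_le_of_le_ofReal hb hneg

end NegativeJumps

section PeakCells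

variable {d : ℕ} {lam : Measure ℝ} {a δ : ℝ} {r : ℕ → ℝ}

/-- The jumps larger than `δ` in the `n`-th unit time interval after time `a` and at distance
less than `r n` from the origin. -/
def peakStrip (d : ℕ) (a δ : ℝ) (r : ℕ → ℝ) (n : ℕ) : Set (ℝ × Space d × ℝ) :=
  Ioc (a + n) (a + n + 1) ×ˢ (Metric.ball 0 (r n) ×ˢ Ioi δ)

/-- The part of `peakStrip d a δ r i.1` in the `i.2`-th time interval of length `r i.1 ^ 2`, the
time the heat kernel needs to spread over the ball of radius `r i.1`. -/
def peakCell (d : ℕ) (a δ : ℝ) (r : ℕ → ℝ) (i : ℕ × ℕ) : Set (ℝ × Space d × ℝ) :=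
  peakStrip d a δ r i.1 ∩
    Prod.fst ⁻¹' Ioc (a + i.1 + i.2 * r i.1 ^ 2) (a + i.1 + (i.2 + 1) * r i.1 ^ 2)

/-- The time at which the jumps in `peakCell d a δ r i` are observed at the origin. -/
def peakTime (a : ℝ) (r : ℕ → ℝ) (i : ℕ × ℕ) : ℝ :=
  a + i.1 + (i.2 + 2) * r i.1 ^ 2

lemma measurableSet_peakStrip (n : ℕ) : MeasurableSet (peakStrip d a δ r n) :=
  measurableSet_Ioc.prod (measurableSet_ball.prod measurableSet_Ioi)

lemma measurableSet_peakCell (i : ℕ × ℕ) : MeasurableSet (peakCell d a δ r i) :=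
  (measurableSet_peakStrip i.1).inter (measurable_fst measurableSet_Ioc)

lemma pairwise_disjoint_peakStrip : Pairwise (Function.onFun Disjoint (peakStrip d a δ r)) := by
  intro m n hmn
  have htime := pairwise_disjoint_Ioc_add_intCast a (Nat.cast_injective.ne hmn : (m : ℤ) ≠ n)
  simp only [Function.onFun, Int.cast_natCast] at htime
  exact htime.set_prod_left _ _

lemma pairwise_disjoint_peakCell : Pairwise (Function.onFun Disjoint (peakCell d a δ r)) := by
  rintro ⟨m, k⟩ ⟨n, l⟩ hij
  rcases eq_or_ne m n with rfl | hmn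
  · have hkl : (k : ℤ) ≠ l := fun h => hij (by rw [Int.natCast_inj.1 h])
    have htime := pairwise_disjoint_Ioc_add_zsmul (a + m) (r m ^ 2) hkl
    simp only [Function.onFun, zsmul_eq_mul, Int.cast_add, Int.cast_natCast, Int.cast_one]
      at htime
    exact (htime.preimage Prod.fst).mono inter_subset_right inter_subset_right
  · exact (pairwise_disjoint_peakStrip hmn).mono inter_subset_left inter_subset_left

lemma peakStrip_subset_iUnion_peakCell {n : ℕ} (hr : 0 < r n) :
    peakStrip d a δ r n ⊆ ⋃ i, peakCell d a δ r i := fun p hp => by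
  obtain ⟨k, hk⟩ := exists_nat_mem_Ioc_add_mul (pow_pos hr 2) hp.1.1
  exact mem_iUnion.2 ⟨(n, k), hp, hk⟩

lemma jumpIntensity_peakStrip [SFinite lam] (ha : 0 ≤ a) {n : ℕ} (hr : 0 < r n) :
    jumpIntensity d lam (peakStrip d a δ r n)
      = volume (Metric.ball (0 : Space d) 1) * lam (Ioi δ) * ENNReal.ofReal (r n ^ d) := by
  have htime : Ioc (a + n) (a + n + 1) ⊆ Ioi 0 := fun t ht =>
    (add_nonneg ha n.cast_nonneg).trans_lt ht.1
  rw [peakStrip, jumpIntensity_prod measurableSet_Ioc, inter_eq_left.2 htime, Real.volume_Ioc,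
    add_sub_cancel_left, ENNReal.ofReal_one, one_mul, Measure.prod_prod,
    Measure.addHaar_ball_of_pos _ _ hr, finrank_euclideanSpace, Fintype.card_fin]
  ring

lemma jumpIntensity_iUnion_peakCell_eq_top [SFinite lam] (ha : 0 ≤ a) (hr : ∀ n, 0 < r n)
    (hsum : ∑' n, ENNReal.ofReal (r n ^ d) = ⊤) (hδ : lam (Ioi δ) ≠ 0) :
    jumpIntensity d lam (⋃ i, peakCell d a δ r i) = ⊤ := by
  have hball : volume (Metric.ball (0 : Space d) 1) ≠ 0 :=
    (Metric.measure_ball_pos volume 0 one_pos).ne'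
  rw [← top_le_iff]
  calc ⊤ = ∑' n, jumpIntensity d lam (peakStrip d a δ r n) := by
        simp only [jumpIntensity_peakStrip ha (hr _)]
        rw [ENNReal.tsum_mul_left, hsum, ENNReal.mul_top (mul_ne_zero hball hδ)]
    _ = jumpIntensity d lam (⋃ n, peakStrip d a δ r n) :=
        (measure_iUnion pairwise_disjoint_peakStrip measurableSet_peakStrip).symm
    _ ≤ jumpIntensity d lam (⋃ i, peakCell d a δ r i) :=
        measure_mono (iUnion_subset fun n => peakStrip_subset_iUnion_peakCell (hr n))

lemma le_peakTime (a : ℝ) (r : ℕ → ℝ) (i : ℕ × ℕ) : a ≤ peakTime a r i := by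
  rw [peakTime, add_assoc]
  exact le_add_of_nonneg_right (by positivity)

lemma peakTime_le {i : ℕ × ℕ} (hr0 : 0 ≤ r i.1) (hr1 : r i.1 ≤ 1)
    (hcell : (peakCell d a δ r i).Nonempty) : peakTime a r i ≤ i.1 + (a + 3) := by
  obtain ⟨p, hstrip, htime⟩ := hcell
  have hend : p.1 ≤ a + i.1 + 1 := hstrip.1.2
  have hstart : a + i.1 + i.2 * r i.1 ^ 2 < p.1 := htime.1
  have hsq : r i.1 ^ 2 ≤ 1 := pow_le_one₀ hr0 hr1
  rw [peakTime]
  linarith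

lemma le_mildKernel_mul_of_mem_peakCell {i : ℕ × ℕ} (hr : 0 < r i.1) (hδ : 0 ≤ δ)
    {p : ℝ × Space d × ℝ} (hp : p ∈ peakCell d a δ r i) :
    heatLowerBound d * (r i.1 ^ d)⁻¹ * δ
      ≤ mildKernel (peakTime a r i) 0 (p.1, p.2.1) * p.2.2 := by
  obtain ⟨⟨-, hball, hjump⟩, hstart, hend⟩ := hp
  have hkernel : heatLowerBound d * (r i.1 ^ d)⁻¹ ≤ mildKernel (peakTime a r i) 0 (p.1, p.2.1) := by
    rw [mildKernel_zero]
    refine heatLowerBound_mul_inv_pow_le hr ?_ ?_ (mem_ball_zero_iff.1 hball).le <;>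
      rw [peakTime] <;> linarith
  exact mul_le_mul hkernel (le_of_lt hjump) hδ (mildKernel_nonneg _ 0 _)

lemma ofReal_le_lintegral_mildKernel_mul {i : ℕ × ℕ} (hr : 0 < r i.1) (hδ : 0 ≤ δ)
    {M : Measure (ℝ × Space d × ℝ)} (hM : 1 ≤ M (peakCell d a δ r i)) :
    ENNReal.ofReal (heatLowerBound d * (r i.1 ^ d)⁻¹ * δ)
      ≤ ∫⁻ p, ENNReal.ofReal (mildKernel (peakTime a r i) 0 (p.1, p.2.1) * p.2.2) ∂M :=
  calc ENNReal.ofReal (heatLowerBound d * (r i.1 ^ d)⁻¹ * δ)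
      ≤ ENNReal.ofReal (heatLowerBound d * (r i.1 ^ d)⁻¹ * δ) * M (peakCell d a δ r i) :=
        le_mul_of_one_le_right zero_le hM
    _ = ∫⁻ _ in peakCell d a δ r i, ENNReal.ofReal (heatLowerBound d * (r i.1 ^ d)⁻¹ * δ) ∂M :=
        (setLIntegral_const _ _).symm
    _ ≤ ∫⁻ p in peakCell d a δ r i,
          ENNReal.ofReal (mildKernel (peakTime a r i) 0 (p.1, p.2.1) * p.2.2) ∂M :=
        setLIntegral_mono' (measurableSet_peakCell i) fun _ hp =>
          ENNReal.ofReal_le_ofReal (le_mildKernel_mul_of_mem_peakCell hr hδ hp)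
    _ ≤ _ := setLIntegral_le_lintegral _ _

end PeakCells

section Peaks

variable {Ω : Type*} [MeasurableSpace Ω] {P : Measure Ω} {d : ℕ} {lam : Measure ℝ}
  {N : Ω → Measure (ℝ × Space d × ℝ)} {a δ C : ℝ} {r : ℕ → ℝ} {F : ℝ → ℝ}

/-- Some peak cell contains a jump, and at the corresponding time `t` the negative jumps
contribute at most `C * t`. -/
def peakEvent (N : Ω → Measure (ℝ × Space d × ℝ)) (a δ C : ℝ) (r : ℕ → ℝ) : Set Ω :=
  ⋃ i, {ω | N ω (peakCell d a δ r i) ≠ 0} ∩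
    {ω | ∫⁻ p, negJumpHeat (peakTime a r i) p ∂(N ω) ≤ ENNReal.ofReal (C * peakTime a r i)}

lemma measurableSet_peakEvent {nu : Measure (ℝ × Space d × ℝ)}
    (hN : IsPoissonRandomMeasure P N nu) : MeasurableSet (peakEvent N a δ C r) :=
  MeasurableSet.iUnion fun i =>
    (hN.measurable_apply (measurableSet_peakCell i) (measurableSet_singleton 0).compl).inter
      (measurableSet_le (hN.measurable_lintegral (measurable_negJumpHeat _)) measurable_const)

lemma le_measure_peakEvent [IsProbabilityMeasure P] [SFinite lam]
    (hN : IsPoissonRandomMeasure P N (jumpIntensity d lam)) (ha : 0 < a) (hC : 0 < C)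
    (hr : ∀ n, 0 < r n) (hsum : ∑' n, ENNReal.ofReal (r n ^ d) = ⊤) (hδ : 0 ≤ δ)
    (hlam : lam (Ioi δ) ≠ 0) :
    1 - (∫⁻ z, ENNReal.ofReal |z| ∂lam) / ENNReal.ofReal C ≤ P (peakEvent N a δ C r) := by
  rw [peakEvent, ← Nat.surjective_unpair.iUnion_comp]
  refine hN.le_measure_iUnion_apply_ne_zero_inter (fun i => measurableSet_peakCell i.unpair)
    (pairwise_disjoint_peakCell.comp_of_injective Nat.pairEquiv.symm.injective) ?_
    (fun i => measurable_negJumpHeat _)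
    (fun j i p hp => negJumpHeat_of_nonneg _ (hδ.trans (le_of_lt hp.1.2.2)))
    (fun i => le_measure_lintegral_negJumpHeat_le hN hC (ha.trans_le (le_peakTime a r _)))
  rw [Nat.surjective_unpair.iUnion_comp (peakCell d a δ r)]
  exact jumpIntensity_iUnion_peakCell_eq_top ha.le hr hsum hlam

lemma ae_exists_le_mildSolution_of_mem_peakEvent
    (hN : IsPoissonRandomMeasure P N (jumpIntensity d lam))
    (hfin : ∀ᵐ ω ∂P, ∀ t : ℝ, 0 ≤ t → ∫⁻ p, jumpHeat t p ∂(N ω) < ⊤) (m : ℝ)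
    (hFmono : MonotoneOn F (Ioi 0)) (hFt : ∀ t, 0 < t → t ≤ F t) (ha : 0 < a) (hC : 0 ≤ C)
    (hδ : 0 ≤ δ) (hr0 : ∀ n, 0 < r n) (hr1 : ∀ n, r n ≤ 1)
    (hr : ∀ n : ℕ, (2 * C + |noiseDrift m lam|) * F (n + (a + 3))
      ≤ heatLowerBound d * (r n ^ d)⁻¹ * δ) :
    ∀ᵐ ω ∂P, ω ∈ peakEvent N a δ C r →
      ∃ t : ℝ, a ≤ t ∧ C * F t ≤ mildSolution m lam (N ω) t 0 := by
  have hcount : ∀ᵐ ω ∂P, ∀ i, N ω (peakCell d a δ r i) ≠ 0 → 1 ≤ N ω (peakCell d a δ r i) :=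
    ae_all_iff.2 fun i => hN.ae_one_le_of_ne_zero (measurableSet_peakCell i)
  filter_upwards [hcount, hfin] with ω hcountω hfinω hω
  obtain ⟨i, hi, hneg⟩ := mem_iUnion.1 hω
  have hat := le_peakTime a r i
  have ht := ha.trans_le hat
  refine ⟨peakTime a r i, hat, ?_⟩
  have hpeak := ofReal_le_lintegral_mildKernel_mul (hr0 i.1) hδ (hcountω i hi)
  have hsol := le_mildSolution_of_lintegral_negJumpHeat_le (lam := lam) ht.le
    (hfinω _ ht.le) m (mul_nonneg hC ht.le) hpeak hneg
  have htop := peakTime_le (hr0 i.1).le (hr1 i.1) (nonempty_of_measure_ne_zero hi)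
  have hF := hFmono ht (ht.trans_le htop) htop
  generalize peakTime a r i = t at *
  have hdrift : -(|noiseDrift m lam| * F t) ≤ noiseDrift m lam * t := by
    have habs := neg_abs_le (noiseDrift m lam * t)
    rw [abs_mul, abs_of_pos ht] at habs
    exact (neg_le_neg (mul_le_mul_of_nonneg_left (hFt t ht) (abs_nonneg _))).trans habs
  have hscale : (2 * C + |noiseDrift m lam|) * F t
      ≤ (2 * C + |noiseDrift m lam|) * F (i.1 + (a + 3)) := by gcongr
  have hneg_le : C * t ≤ C * F t := mul_le_mul_of_nonneg_left (hFt t ht) hC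
  linarith [hr i.1]

lemma exists_pos_le_one_pow_eq_inv (hd : 1 ≤ d) {q : ℝ} (hq : 1 ≤ q) :
    ∃ r : ℝ, 0 < r ∧ r ≤ 1 ∧ r ^ d = q⁻¹ := by
  have hq0 : 0 < q⁻¹ := inv_pos.2 (one_pos.trans_le hq)
  exact ⟨q⁻¹ ^ (d : ℝ)⁻¹, by positivity,
    Real.rpow_le_one hq0.le (inv_le_one_of_one_le₀ hq) (by positivity),
    Real.rpow_inv_natCast_pow hq0.le (Nat.one_le_iff_ne_zero.1 hd)⟩

lemma exists_peak_scales (hd : 1 ≤ d) (hFmono : MonotoneOn F (Ioi 0))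
    (hFt : ∀ t, 0 < t → t ≤ F t)
    (hint : (∫⁻ t in Ioi (1 : ℝ), ENNReal.ofReal (1 / F t)) = ⊤) {b K : ℝ} (hb : 1 ≤ b)
    (hK : 1 ≤ K) :
    ∃ r : ℕ → ℝ, (∀ n, 0 < r n) ∧ (∀ n, r n ≤ 1) ∧ (∀ n : ℕ, (r n ^ d)⁻¹ = K * F (n + b)) ∧
      ∑' n, ENNReal.ofReal (r n ^ d) = ⊤ := by
  have hFpos (t : ℝ) (ht : 0 < t) : 0 < F t := ht.trans_le (hFt t ht)
  have hnb (n : ℕ) : 1 ≤ (n : ℝ) + b := le_add_of_nonneg_of_le n.cast_nonneg hb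
  have hKF (n : ℕ) : 1 ≤ K * F (n + b) :=
    one_le_mul_of_one_le_of_one_le hK ((hnb n).trans (hFt _ (one_pos.trans_le (hnb n))))
  choose r hr0 hr1 hr using fun n => exists_pos_le_one_pow_eq_inv hd (hKF n)
  refine ⟨r, hr0, hr1, fun n => by rw [hr, inv_inv], ?_⟩
  have hK0 : 0 < K⁻¹ := inv_pos.2 (one_pos.trans_le hK)
  have hterm (n : ℕ) : ENNReal.ofReal (r n ^ d)
      = ENNReal.ofReal K⁻¹ * ENNReal.ofReal (1 / F (n + b)) := by
    rw [hr, mul_inv, ENNReal.ofReal_mul hK0.le, one_div]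
  simp only [hterm]
  rw [ENNReal.tsum_mul_left, tsum_eq_top_of_setLIntegral_eq_top
    (antitoneOn_ofReal_one_div hFpos hFmono) ENNReal.ofReal_ne_top hint (one_pos.trans_le hb),
    ENNReal.mul_top (ENNReal.ofReal_pos.2 hK0).ne']

lemma exists_measure_Ioi_pos (h : 0 < lam (Ioi 0)) : ∃ δ : ℝ, 0 < δ ∧ 0 < lam (Ioi δ) := by
  have hunion : ⋃ n : ℕ, Ioi (1 / ((n : ℝ) + 1)) = Ioi (0 : ℝ) := by
    ext x
    simp only [mem_Ioi, mem_iUnion]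
    exact ⟨fun ⟨n, hn⟩ => lt_trans (by positivity) hn, exists_nat_one_div_lt⟩
  rw [← hunion] at h
  obtain ⟨n, hn⟩ := exists_measure_pos_of_not_measure_iUnion_null h.ne'
  exact ⟨_, by positivity, hn⟩

lemma exists_peak_event [IsProbabilityMeasure P] [SFinite lam]
    (hN : IsPoissonRandomMeasure P N (jumpIntensity d lam)) (hd : 1 ≤ d)
    (hfin : ∀ᵐ ω ∂P, ∀ t : ℝ, 0 ≤ t → ∫⁻ p, jumpHeat t p ∂(N ω) < ⊤) (m : ℝ)
    (hFmono : MonotoneOn F (Ioi 0)) (hFt : ∀ t, 0 < t → t ≤ F t)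
    (hint : (∫⁻ t in Ioi (1 : ℝ), ENNReal.ofReal (1 / F t)) = ⊤) (hpos : 0 < lam (Ioi 0))
    (hC : 0 < C) :
    ∃ G : Set Ω, MeasurableSet G ∧
      1 - (∫⁻ z, ENNReal.ofReal |z| ∂lam) / ENNReal.ofReal C ≤ P G ∧
      ∀ᵐ ω ∂P, ω ∈ G → ∃ t : ℝ, C ≤ t ∧ C * F t ≤ mildSolution m lam (N ω) t 0 := by
  obtain ⟨δ, hδ, hlamδ⟩ := exists_measure_Ioi_pos hpos
  have hc : 0 < heatLowerBound d * δ := mul_pos heatLowerBound_pos hδ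
  set B := 2 * C + |noiseDrift m lam|
  obtain ⟨r, hr0, hr1, hr, hsum⟩ := exists_peak_scales hd hFmono hFt hint
    (show 1 ≤ C + 3 by linarith) (le_max_right (B / (heatLowerBound d * δ)) 1)
  refine ⟨peakEvent N C δ C r, measurableSet_peakEvent hN,
    le_measure_peakEvent hN hC hC hr0 hsum hδ.le hlamδ.ne',
    ae_exists_le_mildSolution_of_mem_peakEvent hN hfin m hFmono hFt hC hC.le hδ.le hr0 hr1
      fun n => ?_⟩
  have hFn : 0 ≤ F (n + (C + 3)) := by
    have hn : 0 < (n : ℝ) + (C + 3) := by positivity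
    exact hn.le.trans (hFt _ hn)
  calc B * F (n + (C + 3))
      = heatLowerBound d * δ * (B / (heatLowerBound d * δ)) * F (n + (C + 3)) := by
        rw [mul_div_cancel₀ _ hc.ne']
    _ ≤ heatLowerBound d * δ * max (B / (heatLowerBound d * δ)) 1 * F (n + (C + 3)) := by
        gcongr
        exact le_max_left _ _
    _ = heatLowerBound d * (r n ^ d)⁻¹ * δ := by
        rw [hr]
        ring

lemma ae_frequently_mem_of_tendsto_measure [IsProbabilityMeasure P] {G : ℕ → Set Ω}
    (hG : ∀ n, MeasurableSet (G n)) (hlim : Tendsto (fun n => P (G n)) atTop (𝓝 1)) :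
    ∀ᵐ ω ∂P, ∃ᶠ n in atTop, ω ∈ G n := by
  simp only [frequently_atTop]
  refine ae_all_iff.2 fun j => ?_
  have hmeas : MeasurableSet {ω | ∃ n ≥ j, ω ∈ G n} := by measurability
  refine (mem_ae_iff_prob_eq_one hmeas).2 (le_antisymm prob_le_one (le_of_tendsto hlim ?_))
  filter_upwards [eventually_ge_atTop j] with n hn
  exact measure_mono fun ω hω => ⟨n, hn, hω⟩

lemma limsup_coe_div_eq_top {u f : ℝ → ℝ} (hf : ∀ t, 0 < t → 0 < f t)
    (hu : ∃ᶠ n : ℕ in atTop, ∃ t : ℝ, n ≤ t ∧ n * f t ≤ u t) :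
    limsup (fun t => ((u t / f t : ℝ) : EReal)) atTop = ⊤ := by
  rw [← top_le_iff, ← EReal.ge_of_forall_gt_iff_ge]
  refine fun c _ => le_limsup_of_frequently_le (frequently_atTop.2 fun T => ?_)
    (by isBoundedDefault)
  obtain ⟨n, ⟨t, hnt, hut⟩, hn⟩ := (hu.and_eventually
    (tendsto_natCast_atTop_atTop.eventually_ge_atTop (max (max T c) 1))).exists
  obtain ⟨⟨hTn, hcn⟩, hn1⟩ := by simpa only [max_le_iff] using hn
  have hft := hf t (one_pos.trans_le (hn1.trans hnt))
  refine ⟨t, hTn.trans hnt, EReal.coe_le_coe_iff.2 ((le_div_iff₀ hft).2 (le_trans ?_ hut))⟩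
  gcongr

lemma ae_limsup_mildSolution_div_eq_top [IsProbabilityMeasure P]
    (hN : IsPoissonRandomMeasure P N (jumpIntensity d lam)) (hd : 1 ≤ d)
    (m : ℝ) (hlam : IsLevyMeasure lam) (hκ : ∫⁻ z, ENNReal.ofReal |z| ∂lam < ⊤)
    (hlog : IntegrableOn (fun z : ℝ => |z * Real.log z|) (Icc (-1) 1) lam) {f : ℝ → ℝ}
    (hfpos : ∀ t, 0 < t → 0 < f t) (hfmono : MonotoneOn f (Ioi 0))
    (hint : (∫⁻ t in Ioi (1 : ℝ), ENNReal.ofReal (1 / f t)) = ⊤) (hpos : 0 < lam (Ioi 0)) :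
    ∀ᵐ ω ∂P, limsup (fun t : ℝ => ((mildSolution m lam (N ω) t 0 / f t : ℝ) : EReal)) atTop
      = ⊤ := by
  have := hlam.sigmaFinite
  have hFmono : MonotoneOn (fun t => max (f t) t) (Ioi 0) := fun s hs t ht hst =>
    max_le_max (hfmono hs ht hst) hst
  choose G hGm hGP hG using fun n : ℕ => exists_peak_event hN hd
    (ae_forall_lintegral_jumpHeat_lt_top hN hd hlam hκ hlog) m hFmono
    (fun t _ => le_max_right (f t) t) (lintegral_one_div_max_eq_top hfpos hfmono hint) hpos
    (C := n + 1) (by positivity)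
  have hratio : Tendsto (fun n : ℕ => (∫⁻ z, ENNReal.ofReal |z| ∂lam) /
      ENNReal.ofReal (n + 1)) atTop (𝓝 0) := by
    have hden := ENNReal.tendsto_ofReal_atTop.comp
      (tendsto_atTop_add_const_right atTop (1 : ℝ) tendsto_natCast_atTop_atTop)
    simpa using ENNReal.Tendsto.const_div hden (Or.inr hκ.ne)
  have hGlim : Tendsto (fun n => P (G n)) atTop (𝓝 1) := by
    refine tendsto_of_tendsto_of_tendsto_of_le_of_le ?_ tendsto_const_nhds hGP
      fun n => prob_le_one
    simpa using ENNReal.Tendsto.sub tendsto_const_nhds hratio (Or.inl ENNReal.one_ne_top)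
  filter_upwards [ae_frequently_mem_of_tendsto_measure hGm hGlim, ae_all_iff.2 hG] with ω hω hpeak
  refine limsup_coe_div_eq_top hfpos (hω.mono fun n hn => ?_)
  obtain ⟨t, hnt, hsol⟩ := hpeak n hn
  have ht : 0 < t := lt_of_lt_of_le (by positivity) hnt
  refine ⟨t, by linarith, le_trans ?_ hsol⟩
  have := hfpos t ht
  gcongr
  · linarith
  · exact le_max_left _ _

end Peaks

section Reflection

variable {d : ℕ} {lam : Measure ℝ}

/-- The map `(s, y, z) ↦ (s, y, -z)`, which turns the jumps of the noise into those of its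
negative. -/
noncomputable def reflectJumps (d : ℕ) : (ℝ × Space d × ℝ) ≃ᵐ (ℝ × Space d × ℝ) :=
  (MeasurableEquiv.refl ℝ).prodCongr
    ((MeasurableEquiv.refl (Space d)).prodCongr (MeasurableEquiv.neg ℝ))

lemma reflectJumps_apply (p : ℝ × Space d × ℝ) : reflectJumps d p = (p.1, p.2.1, -p.2.2) := rfl

lemma jumpIntensity_map_neg [SFinite lam] :
    jumpIntensity d (lam.map (MeasurableEquiv.neg ℝ))
      = (jumpIntensity d lam).map (reflectJumps d) := by
  have hspace : (volume : Measure (Space d)).prod (lam.map (MeasurableEquiv.neg ℝ))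
      = (volume.prod lam).map (Prod.map id (MeasurableEquiv.neg ℝ)) := by
    rw [← Measure.map_prod_map _ _ measurable_id (MeasurableEquiv.neg ℝ).measurable,
      Measure.map_id]
  have htime := Measure.map_prod_map ((volume : Measure ℝ).restrict (Ioi 0))
    ((volume : Measure (Space d)).prod lam) measurable_id
    (measurable_id.prodMap (MeasurableEquiv.neg ℝ).measurable)
  rw [Measure.map_id, ← hspace] at htime
  exact htime

lemma IsLevyMeasure.map_neg (hlam : IsLevyMeasure lam) :
    IsLevyMeasure (lam.map (MeasurableEquiv.neg ℝ)) where
  zero_singleton := by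
    have hpre : (MeasurableEquiv.neg ℝ) ⁻¹' {0} = {0} := by
      ext z
      exact neg_eq_zero
    rw [MeasurableEquiv.map_apply, hpre, hlam.zero_singleton]
  lintegral_min_lt_top := by
    rw [lintegral_map_equiv]
    simpa [MeasurableEquiv.neg] using hlam.lintegral_min_lt_top

lemma noiseDrift_map_neg (m : ℝ) :
    noiseDrift (-m) (lam.map (MeasurableEquiv.neg ℝ)) = -noiseDrift m lam := by
  have hmean : ∫ z, (MeasurableEquiv.neg ℝ) z ∂lam = -∫ z, z ∂lam := integral_neg _
  rw [noiseDrift, noiseDrift, integral_map_equiv, hmean]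
  ring

lemma mildSolution_map_neg (m : ℝ) (M : Measure (ℝ × Space d × ℝ)) (t : ℝ) (x : Space d) :
    mildSolution (-m) (lam.map (MeasurableEquiv.neg ℝ)) (M.map (reflectJumps d)) t x
      = -mildSolution m lam M t x := by
  rw [mildSolution, mildSolution, noiseIntegral, noiseIntegral, noiseDrift_map_neg,
    integral_map_equiv]
  simp only [reflectJumps_apply, mul_neg, integral_neg]
  ring

lemma lintegral_abs_map_neg :
    ∫⁻ z, ENNReal.ofReal |z| ∂(lam.map (MeasurableEquiv.neg ℝ))
      = ∫⁻ z, ENNReal.ofReal |z| ∂lam := by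
  rw [lintegral_map_equiv]
  exact lintegral_congr fun z => congrArg ENNReal.ofReal (abs_neg z)

lemma integrableOn_mul_log_map_neg
    (hlog : IntegrableOn (fun z : ℝ => |z * Real.log z|) (Icc (-1) 1) lam) :
    IntegrableOn (fun z : ℝ => |z * Real.log z|) (Icc (-1) 1)
      (lam.map (MeasurableEquiv.neg ℝ)) := by
  have hpre : (MeasurableEquiv.neg ℝ) ⁻¹' (Icc (-1) 1) = Icc (-1) 1 := by
    ext z
    change -z ∈ Icc (-1) 1 ↔ z ∈ Icc (-1) 1
    rw [mem_Icc, mem_Icc, ← abs_le, ← abs_le, abs_neg]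
  rw [MeasurableEmbedding.integrableOn_map_iff (MeasurableEquiv.neg ℝ).measurableEmbedding, hpre]
  simpa [Function.comp_def, MeasurableEquiv.neg] using hlog

lemma map_neg_Ioi_zero : lam.map (MeasurableEquiv.neg ℝ) (Ioi 0) = lam (Iio 0) := by
  rw [MeasurableEquiv.map_apply]
  congr 1
  ext z
  exact neg_pos (a := z)

lemma liminf_coe_eq_neg_limsup_coe_neg {ι : Type*} (l : Filter ι) (u : ι → ℝ) :
    liminf (fun i => (u i : EReal)) l = -limsup (fun i => ((-u i : ℝ) : EReal)) l := by
  rw [← EReal.liminf_neg]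
  congr 1
  funext i
  rw [Pi.neg_apply, EReal.coe_neg, neg_neg]

end Reflection

theorem mainTheorem1 {Ω : Type*} [MeasurableSpace Ω] (P : Measure Ω) [IsProbabilityMeasure P]
    (d : ℕ) (hd : 1 ≤ d) (m : ℝ) (lam : Measure ℝ) (hlam : IsLevyMeasure lam)
    (hmoment : ∃ ε : ℝ, 0 < ε ∧ Integrable (fun z : ℝ => |z| ^ (1 + ε)) lam)
    (hlog : IntegrableOn (fun z : ℝ => |z * Real.log z|) (Icc (-1) 1) lam)
    (N : Ω → Measure (ℝ × Space d × ℝ))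
    (hN : IsPoissonRandomMeasure P N (jumpIntensity d lam))
    (f : ℝ → ℝ) (hfpos : ∀ t, 0 < t → 0 < f t) (hfmono : MonotoneOn f (Ioi 0)) :
    -- the integral that defines `Y(t,0)` converges absolutely for all `t`, almost surely
    (∀ᵐ ω ∂P, ∀ t : ℝ, 0 < t → NoiseIntegrable (N ω) (mildKernel t (0 : Space d))) ∧
    -- (1)
    ((∫⁻ t in Ioi (1 : ℝ), ENNReal.ofReal (1 / f t)) = ⊤ →
      (0 < lam (Ioi 0) → ∀ᵐ ω ∂P,
        limsup (fun t : ℝ => ((mildSolution m lam (N ω) t 0 / f t : ℝ) : EReal)) atTop = ⊤) ∧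
      (0 < lam (Iio 0) → ∀ᵐ ω ∂P,
        liminf (fun t : ℝ => ((mildSolution m lam (N ω) t 0 / f t : ℝ) : EReal)) atTop = ⊥)) ∧
    -- (2)
    ((∫⁻ t in Ioi (1 : ℝ), ENNReal.ofReal (1 / f t)) < ⊤ →
      ∀ᵐ ω ∂P, Tendsto (fun t : ℝ => mildSolution m lam (N ω) t 0 / f t) atTop (𝓝 0)) ∧
    -- (3)
    (lam (Ioi 0) = 0 → ∀ᵐ ω ∂P,
      limsup (fun t : ℝ => ((mildSolution m lam (N ω) t 0 / t : ℝ) : EReal)) atTop = (m : EReal)) ∧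
    (lam (Iio 0) = 0 → ∀ᵐ ω ∂P,
      liminf (fun t : ℝ => ((mildSolution m lam (N ω) t 0 / t : ℝ) : EReal)) atTop
        = (m : EReal)) := by
  have hσ := hlam.sigmaFinite
  have hκ := hlam.lintegral_abs_lt_top hmoment hlog
  have hlam' := hlam.map_neg
  have hlog' := integrableOn_mul_log_map_neg hlog
  have hκ' := lintegral_abs_map_neg.trans_lt hκ
  have hN' := hN.map (reflectJumps d).measurable
  rw [← jumpIntensity_map_neg] at hN'
  refine ⟨?_, fun hint => ⟨fun hpos => ?_, fun hneg => ?_⟩, fun hint => ?_, fun hpos => ?_,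
    fun hneg => ?_⟩
  · filter_upwards [ae_forall_lintegral_jumpHeat_lt_top hN hd hlam hκ hlog] with ω hω t ht
    exact ⟨integrable_mildKernel t 0, integrable_mildKernel_mul (hω t ht.le)⟩
  · exact ae_limsup_mildSolution_div_eq_top hN hd m hlam hκ hlog hfpos hfmono hint hpos
  · rw [← map_neg_Ioi_zero] at hneg
    filter_upwards [ae_limsup_mildSolution_div_eq_top hN' hd (-m) hlam' hκ' hlog' hfpos hfmono
      hint hneg] with ω hω
    simp only [mildSolution_map_neg, neg_div] at hω
    rw [liminf_coe_eq_neg_limsup_coe_neg, hω, EReal.neg_top]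
  · exact ae_tendsto_mildSolution_div hN hd m hlam hmoment hlog hfpos hfmono hint
  · exact ae_limsup_mildSolution_div_eq hN hd m hlam hκ hlog hpos
  · rw [← map_neg_Ioi_zero] at hneg
    filter_upwards [ae_limsup_mildSolution_div_eq hN' hd (-m) hlam' hκ' hlog' hneg] with ω hω
    simp only [mildSolution_map_neg, neg_div] at hω
    rw [liminf_coe_eq_neg_limsup_coe_neg, hω, EReal.coe_neg, neg_neg]
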